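/- **Conventions.** A *presemifield* is a finite, not necessarily associative, division algebra (nonzero, biadditive multiplication, no zero divisors); a *semifield* is a presemifield with a multiplicative identity. The *parameters* of a semifield $A$ are $$(|A|,\ |\mathbb N_l(A)|,\ |\mathbb N_m(A)|,\ |\mathbb N_r(A)|,\ |Z(A)|),$$ the orders of $A$, of its left, middle and right nucleus, and of its centre. Two algebras are *isotopic* if $h_1(a\star b)=h_2(a)\star' h_3(b)$ for some additive bijections $h_1,h_2,h_3$. **Skew polynomial data.** Let $\mathbb K=\mathbb F_q\subset\mathbb L=\mathbb F_{q^n}$, let $\sigma$ generate $\mathrm{Gal}(\mathbb L/\mathbb K)$, and let $R=\mathbb L[x;\sigma]$ be the skew polynomial ring, with $xa=\sigma(a)x$. Let $F(y)\neq y$ be a monic irreducible polynomial of degree $s$ over $\mathbb K$ with constant coefficient $F_0$, and let $f$ be a monic irreducible factor of $F(x^n)$ in $R$, with constant coefficient $f_0$. Elements of $R/Rf$ are represented by skew polynomials $\sum_i a_ix^i$ of degree less than $\deg f=s$. **The family $\mathcal D_{n,s}$ over $\mathbb F_q$.** Let $n=2t$, let $\mathbb L'=\mathbb F_{q^t}\subset\mathbb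 L$, and let $\gamma\in\mathbb L$ be such that $\gamma/f_0\notin\mathbb L'$ and $\mathrm N_{\mathbb L/\mathbb K}(\gamma)$ is not a square in $\mathbb K$. The members of $\mathcal D_{n,s}$ are the algebras $R/Rf$ with $$a\star b=\Big(a-\frac{\gamma}{f_0}\,a_0''\,f\Big)b ,$$ where the constant coefficient of $a$ is written as $a_0'+\gamma a_0''$ with $a_0',a_0''\in\mathbb L'$. **The presemifields $S_{n,s,1}(\eta,\rho,F)$ over $\mathbb F_q$.** Here $q$ is any prime power, $n\ge2$ and $s\ge1$. Let $\rho\in\mathrm{Aut}(\mathbb L)$ and $\mathbb K'=\mathrm{Fix}(\rho)\cap\mathbb K$, and let $\eta\in\mathbb L$ satisfy $\mathrm N_{\mathbb L/\mathbb K'}(\eta)\,\mathrm N_{\mathbb K/\mathbb K'}((-1)^{s(n-1)}F_0)\ne1$. These are the algebras $R/Rf$ with $a\circ b=(a+\eta\,\rho(a_0)\,x^{s})\,b$, where $a_0$ is the constant coefficient of $a$. **Previously known semifields.** Here this means the following semifields. 1. Semifields of rank two, that is, of order $|N|^2$ for one of their three nuclei $N$. 2. Semifields isotopic to a Pott–Zhou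 presemifield: $\mathbb F_{p^m}^2$ with $$(x,y)*(u,v)=\big(x^{p^k}u+xu^{p^k}+\alpha\,\tau(y^{p^k}v+yv^{p^k}),\ xv+yu\big),$$ where $p$ is an odd prime, $m/\gcd(m,k)$ is odd, $\alpha$ is a nonsquare and $\tau\in\mathrm{Aut}(\mathbb F_{p^m})$. 3. Semifields isotopic to some $S_{n',s',1}(\eta,\rho,F')$ as above, over any finite field. 4. All semifields whose parameters, up to a permutation of the three nuclei, have one of the following forms, which contain the parameters tabulated in the literature for the known constructions. Here $p$ is a prime, the other letters are natural numbers, $(\cdot,\dots,\cdot)$ is the greatest common divisor, and a dot means that the centre is unrestricted. - $(p^{2m},p^{(m,i,j)},p^{(m,i)},p^{(m,i,j)},p^{(m,i,j)})$ (Pott–Zhou); - $(p^{nse},p^{(ne,h)},p^{(ne,\,jes-h)},p^{es},p^{(e,h)})$ with $(j,n)=1$ ($S_{n,s,1}(\eta,\rho,F)$ with $\eta\neq0$); - $(p^{nse},p^{en},p^{en},p^{es},p^{e})$ ($S_{n,s,1}(0,\rho,F)$); - $(p^{2m},p^{c},p^{c},p^{2c},\cdot)$ (Göloğlu–Kölsch);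 - $(p^{2m},p^{(a,b,m)},p^{(a,b,m)},p^{(2a,m)},\cdot)$ (Kölsch's unifying construction). A parameter tuple is called *new* if no previously known semifield has these parameters, even up to a permutation of the three nuclei. **Proposition.** Let $q$ be an odd prime power, $t\ge2$, $n=2t$ and $s\ge2$. (a) The family $\mathcal D_{n,s}$ over $\mathbb F_q$ is non-empty, and each of its members is a semifield with parameters $(q^{2ts},q^t,q^t,q^s,q)$. (b) If moreover $s$ is even and $n\nmid s$, then these parameters are new, and no member of $\mathcal D_{n,s}$ is isotopic to a previously known semifield. (c) For every odd prime power $q$, infinitely many different new parameter tuples are attained by members of families $\mathcal D_{n,s}$ over $\mathbb F_q$ with $n=2t\ge4$, $s\ge2$ even and $n\nmid s$. (d) For every odd prime power $q$, the smallest such case is $n=4$, $s=2$: a member of $\mathcal D_{4,2}$ attains the new parameters $(q^8,q^2,q^2,q^2,q)$, and all members of $\mathcal D_{n,s}$ as in (c) have order at least $q^8$, with equality exactly for $n=4$, $s=2$. -/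

import Mathlib

open Polynomial

universe u v

/-! ### Skew polynomials `L[x; σ]` -/

/-- The action of `ℕ` on `L` by the powers of `σ`. -/
@[reducible]
noncomputable def skewAction {L : Type u} [Field L] (σ : L ≃+* L) :
    MulSemiringAction (Multiplicative ℕ) L :=
  MulSemiringAction.compHom L (powersHom (L ≃+* L) σ)

/-- The skew polynomial ring `L[x; σ]`: polynomials with left coefficients in `L`, multiplied by
the rule `x a = σ(a) x`. -/
def SkewRing {L : Type u} [Field L] (_σ : L ≃+* L) : Type u := SkewPolynomial L

namespace SkewRing

section
variable {L : Type u} [Field L] {σ : L ≃+* L}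

noncomputable instance : Ring (SkewRing σ) :=
  letI := skewAction σ
  inferInstanceAs (Ring (SkewMonoidAlgebra L (Multiplicative ℕ)))

/-- The coefficient of `x ^ i`. -/
noncomputable def coeff (p : SkewRing σ) (i : ℕ) : L := SkewPolynomial.coeff p i

variable (σ) in
/-- The monomial `a x ^ i`. -/
noncomputable def monomial (i : ℕ) (a : L) : SkewRing σ :=
  (SkewPolynomial.monomial i a : SkewPolynomial L)

theorem monomial_mul_monomial (i j : ℕ) (a b : L) :
    monomial σ i a * monomial σ j b = monomial σ (i + j) (a * (σ ^ i) b) := by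
  let _ := skewAction σ
  have h := SkewPolynomial.monomial_mul_monomial i j a b
  rw [SkewPolynomial.φ_iterate_apply] at h
  exact h

theorem coeff_monomial (i j : ℕ) (a : L) :
    (monomial σ i a).coeff j = if i = j then a else 0 :=
  SkewPolynomial.coeff_monomial

/-- The degree (with value `0` at the zero polynomial). -/
noncomputable def natDegree (p : SkewRing σ) : ℕ :=
  (SkewPolynomial.support (p : SkewPolynomial L)).sup id

/-- The leading coefficient is `1`. -/
def Monic (p : SkewRing σ) : Prop := p.coeff p.natDegree = 1

/-- The left `R`-module `R / R f`, where `R = L[x; σ]`. -/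
abbrev Quot (f : SkewRing σ) : Type u :=
  SkewRing σ ⧸ Submodule.span (SkewRing σ) ({f} : Set (SkewRing σ))

/-- The representative of degree less than `deg f` of an element of `R / R f`. -/
noncomputable def rep {f : SkewRing σ} (a : Quot f) : SkewRing σ :=
  letI := Classical.propDecidable
    (∃ r : SkewRing σ, (∀ i, f.natDegree ≤ i → r.coeff i = 0) ∧ (Submodule.Quotient.mk r : Quot f) = a)
  if h : ∃ r : SkewRing σ, (∀ i, f.natDegree ≤ i → r.coeff i = 0) ∧
      (Submodule.Quotient.mk r : Quot f) = a
  then h.choose else 0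

end

end SkewRing

/-! ### Semifields, nuclei, parameters, isotopy -/

section
variable {A : Type u} [AddCommGroup A]

/-- A finite (not necessarily unital, not necessarily associative) division algebra, given by its
multiplication on a finite abelian group. -/
structure IsPresemifield (mul : A → A → A) : Prop where
  finite : Finite A
  nontrivial : Nontrivial A
  left_distrib : ∀ a b c, mul a (b + c) = mul a b + mul a c
  right_distrib : ∀ a b c, mul (a + b) c = mul a c + mul b c
  eq_zero_or_eq_zero : ∀ a b, mul a b = 0 → a = 0 ∨ b = 0

/-- A semifield is a finite unital division algebra. -/
structure IsSemifield (mul : A → A → A) : Prop extends IsPresemifield mul where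
  exists_one : ∃ e, ∀ a, mul e a = a ∧ mul a e = a

/-- The left nucleus. -/
def leftNucleus (mul : A → A → A) : Set A :=
  {a | ∀ b c, mul a (mul b c) = mul (mul a b) c}

/-- The middle nucleus. -/
def middleNucleus (mul : A → A → A) : Set A :=
  {b | ∀ a c, mul a (mul b c) = mul (mul a b) c}

/-- The right nucleus. -/
def rightNucleus (mul : A → A → A) : Set A :=
  {c | ∀ a b, mul a (mul b c) = mul (mul a b) c}

/-- The centre: the elements of all three nuclei that commute with everything. -/
def centre (mul : A → A → A) : Set A :=
  {a | a ∈ leftNucleus mul ∧ a ∈ middleNucleus mul ∧ a ∈ rightNucleus mul ∧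
    ∀ b, mul a b = mul b a}

/-- A 5-tuple of orders: the algebra, its left, middle and right nucleus, its centre. -/
@[ext]
structure NuclearParams where
  order : ℕ
  left : ℕ
  middle : ℕ
  right : ℕ
  centre : ℕ

/-- The parameters of a semifield. -/
noncomputable def nuclearParams (mul : A → A → A) : NuclearParams where
  order := Nat.card A
  left := Nat.card (leftNucleus mul)
  middle := Nat.card (middleNucleus mul)
  right := Nat.card (rightNucleus mul)
  centre := Nat.card (centre mul)

/-- Equality of parameters up to a permutation of the three nuclei. -/
def NuclearParams.SameUpToPerm (P Q : NuclearParams) : Prop :=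
  P.order = Q.order ∧ [P.left, P.middle, P.right].Perm [Q.left, Q.middle, Q.right] ∧
    P.centre = Q.centre

/-- Isotopy of division algebras. -/
def Isotopic {B : Type v} [AddCommGroup B] (mulA : A → A → A) (mulB : B → B → B) : Prop :=
  ∃ h₁ h₂ h₃ : A ≃+ B, ∀ a b, h₁ (mulA a b) = mulB (h₂ a) (h₃ b)

end

/-! ### The two families of semifields from skew polynomial rings -/

/-- The common data: the extension `L / K` of degree `n`, with `K` of order `q`, a generator `σ`
of its Galois group, a monic irreducible `F(y) ≠ y` of degree `s` over `K`, and a monic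
irreducible factor `f` of `F(x ^ n)` in `R = L[x; σ]`. -/
structure SkewData (q n s : ℕ) where
  K : Type u
  L : Type u
  [fieldK : Field K]
  [fieldL : Field L]
  [finiteK : Finite K]
  [finiteL : Finite L]
  [algebra : Algebra K L]
  card_K : Nat.card K = q
  finrank_L : Module.finrank K L = n
  σ : L ≃ₐ[K] L
  σ_generates : ∀ τ : L ≃ₐ[K] L, τ ∈ Subgroup.zpowers σ
  F : K[X]
  F_monic : F.Monic
  F_irreducible : Irreducible F
  F_ne_X : F ≠ X
  F_natDegree : F.natDegree = s
  f : SkewRing (σ : L ≃+* L)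
  f_monic : f.Monic
  f_irreducible : Irreducible f
  f_factor : ∃ g : SkewRing (σ : L ≃+* L),
    (F.sum fun i a => SkewRing.monomial (σ : L ≃+* L) (n * i) (algebraMap K L a)) = g * f

attribute [instance] SkewData.fieldK SkewData.fieldL SkewData.finiteK SkewData.finiteL
  SkewData.algebra

namespace SkewData

/-- The group `R / R f`. -/
abbrev Carrier {q n s : ℕ} (S : SkewData.{u} q n s) : Type u := SkewRing.Quot S.f

end SkewData

/-- The data of a semifield of the family `𝒟_{n,s}` over the field of order `q`: in addition to
the common data, the intermediate field `L'` with `[L : L'] = 2` and the element `γ`. -/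
structure DData (q n s : ℕ) extends SkewData.{u} q n s where
  L' : IntermediateField K L
  finrank_L' : 2 * Module.finrank K L' = n
  γ : L
  γ_div_notMem : γ / f.coeff 0 ∉ L'
  γ_norm : ¬ IsSquare (Algebra.norm K γ)

namespace DData

section
variable {q n s : ℕ} (D : DData.{u} q n s)

/-- The component `a''` of `c = a' + γ a''` with `a', a'' ∈ L'`. -/
noncomputable def second (c : D.L) : D.L :=
  letI := Classical.propDecidable (∃ a'' ∈ D.L', c - D.γ * a'' ∈ D.L')
  if h : ∃ a'' ∈ D.L', c - D.γ * a'' ∈ D.L' then h.choose else 0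

/-- The multiplication `a ⋆ b = (a - (γ / f₀) a₀'' f) b` on `R / R f`, for `a` of degree less than
`deg f` with constant coefficient `a₀' + γ a₀''`. -/
noncomputable def mul (a b : D.Carrier) : D.Carrier :=
  (SkewRing.rep a -
    SkewRing.monomial (D.σ : D.L ≃+* D.L) 0
      (D.γ / D.f.coeff 0 * D.second ((SkewRing.rep a).coeff 0)) * D.f) • b

end

end DData

/-- The data of a presemifield with spread set `S_{n,s,1}(η, ρ, F)`; here `K'` is the field of
those elements of `K` that are fixed by `ρ`. -/
structure SData (q n s : ℕ) extends SkewData.{u} q n s where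
  two_le : 2 ≤ n
  ρ : L ≃+* L
  η : L
  η_norm :
    Algebra.norm (((ρ : L →+* L).comp (algebraMap K L)).eqLocusField (algebraMap K L)) η *
      Algebra.norm (((ρ : L →+* L).comp (algebraMap K L)).eqLocusField (algebraMap K L))
        ((-1) ^ (s * (n - 1)) * F.coeff 0) ≠ 1

namespace SData

section
variable {q n s : ℕ} (S : SData.{u} q n s)

/-- The multiplication `a ∘ b = (a + η a₀^ρ x ^ s) b` on `R / R f`, for `a` of degree less than
`deg f` with constant coefficient `a₀`. -/
noncomputable def mul (a b : S.Carrier) : S.Carrier :=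
  (SkewRing.rep a +
    SkewRing.monomial (S.σ : S.L ≃+* S.L) s (S.η * S.ρ ((SkewRing.rep a).coeff 0))) • b

end

end SData

/-! ### The previously known semifields -/

/-- The Pott-Zhou multiplication on `E × E`, with `x ∘ u = x ^ (p ^ k) u + x u ^ (p ^ k)`. -/
def pottZhouMul {E : Type u} [Field E] (p k : ℕ) (τ : E ≃+* E) (α : E) (a b : E × E) : E × E :=
  ((a.1 ^ p ^ k * b.1 + a.1 * b.1 ^ p ^ k) + α * τ (a.2 ^ p ^ k * b.2 + a.2 * b.2 ^ p ^ k),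
    a.1 * b.2 + a.2 * b.1)

/-- The tabulated parameters of the known constructions. The centre is not specified in the last
two rows. -/
inductive TabulatedParams : NuclearParams → Prop
  /-- Pott-Zhou -/
  | pottZhou (p n i j : ℕ) (hp : p.Prime) :
      TabulatedParams ⟨p ^ (2 * n), p ^ (n.gcd (i.gcd j)), p ^ (n.gcd i), p ^ (n.gcd (i.gcd j)),
        p ^ (n.gcd (i.gcd j))⟩
  /-- `S_{n,s,1}(η, ρ, F)` with `η ≠ 0` over the field of order `p ^ e`, where `ρ` is the `h`-th
  power of the Frobenius automorphism `y ↦ y ^ p` and `σ` is its `e j`-th power -/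
  | twisted (p e n s h j : ℕ) (hp : p.Prime) (hj : j.Coprime n) :
      TabulatedParams ⟨p ^ (n * s * e), p ^ ((n * e).gcd h),
        p ^ (Int.gcd (n * e) (j * (e * s) - h)), p ^ (e * s), p ^ (e.gcd h)⟩
  /-- `S_{n,s,1}(0, ρ, F)` -/
  | cyclic (p e n s : ℕ) (hp : p.Prime) :
      TabulatedParams ⟨p ^ (n * s * e), p ^ (e * n), p ^ (e * n), p ^ (e * s), p ^ e⟩
  /-- Göloğlu-Kölsch, with `e = 2 * c` -/
  | gologluKolsch (p m c z : ℕ) (hp : p.Prime) :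
      TabulatedParams ⟨p ^ (2 * m), p ^ c, p ^ c, p ^ (2 * c), z⟩
  /-- Kölsch -/
  | kolsch (p m a b z : ℕ) (hp : p.Prime) :
      TabulatedParams ⟨p ^ (2 * m), p ^ (a.gcd (b.gcd m)), p ^ (a.gcd (b.gcd m)),
        p ^ ((2 * a).gcd m), z⟩

/-- The semifields that are regarded as previously known: those of rank two (two-dimensional over
one of their nuclei), the isotopes of the Pott-Zhou presemifields, the isotopes of the
presemifields with spread set `S_{n,s,1}(η, ρ, F)`, and all semifields whose parameters are, up to
a permutation of the nuclei, in the table. -/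
inductive IsKnown {B : Type v} [AddCommGroup B] (mul : B → B → B) : Prop
  | rankTwo
      (h : Nat.card B = Nat.card (leftNucleus mul) ^ 2 ∨
        Nat.card B = Nat.card (middleNucleus mul) ^ 2 ∨
        Nat.card B = Nat.card (rightNucleus mul) ^ 2)
  | pottZhou (p m k : ℕ) (hp : p.Prime) (hodd : Odd p) (hm : Odd (m / m.gcd k))
      (E : Type) [Field E] [Finite E] (hE : Nat.card E = p ^ m) (τ : E ≃+* E) (α : E)
      (hα : ¬ IsSquare α) (h : Isotopic (pottZhouMul p k τ α) mul)
  | skew (q n s : ℕ) (S : SData.{0} q n s) (h : Isotopic S.mul mul)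
  | tabulated (Q : NuclearParams) (hQ : TabulatedParams Q)
      (h : (nuclearParams mul).SameUpToPerm Q)

/-- No previously known semifield has the parameters `P`, even up to a permutation of the
nuclei. -/
def IsNewParams (P : NuclearParams) : Prop :=
  ∀ (B : Type v) [AddCommGroup B] (mul : B → B → B), IsSemifield mul → IsKnown mul →
    ¬ (nuclearParams mul).SameUpToPerm P

/-! Write M = R/Rf, and N for the norm from L to K. The skew polynomial F(x^n) is central in R and
kills the simple module M. Skew polynomials of degree less than ns act faithfully on M
(`SkewData.eq_zero_of_smul_eq_zero`) and, by Jacobson density, give all maps that are linear over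
the finite field End_R(M). Counting yields |End_R(M)| = q^s and deg f = s (`SkewData.card_end`,
`SkewData.f_natDegree`). If g has degree at most s and kills a nonzero vector, then N(g_0) = N(f_0)
N(g_s); this comes from determinants of companion matrices (`SkewData.norm_of_smul_eq_zero`).

In the family D, multiplication by a is the action of a skew polynomial of degree at most s with
constant coefficient in L' and coefficient of x^s in (γ/f_0)L'. Norms of elements of L' are squares
because [L : L'] = 2, so a zero divisor would make N(γ) a square. For the nuclei, an additive map
that respects this spread set on the left or in the middle is the action of some p. Multiplying p
with b x^(s-1) and comparing degrees and top coefficients forces p to be a constant in L'. The right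
nucleus is End_R(M). See `SkewData.mapParams_of_one_mem` and `DData.nuclearParams_mul`.

Newness is a comparison of invariants. Nuclei of presemifields are replaced by groups of additive
maps whose sizes are isotopy invariants and agree with the nuclei when there is an identity
(`Isotopic.mapParams_eq`, `IsSemifield.nuclearParams_eq`). Rank two contradicts the sizes. A
commutative presemifield, such as that of Pott and Zhou, has left invariant equal to its centre,
whereas here all nuclei exceed the centre. The presemifields S have rank two for n = 2, are
generalized twisted fields for s = 1, and otherwise are computed from their spread set; up to
degenerate cases their parameters are in the table (`SData.nuclearParams_of_isotopic`). The table is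
excluded by comparing exponents (`not_sameUpToPerm_of_tabulated`): each row leads to 2t | s or
contradicts the order or the centre.

Members exist because F(x^n) has an irreducible right factor, and because γ can be multiplied by a
square without changing the square class of its norm. -/

namespace SkewRing

/-! ### Coefficients, degree and division in the skew polynomial ring -/

section
variable {L : Type u} [Field L] {σ : L ≃+* L}

@[ext]
theorem ext {p q : SkewRing σ} (h : ∀ i, p.coeff i = q.coeff i) : p = q :=
  SkewMonoidAlgebra.ext fun a => h (Multiplicative.toAdd a)

@[simp] theorem coeff_zero (i : ℕ) : (0 : SkewRing σ).coeff i = 0 := rfl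

@[simp] theorem coeff_add (p q : SkewRing σ) (i : ℕ) :
    (p + q).coeff i = p.coeff i + q.coeff i := by
  have h := SkewMonoidAlgebra.coeff_add (k := L) (G := Multiplicative ℕ) p q
  exact DFunLike.congr_fun h (Multiplicative.ofAdd i)

/-- The `i`-th coefficient as an additive map. -/
noncomputable def coeffHom (i : ℕ) : SkewRing σ →+ L where
  toFun p := p.coeff i
  map_zero' := rfl
  map_add' p q := coeff_add p q i

@[simp] theorem coeff_neg (p : SkewRing σ) (i : ℕ) : (-p).coeff i = -p.coeff i :=
  (coeffHom i).map_neg p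

@[simp] theorem coeff_sub (p q : SkewRing σ) (i : ℕ) :
    (p - q).coeff i = p.coeff i - q.coeff i :=
  (coeffHom i).map_sub p q

theorem coeff_sum {ι : Type*} (s : Finset ι) (g : ι → SkewRing σ) (i : ℕ) :
    (∑ j ∈ s, g j).coeff i = ∑ j ∈ s, (g j).coeff i :=
  map_sum (coeffHom i) g s

theorem monomial_add (i : ℕ) (a b : L) :
    monomial σ i (a + b) = monomial σ i a + monomial σ i b := by
  ext j
  simp only [coeff_monomial, coeff_add]
  split_ifs <;> simp

theorem one_eq_monomial : (1 : SkewRing σ) = monomial σ 0 1 := rfl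

theorem coeff_one (i : ℕ) : (1 : SkewRing σ).coeff i = if i = 0 then 1 else 0 := by
  rw [one_eq_monomial, coeff_monomial]
  simp [eq_comm]

theorem induction {P : SkewRing σ → Prop} (h0 : P 0) (hadd : ∀ p q, P p → P q → P (p + q))
    (hm : ∀ i a, P (monomial σ i a)) (p : SkewRing σ) : P p := by
  refine SkewPolynomial.induction (R := L) (motive := P) p h0 ?_
  intro i a q _ _ hq
  exact hadd _ _ (hm i a) hq

theorem coeff_monomial_mul (i : ℕ) (a : L) (q : SkewRing σ) (k : ℕ) :
    (monomial σ i a * q).coeff k = if i ≤ k then a * (σ ^ i) (q.coeff (k - i)) else 0 := by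
  induction q using induction with
  | h0 => simp
  | hadd p q hp hq => rw [mul_add, coeff_add, hp, hq]; split_ifs <;> simp [mul_add]
  | hm j b =>
    rw [monomial_mul_monomial, coeff_monomial, coeff_monomial]
    by_cases h : i ≤ k
    · rw [if_pos h]
      by_cases h' : i + j = k
      · rw [if_pos h', if_pos (by omega)]
      · rw [if_neg h', if_neg (by omega)]; simp
    · rw [if_neg h, if_neg (by omega)]

theorem coeff_mul (p q : SkewRing σ) (k : ℕ) :
    (p * q).coeff k = ∑ i ∈ Finset.range (k + 1), p.coeff i * (σ ^ i) (q.coeff (k - i)) := by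
  induction p using induction with
  | h0 => simp
  | hadd p q hp hq => rw [add_mul, coeff_add, hp, hq]; simp [add_mul, Finset.sum_add_distrib]
  | hm j b =>
    rw [coeff_monomial_mul]
    simp only [coeff_monomial, ite_mul, zero_mul, Finset.sum_ite_eq, Finset.mem_range]
    simp

/-- The embedding of the constants. -/
noncomputable def const : L →+* SkewRing σ where
  toFun := monomial σ 0
  map_one' := rfl
  map_mul' a b := by rw [monomial_mul_monomial]; simp
  map_zero' := by ext; simp [coeff_monomial]
  map_add' := monomial_add 0

/-- The variable. -/
noncomputable def var : SkewRing σ := monomial σ 1 1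

theorem monomial_zero_left (a : L) : monomial σ 0 a = const a := rfl

theorem var_pow (i : ℕ) : (var : SkewRing σ) ^ i = monomial σ i 1 := by
  induction i with
  | zero => rfl
  | succ i ih => rw [pow_succ, ih, var, monomial_mul_monomial]; simp

theorem monomial_eq (i : ℕ) (a : L) : monomial σ i a = const a * var ^ i := by
  rw [var_pow, ← monomial_zero_left, monomial_mul_monomial]; simp

theorem var_pow_mul_const (i : ℕ) (a : L) : (var : SkewRing σ) ^ i * const a = const ((σ ^ i) a) * var ^ i := by
  rw [← monomial_eq, var_pow, ← monomial_zero_left, monomial_mul_monomial]; simp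

theorem var_mul_const (a : L) : (var : SkewRing σ) * const a = const (σ a) * var := by
  simpa using var_pow_mul_const (σ := σ) 1 a

@[simp] theorem coeff_const_mul (a : L) (p : SkewRing σ) (i : ℕ) :
    (const a * p).coeff i = a * p.coeff i := by
  rw [← monomial_zero_left, coeff_monomial_mul]; simp

theorem coeff_const (a : L) (i : ℕ) : (const a : SkewRing σ).coeff i = if i = 0 then a else 0 := by
  rw [← monomial_zero_left, coeff_monomial]; simp [eq_comm]

@[simp] theorem coeff_const_zero (a : L) : (const a : SkewRing σ).coeff 0 = a := by simp [coeff_const]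

theorem coeff_mul_monomial (p : SkewRing σ) (i : ℕ) (a : L) (k : ℕ) :
    (p * monomial σ i a).coeff k = if i ≤ k then p.coeff (k - i) * (σ ^ (k - i)) a else 0 := by
  induction p using induction with
  | h0 => simp
  | hadd p q hp hq => rw [add_mul, coeff_add, hp, hq]; split_ifs <;> simp [add_mul]
  | hm j b =>
    rw [monomial_mul_monomial, coeff_monomial, coeff_monomial]
    by_cases h : i ≤ k
    · rw [if_pos h]
      by_cases h' : j + i = k
      · rw [if_pos h', if_pos (by omega)]
        obtain rfl : j = k - i := by omega
        rfl
      · rw [if_neg h', if_neg (by omega)]; simp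
    · rw [if_neg h, if_neg (by omega)]

theorem coeff_mul_const (p : SkewRing σ) (a : L) (k : ℕ) :
    (p * const a).coeff k = p.coeff k * (σ ^ k) a := by
  rw [← monomial_zero_left, coeff_mul_monomial]; simp

theorem coeff_var_pow_mul (i : ℕ) (q : SkewRing σ) (k : ℕ) :
    (var ^ i * q).coeff k = if i ≤ k then (σ ^ i) (q.coeff (k - i)) else 0 := by
  rw [var_pow, coeff_monomial_mul]; simp

theorem coeff_mul_var_pow (p : SkewRing σ) (i k : ℕ) :
    (p * var ^ i).coeff k = if i ≤ k then p.coeff (k - i) else 0 := by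
  rw [var_pow, coeff_mul_monomial]; simp

@[simp] theorem coeff_var_mul_zero (q : SkewRing σ) : (var * q).coeff 0 = 0 := by
  simpa using coeff_var_pow_mul (σ := σ) 1 q 0

@[simp] theorem coeff_var_mul_succ (q : SkewRing σ) (k : ℕ) :
    (var * q).coeff (k + 1) = σ (q.coeff k) := by
  simpa using coeff_var_pow_mul (σ := σ) 1 q (k + 1)

@[simp] theorem coeff_mul_var_zero (q : SkewRing σ) : (q * var).coeff 0 = 0 := by
  simpa using coeff_mul_var_pow (σ := σ) q 1 0

@[simp] theorem coeff_mul_var_succ (q : SkewRing σ) (k : ℕ) :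
    (q * var).coeff (k + 1) = q.coeff k := by
  simpa using coeff_mul_var_pow (σ := σ) q 1 (k + 1)

theorem coeff_mul_zero (p q : SkewRing σ) : (p * q).coeff 0 = p.coeff 0 * q.coeff 0 := by
  simp [coeff_mul]

/-- The skew polynomials of degree less than `N`. -/
def degLT (σ : L ≃+* L) (N : ℕ) : AddSubgroup (SkewRing σ) where
  carrier := {p | ∀ i, N ≤ i → p.coeff i = 0}
  zero_mem' := fun _ _ => rfl
  add_mem' := fun hp hq i hi => by rw [coeff_add, hp i hi, hq i hi, add_zero]
  neg_mem' := fun hp i hi => by rw [coeff_neg, hp i hi, neg_zero]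

theorem degLT_mono {M N : ℕ} (h : M ≤ N) : degLT σ M ≤ degLT σ N :=
  fun _ hp i hi => hp i (h.trans hi)

theorem degLT_zero {p : SkewRing σ} (h : p ∈ degLT σ 0) : p = 0 := by
  ext i; exact h i (Nat.zero_le _)

theorem mem_degLT_of_coeff_eq_zero {N : ℕ} {p : SkewRing σ} (h : p ∈ degLT σ (N + 1))
    (h0 : p.coeff N = 0) : p ∈ degLT σ N := by
  intro i hi
  rcases hi.eq_or_lt with rfl | hi
  · exact h0
  · exact h i hi

theorem monomial_mem_degLT {i N : ℕ} (h : i < N) (a : L) : monomial σ i a ∈ degLT σ N := by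
  intro j hj
  rw [coeff_monomial, if_neg (by omega)]

theorem const_mem_degLT (a : L) : (const a : SkewRing σ) ∈ degLT σ 1 :=
  monomial_mem_degLT one_pos a

theorem mul_mem_degLT {d e : ℕ} {p q : SkewRing σ} (hp : p ∈ degLT σ (d + 1))
    (hq : q ∈ degLT σ e) : p * q ∈ degLT σ (d + e) := by
  intro k hk
  rw [coeff_mul]
  refine Finset.sum_eq_zero fun i hi => ?_
  by_cases h : i ≤ d
  · rw [hq (k - i) (by omega)]; simp
  · rw [hp i (by omega), zero_mul]

theorem mul_mem_degLT_succ {d e : ℕ} {p q : SkewRing σ} (hp : p ∈ degLT σ (d + 1))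
    (hq : q ∈ degLT σ (e + 1)) : p * q ∈ degLT σ (d + e + 1) :=
  mul_mem_degLT (e := e + 1) hp hq

theorem coeff_mul_top {d e : ℕ} {p q : SkewRing σ} (hp : p ∈ degLT σ (d + 1))
    (hq : q ∈ degLT σ (e + 1)) : (p * q).coeff (d + e) = p.coeff d * (σ ^ d) (q.coeff e) := by
  rw [coeff_mul, Finset.sum_eq_single d]
  · simp
  · intro i _ hi
    rcases lt_or_gt_of_ne hi with h | h
    · rw [hq (d + e - i) (by omega)]; simp
    · rw [hp i (by omega), zero_mul]
  · intro h; simp at h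

theorem eq_sum_of_mem_degLT {N : ℕ} {p : SkewRing σ} (h : p ∈ degLT σ N) :
    p = ∑ i ∈ Finset.range N, monomial σ i (p.coeff i) := by
  ext j
  rw [coeff_sum]
  simp only [coeff_monomial, Finset.sum_ite_eq', Finset.mem_range]
  split_ifs with hj
  · rfl
  · exact h j (by omega)

theorem mem_degLT_natDegree (p : SkewRing σ) : p ∈ degLT σ (p.natDegree + 1) := by
  intro i hi
  by_contra h
  have : i ∈ SkewPolynomial.support (p : SkewPolynomial L) := SkewPolynomial.mem_support_iff.2 h
  have := Finset.le_sup (f := id) this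
  simp only [natDegree, id] at *
  omega

theorem coeff_natDegree_ne_zero {p : SkewRing σ} (h : p ≠ 0) : p.coeff p.natDegree ≠ 0 := by
  have hne : (SkewPolynomial.support (p : SkewPolynomial L)).Nonempty := by
    rw [Finset.nonempty_iff_ne_empty]
    exact fun h' => h (SkewPolynomial.support_eq_empty.1 h')
  obtain ⟨i, hi, h'⟩ := Finset.exists_mem_eq_sup _ hne id
  have h2 : p.natDegree = i := h'
  rw [h2]
  exact SkewPolynomial.mem_support_iff.1 hi

theorem natDegree_lt_of_mem_degLT {p : SkewRing σ} (hp : p ≠ 0) {N : ℕ} (h : p ∈ degLT σ N) :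
    p.natDegree < N := by
  by_contra h'
  exact coeff_natDegree_ne_zero hp (h _ (by omega))

theorem natDegree_eq {p : SkewRing σ} {d : ℕ} (h : p ∈ degLT σ (d + 1)) (h0 : p.coeff d ≠ 0) :
    p.natDegree = d := by
  have hp : p ≠ 0 := by rintro rfl; exact h0 rfl
  have h1 := natDegree_lt_of_mem_degLT hp h
  by_contra h2
  exact h0 (mem_degLT_natDegree p d (by omega))

instance : Nontrivial (SkewRing σ) :=
  ⟨⟨0, 1, fun h => zero_ne_one (α := L) (by simpa [coeff_one] using congrArg (fun p => coeff p 0) h)⟩⟩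

/-- The top coefficient of a product is p_d σ^d(q_e), which is nonzero because σ is injective. -/
instance : NoZeroDivisors (SkewRing σ) where
  eq_zero_or_eq_zero_of_mul_eq_zero {p q} h := by
    by_contra! hpq
    have := coeff_mul_top (mem_degLT_natDegree p) (mem_degLT_natDegree q)
    rw [h, coeff_zero] at this
    have h3 := (mul_eq_zero.1 this.symm).resolve_left (coeff_natDegree_ne_zero hpq.1)
    exact coeff_natDegree_ne_zero hpq.2 ((map_eq_zero_iff _ (σ ^ p.natDegree).injective).1 h3)

theorem natDegree_mul {p q : SkewRing σ} (hp : p ≠ 0) (hq : q ≠ 0) :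
    (p * q).natDegree = p.natDegree + q.natDegree := by
  refine natDegree_eq (mul_mem_degLT_succ (mem_degLT_natDegree p) (mem_degLT_natDegree q)) ?_
  rw [coeff_mul_top (mem_degLT_natDegree p) (mem_degLT_natDegree q)]
  exact mul_ne_zero (coeff_natDegree_ne_zero hp)
    ((map_ne_zero_iff _ (σ ^ p.natDegree).injective).2 (coeff_natDegree_ne_zero hq))

theorem eq_const_of_natDegree_eq_zero {p : SkewRing σ} (h : p.natDegree = 0) : p = const (p.coeff 0) := by
  have := eq_sum_of_mem_degLT (mem_degLT_natDegree p)
  rw [h] at this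
  simpa [monomial_zero_left] using this

theorem isUnit_const {a : L} (ha : a ≠ 0) : IsUnit (const a : SkewRing σ) :=
  (isUnit_iff_ne_zero.2 ha).map const

theorem isUnit_iff {p : SkewRing σ} : IsUnit p ↔ p ≠ 0 ∧ p.natDegree = 0 := by
  constructor
  · intro h
    refine ⟨h.ne_zero, ?_⟩
    obtain ⟨⟨a, b, hab, hba⟩, rfl⟩ := h
    have ha : a ≠ 0 := left_ne_zero_of_mul_eq_one hab
    have hb : b ≠ 0 := right_ne_zero_of_mul_eq_one hab
    have h1 := natDegree_mul ha hb
    rw [hab, natDegree_eq (d := 0) (p := 1) (const_mem_degLT 1) (by simp [coeff_one])] at h1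
    show a.natDegree = 0
    omega
  · rintro ⟨h, h0⟩
    rw [eq_const_of_natDegree_eq_zero h0] at h ⊢
    exact isUnit_const fun h' => h (by rw [h', map_zero])

/-- Right division by a monic skew polynomial. -/
theorem Monic.exists_eq_mul_add {f : SkewRing σ} (hf : f.Monic) (p : SkewRing σ) :
    ∃ g r : SkewRing σ, r ∈ degLT σ f.natDegree ∧ p = g * f + r := by
  suffices H : ∀ N, ∀ p ∈ degLT σ N, ∃ g r : SkewRing σ, r ∈ degLT σ f.natDegree ∧ p = g * f + r from
    H _ p (mem_degLT_natDegree p)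
  intro N
  induction N with
  | zero => intro p hp; exact ⟨0, 0, zero_mem _, by simp [degLT_zero hp]⟩
  | succ N ih =>
    intro p hp
    rcases lt_or_ge N f.natDegree with h | h
    · exact ⟨0, p, degLT_mono h hp, by simp⟩
    · obtain ⟨k, rfl⟩ := Nat.exists_eq_add_of_le' h
      -- As f is monic and σ fixes 1, this left multiple of f has the same top term as p.
      have h1 : p - monomial σ k (p.coeff (k + f.natDegree)) * f ∈ degLT σ (k + f.natDegree) := by
        refine mem_degLT_of_coeff_eq_zero (sub_mem hp
          (mul_mem_degLT_succ (monomial_mem_degLT (Nat.lt_succ_self k) _) (mem_degLT_natDegree f))) ?_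
        rw [coeff_sub, coeff_monomial_mul]
        have : f.coeff f.natDegree = 1 := hf
        simp [this]
      obtain ⟨g, r, hr, h2⟩ := ih _ h1
      refine ⟨g + monomial σ k (p.coeff (k + f.natDegree)), r, hr, ?_⟩
      rw [add_mul, add_right_comm, ← h2, sub_add_cancel]

/-- Degrees add, so a nonzero left multiple of f has degree at least deg f. This is the uniqueness
of remainders. -/
theorem mul_eq_zero_of_mem_degLT {f g : SkewRing σ} (h : g * f ∈ degLT σ f.natDegree) :
    g * f = 0 := by
  by_contra h0
  have h1 := natDegree_lt_of_mem_degLT h0 h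
  rw [natDegree_mul (left_ne_zero_of_mul h0) (right_ne_zero_of_mul h0)] at h1
  omega

theorem monic_const_inv_mul {p : SkewRing σ} (hp : p ≠ 0) :
    (const (p.coeff p.natDegree)⁻¹ * p).Monic := by
  have hc := coeff_natDegree_ne_zero hp
  have : (const (p.coeff p.natDegree)⁻¹ * p).natDegree = p.natDegree := by
    refine natDegree_eq (fun i hi => ?_) ?_
    · rw [coeff_const_mul, mem_degLT_natDegree p i hi, mul_zero]
    · rw [coeff_const_mul]; exact mul_ne_zero (inv_ne_zero hc) hc
  rw [Monic, this, coeff_const_mul, inv_mul_cancel₀ hc]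

/-- Every nonzero left ideal is generated by a monic skew polynomial. -/
theorem exists_monic_span (J : Submodule (SkewRing σ) (SkewRing σ)) (hJ : J ≠ ⊥) :
    ∃ h : SkewRing σ, h.Monic ∧ J = Submodule.span (SkewRing σ) {h} := by
  classical
  obtain ⟨p, hp, hp0⟩ := (Submodule.ne_bot_iff _).1 hJ
  have hex : ∃ d, ∃ p ∈ J, p ≠ 0 ∧ p.natDegree = d := ⟨_, p, hp, hp0, rfl⟩
  obtain ⟨h, hh, hh0, hd⟩ := Nat.find_spec hex
  have hmon := monic_const_inv_mul hh0
  set m := const (h.coeff h.natDegree)⁻¹ * h with hm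
  have hmJ : m ∈ J := J.smul_mem _ hh
  have hmd : m.natDegree = h.natDegree := by
    have hC : (const (h.coeff h.natDegree)⁻¹ : SkewRing σ) ≠ 0 :=
      (isUnit_const (inv_ne_zero (coeff_natDegree_ne_zero hh0))).ne_zero
    rw [hm, natDegree_mul hC hh0, (isUnit_iff.1 (isUnit_const
      (inv_ne_zero (coeff_natDegree_ne_zero hh0)))).2, zero_add]
  refine ⟨m, hmon, le_antisymm (fun p hp => ?_) ?_⟩
  · obtain ⟨g, r, hr, rfl⟩ := hmon.exists_eq_mul_add p
    have hrJ : r ∈ J := by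
      have := J.sub_mem hp (J.smul_mem g hmJ)
      simpa using this
    have : r = 0 := by
      by_contra h0
      have h1 := natDegree_lt_of_mem_degLT h0 hr
      exact Nat.find_min hex (by rw [← hd, ← hmd]; exact h1) ⟨r, hrJ, h0, rfl⟩
    rw [this, add_zero]
    exact Submodule.smul_mem _ g (Submodule.mem_span_singleton_self m)
  · rw [Submodule.span_singleton_le_iff_mem]; exact hmJ

end

end SkewRing

/-! ### The quotient R/Rf and its representatives -/

namespace SkewRing

section
variable {L : Type u} [Field L] {σ : L ≃+* L}

/-- Skew polynomials of degree less than `N` are coefficient vectors. -/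
noncomputable def degLTEquiv (σ : L ≃+* L) (N : ℕ) : degLT σ N ≃+ (Fin N → L) where
  toFun p i := p.1.coeff i
  invFun v := ⟨∑ i : Fin N, monomial σ i (v i),
    sum_mem fun i _ => monomial_mem_degLT i.2 _⟩
  left_inv p := Subtype.ext <| by
    exact (Fin.sum_univ_eq_sum_range (fun i => monomial σ i (p.1.coeff i)) N).trans
      (eq_sum_of_mem_degLT p.2).symm
  right_inv v := by
    ext i
    simp [coeff_sum, coeff_monomial, Fin.val_inj]
  map_add' p q := by ext i; simp

theorem card_degLT (σ : L ≃+* L) (N : ℕ) : Nat.card (degLT σ N) = Nat.card L ^ N := by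
  rw [Nat.card_congr (degLTEquiv σ N).toEquiv, Nat.card_fun]; simp

instance [Finite L] (N : ℕ) : Finite (degLT σ N) := Finite.of_equiv _ (degLTEquiv σ N).toEquiv.symm

variable {f : SkewRing σ}

/-- The class of a skew polynomial modulo `R f`. -/
noncomputable def mk (f : SkewRing σ) : SkewRing σ →ₗ[SkewRing σ] Quot f := Submodule.mkQ _

theorem mk_surjective (f : SkewRing σ) : Function.Surjective (mk f) := Submodule.mkQ_surjective _

theorem mk_eq_zero {p : SkewRing σ} : mk f p = 0 ↔ ∃ g, p = g * f := by
  rw [mk, Submodule.mkQ_apply, Submodule.Quotient.mk_eq_zero, Submodule.mem_span_singleton]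
  exact ⟨fun ⟨g, h⟩ => ⟨g, h.symm⟩, fun ⟨g, h⟩ => ⟨g, h.symm⟩⟩

@[simp] theorem mk_mul_self (g : SkewRing σ) : mk f (g * f) = 0 := mk_eq_zero.2 ⟨g, rfl⟩

theorem mk_mul (p q : SkewRing σ) : mk f (p * q) = p • mk f q := (mk f).map_smul p q

theorem mk_eq_smul_one (p : SkewRing σ) : mk f p = p • mk f 1 := by rw [← mk_mul, mul_one]

theorem mk_injOn {p q : SkewRing σ} (hp : p ∈ degLT σ f.natDegree)
    (hq : q ∈ degLT σ f.natDegree) (h : mk f p = mk f q) : p = q := by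
  rw [← sub_eq_zero, ← map_sub] at h
  obtain ⟨g, hg⟩ := mk_eq_zero.1 h
  have := sub_mem hp hq
  rw [hg] at this
  rw [← sub_eq_zero, hg, mul_eq_zero_of_mem_degLT this]

theorem rep_spec (hf : f.Monic) (a : Quot f) : rep a ∈ degLT σ f.natDegree ∧ mk f (rep a) = a := by
  have h : ∃ r : SkewRing σ, (∀ i, f.natDegree ≤ i → r.coeff i = 0) ∧
      (Submodule.Quotient.mk r : Quot f) = a := by
    obtain ⟨p, rfl⟩ := mk_surjective f a
    obtain ⟨g, r, hr, rfl⟩ := hf.exists_eq_mul_add p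
    exact ⟨r, hr, show mk f r = _ by rw [map_add, mk_mul_self, zero_add]⟩
  rw [rep, dif_pos h]
  exact h.choose_spec

theorem rep_mem (hf : f.Monic) (a : Quot f) : rep a ∈ degLT σ f.natDegree := (rep_spec hf a).1

theorem mk_rep (hf : f.Monic) (a : Quot f) : mk f (rep a) = a := (rep_spec hf a).2

theorem rep_mk (hf : f.Monic) {p : SkewRing σ} (hp : p ∈ degLT σ f.natDegree) :
    rep (mk f p) = p :=
  mk_injOn (rep_mem hf _) hp (mk_rep hf _)

theorem rep_add (hf : f.Monic) (a b : Quot f) : rep (a + b) = rep a + rep b :=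
  mk_injOn (rep_mem hf _) (add_mem (rep_mem hf _) (rep_mem hf _))
    (by rw [map_add, mk_rep hf, mk_rep hf, mk_rep hf])

/-- Representatives as an additive equivalence. -/
noncomputable def repEquiv (hf : f.Monic) : Quot f ≃+ degLT σ f.natDegree where
  toFun a := ⟨rep a, rep_mem hf a⟩
  invFun p := mk f p.1
  left_inv a := mk_rep hf a
  right_inv p := Subtype.ext (rep_mk hf p.2)
  map_add' a b := Subtype.ext (rep_add hf a b)

theorem card_quot (hf : f.Monic) : Nat.card (Quot f) = Nat.card L ^ f.natDegree := by
  rw [Nat.card_congr (repEquiv hf).toEquiv, card_degLT]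

theorem finite_quot [Finite L] (hf : f.Monic) : Finite (Quot f) :=
  Finite.of_equiv _ (repEquiv hf).toEquiv.symm

/-- A left ideal containing f is generated by a monic right divisor of f, so irreducibility leaves
only Rf and R. -/
theorem isSimpleModule_quot (hf : Irreducible f) : IsSimpleModule (SkewRing σ) (Quot f) := by
  rw [isSimpleModule_iff_isCoatom]
  constructor
  · intro h
    have h1 : (1 : SkewRing σ) ∈ Submodule.span (SkewRing σ) {f} := h ▸ Submodule.mem_top
    obtain ⟨g, hg⟩ := Submodule.mem_span_singleton.1 h1
    rw [smul_eq_mul] at hg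
    have hg0 : g ≠ 0 := left_ne_zero_of_mul_eq_one hg
    have hf0 : f ≠ 0 := hf.ne_zero
    have h2 := natDegree_mul hg0 hf0
    rw [hg, (isUnit_iff.1 isUnit_one).2] at h2
    exact hf.not_isUnit (isUnit_iff.2 ⟨hf0, by omega⟩)
  · intro J hJ
    have hfJ : f ∈ J := hJ.le (Submodule.mem_span_singleton_self f)
    obtain ⟨h, hm, rfl⟩ := exists_monic_span J (fun h => hf.ne_zero (by simpa [h] using hfJ))
    obtain ⟨a, ha⟩ := Submodule.mem_span_singleton.1 hfJ
    rcases hf.isUnit_or_isUnit ha.symm with hu | hu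
    · exfalso
      refine hJ.not_ge ?_
      rw [Submodule.span_singleton_le_iff_mem, Submodule.mem_span_singleton]
      obtain ⟨b, hb⟩ := hu.exists_left_inv
      exact ⟨b, by rw [← ha, smul_eq_mul, smul_eq_mul, ← mul_assoc, hb, one_mul]⟩
    · obtain ⟨b, hb⟩ := hu.exists_left_inv
      rw [Ideal.eq_top_iff_one (Submodule.span (SkewRing σ) {h})]
      exact Submodule.mem_span_singleton.2 ⟨b, hb⟩

end

end SkewRing

/-! ### Central polynomials in x^n and the action of x -/

namespace SkewData

open SkewRing

variable {q n s : ℕ} (S : SkewData.{u} q n s)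

/-- The automorphism that twists the multiplication. -/
abbrev aut : S.L ≃+* S.L := (S.σ : S.L ≃+* S.L)

/-- The skew polynomial ring. -/
abbrev R : Type u := SkewRing S.aut

instance : FiniteDimensional S.K S.L := Module.Finite.of_finite

instance : Finite S.Carrier := finite_quot S.f_monic

instance : IsSimpleModule S.R S.Carrier := isSimpleModule_quot S.f_irreducible

theorem n_pos (S : SkewData.{u} q n s) : 0 < n := S.finrank_L ▸ Module.finrank_pos

theorem card_L : Nat.card S.L = q ^ n := by
  rw [Module.natCard_eq_pow_finrank (K := S.K), S.card_K, S.finrank_L]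

theorem one_lt_q (S : SkewData.{u} q n s) : 1 < q := S.card_K ▸ Finite.one_lt_card

theorem aut_pow_apply (i : ℕ) (a : S.L) : (S.aut ^ i) a = (S.σ ^ i) a := by
  induction i generalizing a with
  | zero => rfl
  | succ i ih => rw [pow_succ, pow_succ]; exact ih _

theorem orderOf_σ : orderOf S.σ = n := by
  rw [orderOf_eq_card_of_forall_mem_zpowers S.σ_generates, IsGalois.card_aut_eq_finrank,
    S.finrank_L]

theorem aut_pow_eq_iff {i j : ℕ} :
    (∀ a, (S.aut ^ i) a = (S.aut ^ j) a) ↔ i ≡ j [MOD n] := by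
  have h : S.σ ^ i = S.σ ^ j ↔ i ≡ j [MOD orderOf S.σ] := pow_eq_pow_iff_modEq
  simp only [aut_pow_apply]
  rw [S.orderOf_σ, AlgEquiv.ext_iff] at h
  exact h

theorem aut_pow_n (a : S.L) : (S.aut ^ n) a = a := by
  simpa using (S.aut_pow_eq_iff (i := n) (j := 0)).2 (by simp [Nat.ModEq]) a

theorem aut_algebraMap (k : S.K) : S.aut (algebraMap S.K S.L k) = algebraMap S.K S.L k :=
  S.σ.commutes k

theorem exists_algebraMap_of_fixed {a : S.L} (h : S.aut a = a) : ∃ k, algebraMap S.K S.L k = a := by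
  rw [← Set.mem_range, IsGalois.mem_range_algebraMap_iff_fixed]
  intro g
  obtain ⟨i, rfl⟩ := S.σ_generates g
  have : S.σ ∈ MulAction.stabilizer (S.L ≃ₐ[S.K] S.L) a := h
  exact (MulAction.stabilizer (S.L ≃ₐ[S.K] S.L) a).zpow_mem this i

theorem commute_const_var_pow (k : S.K) :
    Commute (const (algebraMap S.K S.L k) : S.R) (var ^ n) := by
  rw [Commute, SemiconjBy, var_pow_mul_const, aut_pow_n]

/-- Substitution of `x ^ n` into polynomials over `K`. -/
noncomputable def ev : S.K[X] →+* S.R :=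
  Polynomial.eval₂RingHom' (const.comp (algebraMap S.K S.L)) (var ^ n) S.commute_const_var_pow

theorem ev_eq_sum (p : S.K[X]) :
    S.ev p = p.sum fun i a => monomial S.aut (n * i) (algebraMap S.K S.L a) := by
  show p.eval₂ _ _ = _
  rw [eval₂_eq_sum]
  congr 1
  ext1 i; ext1 a
  rw [monomial_eq, pow_mul]; rfl

theorem coeff_ev_mul (p : S.K[X]) (i : ℕ) :
    (S.ev p).coeff (n * i) = algebraMap S.K S.L (p.coeff i) := by
  rw [ev_eq_sum, Polynomial.sum_def, SkewRing.coeff_sum]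
  simp only [SkewRing.coeff_monomial, mul_right_inj' S.n_pos.ne', Finset.sum_ite_eq']
  split_ifs with h
  · rfl
  · rw [notMem_support_iff.1 h, map_zero]

theorem coeff_ev_of_not_dvd (p : S.K[X]) {i : ℕ} (h : ¬ n ∣ i) : (S.ev p).coeff i = 0 := by
  rw [ev_eq_sum, Polynomial.sum_def, SkewRing.coeff_sum]
  refine Finset.sum_eq_zero fun j _ => ?_
  rw [SkewRing.coeff_monomial, if_neg]
  rintro rfl
  exact h (dvd_mul_right n j)

/-- Powers of x^n commute with L because σ^n = 1, and K commutes with x because σ fixes it. -/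
theorem ev_mul_comm (p : S.K[X]) (r : S.R) : S.ev p * r = r * S.ev p := by
  have hC : ∀ (k : S.K) (r : S.R), const (algebraMap S.K S.L k) * r = r * const (algebraMap S.K S.L k) := by
    intro k r
    ext i
    rw [coeff_const_mul, coeff_mul_const, aut_pow_apply, AlgEquiv.commutes, mul_comm]
  have hX : ∀ r : S.R, var ^ n * r = r * var ^ n := by
    intro r
    ext i
    rw [coeff_var_pow_mul, coeff_mul_var_pow, aut_pow_n]
  induction p using Polynomial.induction_on' with
  | add p q hp hq => rw [map_add, add_mul, mul_add, hp, hq]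
  | monomial i a =>
    rw [← Polynomial.C_mul_X_pow_eq_monomial, map_mul, map_pow]
    have h1 : S.ev (Polynomial.C a) = const (algebraMap S.K S.L a) := by simp [ev]
    have h2 : S.ev Polynomial.X = var ^ n := by simp [ev]
    rw [h1, h2]
    have h3 : SemiconjBy r (var ^ n) (var ^ n) := (hX r).symm
    have h4 := (h3.pow_right i).eq
    rw [mul_assoc, ← h4, ← mul_assoc, hC, mul_assoc]

theorem exists_ev_F : ∃ g : S.R, S.ev S.F = g * S.f := by
  rw [ev_eq_sum]; exact S.f_factor

/-- Since Rf is only a left ideal, F(x^n) has to be moved past a representative of m, by centrality,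
before its right factor f can act as zero. -/
theorem ev_F_smul (m : S.Carrier) : S.ev S.F • m = 0 := by
  obtain ⟨p, rfl⟩ := mk_surjective S.f m
  obtain ⟨g, hg⟩ := S.exists_ev_F
  rw [← mk_mul, ev_mul_comm, hg, ← mul_assoc]
  exact mk_mul_self _

theorem F_coeff_zero_ne : S.F.coeff 0 ≠ 0 := by
  intro h
  have h1 : (Polynomial.X : S.K[X]) ∣ S.F := X_dvd_iff.2 h
  have h2 := (irreducible_X.associated_of_dvd S.F_irreducible h1)
  exact S.F_ne_X (eq_of_monic_of_associated S.F_monic monic_X h2.symm)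

theorem f_coeff_zero_ne : S.f.coeff 0 ≠ 0 := by
  intro h
  obtain ⟨g, hg⟩ := S.exists_ev_F
  have h1 := S.coeff_ev_mul S.F 0
  rw [hg, mul_zero, coeff_mul_zero, h, mul_zero] at h1
  exact S.F_coeff_zero_ne ((map_eq_zero _).1 h1.symm)

/-- Write F = G y + F_0 with F_0 ≠ 0. If x m = 0 then x^n m = 0, so F(x^n) m = 0 reduces to F_0 m =
0. -/
theorem var_smul_injective : Function.Injective fun m : S.Carrier => (var : S.R) • m := by
  have hn := S.n_pos
  suffices H : ∀ m : S.Carrier, (var : S.R) • m = 0 → m = 0 by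
    intro a b h
    rw [← sub_eq_zero]
    refine H _ ?_
    rw [smul_sub, sub_eq_zero]; exact h
  intro m hm
  obtain ⟨G, hG⟩ : ∃ G, S.F = G * Polynomial.X + Polynomial.C (S.F.coeff 0) :=
    ⟨_, (divX_mul_X_add S.F).symm⟩
  have h1 := S.ev_F_smul m
  have h2 : S.ev Polynomial.X = var ^ (n - 1) * var := by
    rw [← pow_succ, Nat.sub_add_cancel hn]; simp [ev]
  have h3 : S.ev (Polynomial.C (S.F.coeff 0)) = const (algebraMap S.K S.L (S.F.coeff 0)) := by
    simp [ev]
  rw [hG, map_add, map_mul, add_smul, h2, h3, mul_smul, mul_smul, hm, smul_zero, smul_zero,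
    zero_add] at h1
  have h4 := S.F_coeff_zero_ne
  rw [← (isUnit_const (σ := S.aut) ((map_ne_zero (algebraMap S.K S.L)).2 h4)).smul_eq_zero]
  exact h1

theorem var_smul_bijective : Function.Bijective fun m : S.Carrier => (var : S.R) • m :=
  Finite.injective_iff_bijective.1 S.var_smul_injective

end SkewData

/-! ### Faithfulness, endomorphisms and the degree of f -/

namespace SkewRing

variable {L : Type u} [Field L] {σ : L ≃+* L}

theorem exists_eq_mul_var {p : SkewRing σ} {N : ℕ} (hp : p ∈ degLT σ (N + 1))
    (h : p.coeff 0 = 0) : ∃ p' ∈ degLT σ N, p = p' * var := by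
  refine ⟨∑ i ∈ Finset.range N, monomial σ i (p.coeff (i + 1)),
    sum_mem fun i hi => monomial_mem_degLT (Finset.mem_range.1 hi) _, ?_⟩
  ext i
  rcases i with _ | i
  · rw [coeff_mul_var_zero, h]
  · rw [coeff_mul_var_succ, coeff_sum]
    simp only [SkewRing.coeff_monomial, Finset.sum_ite_eq', Finset.mem_range]
    split_ifs with hi
    · rfl
    · exact hp _ (by omega)

theorem var_mul_mem_degLT {p : SkewRing σ} {N : ℕ} (hp : p ∈ degLT σ N) :
    var * p ∈ degLT σ (N + 1) := by
  intro i hi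
  obtain ⟨i, rfl⟩ := Nat.exists_eq_add_of_le' (Nat.one_le_of_lt hi)
  rw [coeff_var_mul_succ, hp i (by omega), map_zero]

theorem mul_var_mem_degLT {p : SkewRing σ} {N : ℕ} (hp : p ∈ degLT σ N) :
    p * var ∈ degLT σ (N + 1) := by
  intro i hi
  obtain ⟨i, rfl⟩ := Nat.exists_eq_add_of_le' (Nat.one_le_of_lt hi)
  rw [coeff_mul_var_succ, hp i (by omega)]

theorem const_mul_mem_degLT {p : SkewRing σ} {N : ℕ} (a : L) (hp : p ∈ degLT σ N) :
    const a * p ∈ degLT σ N := fun i hi => by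
  rw [SkewRing.coeff_const_mul, hp i hi, mul_zero]

theorem mul_const_mem_degLT {p : SkewRing σ} {N : ℕ} (a : L) (hp : p ∈ degLT σ N) :
    p * const a ∈ degLT σ N := fun i hi => by
  rw [coeff_mul_const, hp i hi, zero_mul]

end SkewRing

namespace SkewData

open SkewRing

variable {q n s : ℕ} (S : SkewData.{u} q n s)

theorem s_pos (S : SkewData.{u} q n s) : 0 < s := S.F_natDegree ▸ S.F_irreducible.natDegree_pos

theorem ev_mem_degLT {k : S.K[X]} {N : ℕ} (hk : k ∈ degreeLT S.K N) :
    S.ev k ∈ degLT S.aut (n * N) := by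
  intro i hi
  by_cases h : n ∣ i
  · obtain ⟨j, rfl⟩ := h
    have hj : N ≤ j := Nat.le_of_mul_le_mul_left hi S.n_pos
    rw [coeff_ev_mul, coeff_eq_zero_of_degree_lt ((mem_degreeLT.1 hk).trans_le (by exact_mod_cast hj)),
      map_zero]
  · exact S.coeff_ev_of_not_dvd k h

theorem ev_injective : Function.Injective S.ev := by
  intro p r h
  ext i
  apply (algebraMap S.K S.L).injective
  rw [← coeff_ev_mul, h, coeff_ev_mul]

/-- A skew polynomial in `x ^ n` with coefficients fixed by `σ` comes from `K[y]`. -/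
theorem exists_ev_eq {g : S.R} {N : ℕ} (hg : g ∈ degLT S.aut (n * N))
    (h1 : ∀ i, ¬ n ∣ i → g.coeff i = 0) (h2 : ∀ i, S.aut (g.coeff i) = g.coeff i) :
    ∃ k ∈ degreeLT S.K N, S.ev k = g := by
  choose κ hκ using fun i => S.exists_algebraMap_of_fixed (h2 (n * i))
  refine ⟨∑ j ∈ Finset.range N, Polynomial.monomial j (κ j), ?_, ?_⟩
  · refine sum_mem fun j hj => mem_degreeLT.2 ((degree_monomial_le _ _).trans_lt ?_)
    exact_mod_cast Finset.mem_range.1 hj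
  · ext i
    by_cases h : n ∣ i
    · obtain ⟨j, rfl⟩ := h
      rw [coeff_ev_mul, finsetSum_coeff]
      simp only [Polynomial.coeff_monomial, Finset.sum_ite_eq', Finset.mem_range]
      split_ifs with hj
      · exact hκ j
      · rw [map_zero]
        exact (hg _ (Nat.mul_le_mul_left n (not_lt.1 hj))).symm
    · rw [coeff_ev_of_not_dvd _ _ h, h1 i h]

/-- A nonzero k of degree less than s is coprime to F; by Bézout, 1 would act as zero if both did.
-/
theorem ev_smul_ne_zero {k : S.K[X]} (hk : k ∈ degreeLT S.K s) (h0 : k ≠ 0) :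
    ¬ ∀ m : S.Carrier, S.ev k • m = 0 := by
  intro h
  have hco : IsCoprime S.F k := by
    rw [S.F_irreducible.coprime_iff_not_dvd]
    intro hd
    have h1 := degree_le_of_dvd hd h0
    have h2 := mem_degreeLT.1 hk
    rw [degree_eq_natDegree S.F_irreducible.ne_zero, S.F_natDegree] at h1
    exact absurd h2 h1.not_gt
  obtain ⟨a, b, hab⟩ := hco
  have : Nontrivial S.Carrier := IsSimpleModule.nontrivial S.R S.Carrier
  obtain ⟨m, hm⟩ := exists_ne (0 : S.Carrier)
  apply hm
  rw [← one_smul S.R m, ← map_one S.ev, ← hab, map_add, map_mul, map_mul, add_smul, mul_smul,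
    mul_smul, h, S.ev_F_smul, smul_zero, smul_zero, add_zero]

/-- Take a monic annihilator g of minimal degree d. Its twisted commutators with L and with x
annihilate as well and have smaller degree, hence vanish. So g lies in K[x^n] with degree below s in
x^n, which `ev_smul_ne_zero` forbids. -/
theorem eq_zero_of_smul_eq_zero (hn : 2 ≤ n) {g : S.R} (hg : g ∈ degLT S.aut (n * s))
    (h : ∀ m : S.Carrier, g • m = 0) : g = 0 := by
  classical
  by_contra hg0
  have hex : ∃ d, ∃ g : S.R, g ≠ 0 ∧ (∀ m : S.Carrier, g • m = 0) ∧ g.natDegree = d :=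
    ⟨_, g, hg0, h, rfl⟩
  have hlt : Nat.find hex < n * s :=
    (Nat.find_min' hex ⟨g, hg0, h, rfl⟩).trans_lt (natDegree_lt_of_mem_degLT hg0 hg)
  have hmin : ∀ p ∈ degLT S.aut (Nat.find hex), (∀ m : S.Carrier, p • m = 0) → p = 0 := by
    intro p hp hpm
    by_contra hp0
    exact Nat.find_min hex (natDegree_lt_of_mem_degLT hp0 hp) ⟨p, hp0, hpm, rfl⟩
  obtain ⟨g₁, hg₁, hm₁, hd₁⟩ := Nat.find_spec hex
  set d := Nat.find hex with hd
  obtain ⟨g, hgm, hgd, hg1⟩ : ∃ g : S.R, (∀ m : S.Carrier, g • m = 0) ∧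
      g ∈ degLT S.aut (d + 1) ∧ g.coeff d = 1 := by
    refine ⟨const (g₁.coeff d)⁻¹ * g₁, fun m => by rw [mul_smul, hm₁, smul_zero], fun i hi => ?_, ?_⟩
    · rw [SkewRing.coeff_const_mul, mem_degLT_natDegree g₁ i (by omega), mul_zero]
    · rw [SkewRing.coeff_const_mul, ← hd₁, inv_mul_cancel₀ (coeff_natDegree_ne_zero hg₁)]
  -- These are the coefficients of g a - σ^d(a) g, whose terms of degree d cancel because g is
  -- monic.
  have key : ∀ i a, g.coeff i * ((S.aut ^ i) a - (S.aut ^ d) a) = 0 := by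
    intro i a
    have h0 : g * const a - const ((S.aut ^ d) a) * g = 0 := by
      refine hmin _ (mem_degLT_of_coeff_eq_zero (fun j hj => ?_) ?_) fun m => ?_
      · rw [SkewRing.coeff_sub, coeff_mul_const, SkewRing.coeff_const_mul, hgd j hj]; simp
      · rw [SkewRing.coeff_sub, coeff_mul_const, SkewRing.coeff_const_mul, hg1]; simp
      · rw [sub_smul, mul_smul, mul_smul, hgm, hgm, smul_zero, sub_zero]
    have := congrArg (fun p => SkewRing.coeff p i) h0
    simp only [SkewRing.coeff_sub, coeff_mul_const, SkewRing.coeff_const_mul,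
      SkewRing.coeff_zero] at this
    linear_combination this
  have hdvd : ∀ i, g.coeff i ≠ 0 → i ≡ d [MOD n] := fun i hi =>
    S.aut_pow_eq_iff.1 fun a => sub_eq_zero.1 ((mul_eq_zero.1 (key i a)).resolve_left hi)
  -- Otherwise g = p x; as x acts surjectively, p would be an annihilator of smaller degree.
  have h0 : g.coeff 0 ≠ 0 := by
    intro h0
    obtain ⟨p, hp, rfl⟩ := exists_eq_mul_var hgd h0
    have hp0 : p = 0 := by
      refine hmin p hp fun m => ?_
      obtain ⟨m, rfl⟩ := S.var_smul_bijective.2 m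
      rw [← hgm m, mul_smul]
    rw [hp0, zero_mul] at hg1
    exact zero_ne_one hg1
  have hnd : n ∣ d := (Nat.modEq_zero_iff_dvd.1 (hdvd 0 h0).symm)
  have hn0 : ∀ i, ¬ n ∣ i → g.coeff i = 0 := by
    intro i hi
    by_contra h
    exact hi ((Nat.modEq_zero_iff_dvd).1 ((hdvd i h).trans (Nat.modEq_zero_iff_dvd.2 hnd)))
  have hcomm : var * g - g * var = 0 := by
    refine hmin _ (mem_degLT_of_coeff_eq_zero (fun j hj => ?_) ?_) fun m => ?_
    · obtain ⟨j, rfl⟩ := Nat.exists_eq_add_of_le' (Nat.one_le_of_lt hj)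
      rw [SkewRing.coeff_sub, coeff_var_mul_succ, coeff_mul_var_succ]
      rcases (Nat.le_of_succ_le_succ hj).eq_or_lt with rfl | hj
      · simp [hg1]
      · simp [hgd j hj]
    -- The coefficient of x^d in x g - g x involves only the coefficient of g at d - 1, which
    -- vanishes: n | d and n ≥ 2 give n ∤ d - 1.
    · rcases Nat.eq_zero_or_pos d with h | h
      · rw [h]; simp
      · obtain ⟨e, he⟩ := Nat.exists_eq_add_of_le' h
        have : ¬ n ∣ e := by
          intro h'
          rw [he] at hnd
          have := (Nat.dvd_add_right h').1 hnd
          have := Nat.le_of_dvd one_pos this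
          omega
        rw [he, SkewRing.coeff_sub, coeff_var_mul_succ, coeff_mul_var_succ, hn0 e this]; simp
    · rw [sub_smul, mul_smul, mul_smul, hgm, hgm, smul_zero, sub_zero]
  have hfix : ∀ i, S.aut (g.coeff i) = g.coeff i := by
    intro i
    have := congrArg (fun p => SkewRing.coeff p (i + 1)) hcomm
    simp only [SkewRing.coeff_sub, coeff_var_mul_succ, coeff_mul_var_succ,
      SkewRing.coeff_zero] at this
    exact sub_eq_zero.1 this
  obtain ⟨k, hk, rfl⟩ := S.exists_ev_eq (degLT_mono (Nat.succ_le_of_lt hlt) hgd) hn0 hfix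
  refine S.ev_smul_ne_zero hk ?_ hgm
  rintro rfl
  simp at h0

theorem eq_of_smul_eq (hn : 2 ≤ n) {g h : S.R} (hg : g ∈ degLT S.aut (n * s))
    (hh : h ∈ degLT S.aut (n * s)) (H : ∀ m : S.Carrier, g • m = h • m) : g = h := by
  rw [← sub_eq_zero]
  exact S.eq_zero_of_smul_eq_zero hn (sub_mem hg hh) fun m => by rw [sub_smul, H, sub_self]

theorem F_coeff_s : S.F.coeff s = 1 := by
  have h := S.F_monic.coeff_natDegree
  rwa [S.F_natDegree] at h

theorem exists_mem_degLT_smul (r : S.R) :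
    ∃ p ∈ degLT S.aut (n * s), ∀ m : S.Carrier, r • m = p • m := by
  have hd : (S.ev S.F).natDegree = n * s := by
    refine SkewRing.natDegree_eq (fun i hi => ?_) ?_
    · by_cases h : n ∣ i
      · obtain ⟨j, rfl⟩ := h
        have hj : s < j := lt_of_mul_lt_mul_left (Nat.lt_of_succ_le hi) (Nat.zero_le n)
        rw [coeff_ev_mul, coeff_eq_zero_of_natDegree_lt (by rwa [S.F_natDegree]), map_zero]
      · exact S.coeff_ev_of_not_dvd _ h
    · rw [coeff_ev_mul, F_coeff_s, map_one]
      exact one_ne_zero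
  have hm : (S.ev S.F).Monic := by
    rw [SkewRing.Monic, hd, coeff_ev_mul, F_coeff_s, map_one]
  obtain ⟨g, p, hp, rfl⟩ := hm.exists_eq_mul_add r
  rw [hd] at hp
  exact ⟨p, hp, fun m => by rw [add_smul, mul_smul, S.ev_F_smul, smul_zero, zero_add]⟩

section End

variable (hn : 2 ≤ n)

/-- Central skew polynomials act as endomorphisms. -/
noncomputable def evEnd (k : S.K[X]) : Module.End S.R S.Carrier where
  toFun m := S.ev k • m
  map_add' := smul_add _
  map_smul' r m := by
    simp only [RingHom.id_apply]
    rw [← mul_smul, ev_mul_comm, mul_smul]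

instance : Finite (Module.End S.R S.Carrier) :=
  Finite.of_injective (fun e : Module.End S.R S.Carrier => (e : S.Carrier → S.Carrier))
    DFunLike.coe_injective

/-- Schur's lemma makes the endomorphism ring a division ring; being finite, it is commutative by
Wedderburn. -/
theorem end_mul_comm (e e' : Module.End S.R S.Carrier) : e * e' = e' * e := by
  classical
  exact (Finite.isDomain_to_isField (Module.End S.R S.Carrier)).mul_comm e e'

/-- The module is finite, so Jacobson density applies to all of its vectors at once; reduction
modulo F(x^n) bounds the degree. -/
theorem density (e : Module.End (Module.End S.R S.Carrier) S.Carrier) :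
    ∃ p ∈ degLT S.aut (n * s), ∀ m, e m = p • m := by
  have := Fintype.ofFinite S.Carrier
  obtain ⟨r, hr⟩ := jacobson_density e Finset.univ
  obtain ⟨p, hp, h⟩ := S.exists_mem_degLT_smul r
  exact ⟨p, hp, fun m => (hr m (Finset.mem_univ m)).trans (h m)⟩

include hn in
-- Commutativity of the endomorphism ring makes e linear over it, so e is the action of some p. As e
-- is R-linear, p commutes with L and with x, and therefore lies in K[x^n].
theorem exists_evEnd_eq (e : Module.End S.R S.Carrier) :
    ∃ k ∈ degreeLT S.K s, S.evEnd k = e := by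
  obtain ⟨p, hp, hpe⟩ := S.density
    { toFun := e
      map_add' := map_add e
      map_smul' := fun e' m => DFunLike.congr_fun (S.end_mul_comm e e') m }
  replace hpe : ∀ m, e m = p • m := hpe
  obtain ⟨N, hN⟩ : ∃ N, n * s = N + 1 :=
    Nat.exists_eq_add_of_le' (Nat.mul_pos S.n_pos S.s_pos)
  have hn0 : ∀ i, ¬ n ∣ i → p.coeff i = 0 := by
    intro i hi
    by_contra hpi
    apply hi
    rw [← Nat.modEq_zero_iff_dvd, ← S.aut_pow_eq_iff]
    intro a
    have h0 : p * const a = const a * p := by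
      refine S.eq_of_smul_eq hn (fun j hj => ?_) (fun j hj => ?_) fun m => ?_
      · rw [coeff_mul_const, hp j hj, zero_mul]
      · rw [SkewRing.coeff_const_mul, hp j hj, mul_zero]
      · rw [mul_smul, mul_smul, ← hpe, ← hpe, map_smul]
    have := congrArg (fun p => SkewRing.coeff p i) h0
    simp only [coeff_mul_const, SkewRing.coeff_const_mul] at this
    rw [mul_comm] at this
    simpa using mul_right_cancel₀ hpi this
  -- Since n ≥ 2 does not divide ns - 1, the top coefficient is zero; hence x p and p x still have
  -- degree less than ns, where the action is faithful.
  have hN0 : p.coeff N = 0 := hn0 N fun h => by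
    have := (Nat.dvd_add_right h).1 (hN ▸ dvd_mul_right n s)
    have := Nat.le_of_dvd one_pos this
    omega
  have hcomm : var * p = p * var := by
    have hp' : p ∈ degLT S.aut N := mem_degLT_of_coeff_eq_zero (hN ▸ hp) hN0
    refine S.eq_of_smul_eq hn (hN ▸ var_mul_mem_degLT hp') (hN ▸ mul_var_mem_degLT hp') fun m => ?_
    rw [mul_smul, mul_smul, ← hpe, ← hpe, map_smul]
  obtain ⟨k, hk, rfl⟩ := S.exists_ev_eq hp hn0 fun i => by
    have := congrArg (fun p => SkewRing.coeff p (i + 1)) hcomm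
    simpa only [coeff_var_mul_succ, coeff_mul_var_succ] using this
  exact ⟨k, hk, LinearMap.ext fun m => (hpe m).symm⟩

include hn in
theorem card_end : Nat.card (Module.End S.R S.Carrier) = q ^ s := by
  have hb : Function.Bijective fun k : degreeLT S.K s => S.evEnd k.1 := by
    constructor
    · intro k k' h
      refine Subtype.ext (S.ev_injective ?_)
      exact S.eq_of_smul_eq hn (S.ev_mem_degLT k.2) (S.ev_mem_degLT k'.2)
        fun m => DFunLike.congr_fun h m
    · intro e
      obtain ⟨k, hk, h⟩ := S.exists_evEnd_eq hn e
      exact ⟨⟨k, hk⟩, h⟩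
  rw [← Nat.card_congr (Equiv.ofBijective _ hb), Nat.card_congr (degreeLTEquiv S.K s).toEquiv,
    Nat.card_fun, S.card_K, Nat.card_fin]

include hn in
-- Let E = End_R(M) and r = dim_E M. Counting M gives n deg f = s r. The E-linear maps of M are the
-- skew polynomials of degree less than ns, so counting them gives n²s = r n deg f. Together r = n
-- and deg f = s.
theorem f_natDegree : S.f.natDegree = s := by
  classical
  have hq := S.one_lt_q
  have := S.n_pos
  have hs := S.s_pos
  have hM : Nat.card S.Carrier = q ^ (n * S.f.natDegree) := by
    rw [card_quot S.f_monic, S.card_L, pow_mul]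
  set E := Module.End S.R S.Carrier
  set r := Module.finrank E S.Carrier
  have : Module.Finite E S.Carrier := Module.Finite.of_finite
  have h1 : n * S.f.natDegree = s * r := by
    have h := Module.natCard_eq_pow_finrank (K := E) (V := S.Carrier)
    rw [hM, S.card_end hn, ← pow_mul] at h
    exact Nat.pow_right_injective hq h
  have h2 : n * (n * s) = n * S.f.natDegree * r := by
    have hb : Function.Bijective fun p : degLT S.aut (n * s) =>
        ({ toFun := fun m => p.1 • m
           map_add' := smul_add _
           map_smul' := fun e m => (map_smul e p.1 m).symm } : Module.End E S.Carrier) := by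
      constructor
      · intro p p' h
        exact Subtype.ext (S.eq_of_smul_eq hn p.2 p'.2 fun m => DFunLike.congr_fun h m)
      · intro e
        obtain ⟨p, hp, h⟩ := S.density e
        exact ⟨⟨p, hp⟩, LinearMap.ext fun m => (h m).symm⟩
    have hc := Nat.card_congr (Equiv.ofBijective _ hb)
    have hc' := Nat.card_congr
      ((Module.finBasis E S.Carrier).constr (M' := S.Carrier) ℕ).toEquiv
    rw [card_degLT, S.card_L, ← pow_mul, ← hc', Nat.card_fun, hM, Nat.card_fin, ← pow_mul] at hc
    exact Nat.pow_right_injective hq hc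
  have h3 : n = r := by
    have : n * n * s = r * r * s := by rw [mul_assoc, h2, h1]; ring
    have := Nat.eq_of_mul_eq_mul_right hs this
    exact Nat.mul_self_inj.1 this
  rw [← h3, mul_comm s] at h1
  exact Nat.eq_of_mul_eq_mul_left S.n_pos h1

include hn in
theorem card_carrier : Nat.card S.Carrier = q ^ (n * s) := by
  rw [card_quot S.f_monic, S.card_L, pow_mul, S.f_natDegree hn]

end End

end SkewData

/-! ### Companion matrices and the norm condition -/

namespace SkewRing

variable {L : Type u} [Field L] {σ : L ≃+* L}

theorem rep_const_smul {f : SkewRing σ} (hf : f.Monic) (c : L) (a : Quot f) :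
    rep ((const c : SkewRing σ) • a) = const c * rep a := by
  refine mk_injOn (rep_mem hf _) (const_mul_mem_degLT c (rep_mem hf a)) ?_
  rw [mk_rep hf, mk_mul, mk_rep hf]

theorem rep_sum {f : SkewRing σ} (hf : f.Monic) {ι : Type*} (t : Finset ι) (a : ι → Quot f) :
    rep (∑ i ∈ t, a i) = ∑ i ∈ t, rep (a i) :=
  map_sum (AddMonoidHom.mk' (fun a : Quot f => rep a) (rep_add hf)) a t

/-- The companion matrix of a monic skew polynomial of degree `N + 1`. -/
noncomputable def companion (N : ℕ) (h : SkewRing σ) : Matrix (Fin (N + 1)) (Fin (N + 1)) L :=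
  fun j => Fin.lastCases (-h.coeff j) fun i => if j = i.succ then 1 else 0

@[simp] theorem companion_last (N : ℕ) (h : SkewRing σ) (j : Fin (N + 1)) :
    companion N h j (Fin.last N) = -h.coeff j := by simp [companion]

@[simp] theorem companion_castSucc (N : ℕ) (h : SkewRing σ) (j : Fin (N + 1)) (i : Fin N) :
    companion N h j i.castSucc = if j = i.succ then 1 else 0 := by simp [companion]

/-- Only the last entry of the first row can be nonzero, and its minor is the identity. -/
theorem det_companion (N : ℕ) (h : SkewRing σ) :
    (companion N h).det = (-1) ^ (N + 1) * h.coeff 0 := by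
  rw [Matrix.det_succ_row_zero, Fin.sum_univ_castSucc, Finset.sum_eq_zero, zero_add, companion_last]
  · have : (companion N h).submatrix Fin.succ (Fin.last N).succAbove = 1 := by
      ext i j
      simp [Matrix.one_apply]
    rw [this, Matrix.det_one]
    simp [pow_succ]
  · intro i _
    rw [companion_castSucc, if_neg (Fin.succ_ne_zero i).symm, mul_zero, zero_mul]

theorem coeff_rep_var_smul {f : SkewRing σ} (hf : f.Monic) {N : ℕ} (hd : f.natDegree = N + 1)
    (a : Quot f) (j : Fin (N + 1)) : (rep ((var : SkewRing σ) • a)).coeff j =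
      ∑ i, companion N f j i * σ ((rep a).coeff i) := by
  have hfN : f.coeff (N + 1) = 1 := hd ▸ hf
  have ha : rep a ∈ degLT σ (N + 1) := hd ▸ rep_mem hf a
  -- Only the top term of x a leaves the range of representatives, and one multiple of the monic f
  -- removes it.
  have h1 : rep ((var : SkewRing σ) • a) = var * rep a - const (σ ((rep a).coeff N)) * f := by
    refine mk_injOn (rep_mem hf _) ?_ ?_
    · rw [hd]
      refine mem_degLT_of_coeff_eq_zero (sub_mem (var_mul_mem_degLT ha)
        (const_mul_mem_degLT _ (by rw [← hd]; exact mem_degLT_natDegree f))) ?_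
      rw [coeff_sub, coeff_var_mul_succ, SkewRing.coeff_const_mul, hfN, mul_one, sub_self]
    · rw [mk_rep hf, map_sub, mk_mul_self, sub_zero, mk_mul, mk_rep hf]
  rw [h1, coeff_sub, SkewRing.coeff_const_mul, Fin.sum_univ_castSucc, companion_last]
  simp only [companion_castSucc, ite_mul, one_mul, zero_mul]
  have h2 : (var * rep a).coeff j =
      ∑ i : Fin N, if j = i.succ then σ ((rep a).coeff i.castSucc) else 0 := by
    refine Fin.cases ?_ (fun j => ?_) j
    · rw [Finset.sum_eq_zero]
      · simp
      · intro i _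
        rw [if_neg (Fin.succ_ne_zero i).symm]
    · simp [Fin.succ_inj]
  rw [h2, Fin.val_last]
  ring

end SkewRing

/-! ### Skew polynomials of degree at most s that kill a vector -/

namespace SkewData

open SkewRing

variable {q n s : ℕ} (S : SkewData.{u} q n s)

section
variable (hn : 2 ≤ n)

include hn in
-- The annihilator of m is a left ideal Rp with R/Rp isomorphic to M. Counting gives deg p = s, so
-- it contains nothing nonzero of smaller degree.
theorem eq_zero_of_smul_eq_zero_of_mem {g : S.R} (hg : g ∈ degLT S.aut s) {m : S.Carrier}
    (hm : m ≠ 0) (h : g • m = 0) : g = 0 := by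
  set J := LinearMap.ker (LinearMap.toSpanSingleton S.R S.Carrier m) with hJ
  have hsurj : Function.Surjective (LinearMap.toSpanSingleton S.R S.Carrier m) :=
    IsSimpleModule.toSpanSingleton_surjective S.R hm
  have hne : J ≠ ⊥ := by
    intro h0
    have : S.ev S.F ∈ J := S.ev_F_smul m
    rw [h0, Submodule.mem_bot, map_eq_zero_iff _ S.ev_injective] at this
    exact S.F_irreducible.ne_zero this
  obtain ⟨p, hp, hJp⟩ := exists_monic_span J hne
  have hc : Nat.card (Quot p) = Nat.card S.Carrier := by
    have e := LinearMap.quotKerEquivOfSurjective _ hsurj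
    rw [← hJ, hJp] at e
    exact Nat.card_congr e.toEquiv
  rw [card_quot hp, S.card_L, S.card_carrier hn, ← pow_mul] at hc
  have hd : p.natDegree = s :=
    Nat.eq_of_mul_eq_mul_left S.n_pos (Nat.pow_right_injective S.one_lt_q hc)
  have hgJ : g ∈ J := h
  rw [hJp] at hgJ
  obtain ⟨a, rfl⟩ := Submodule.mem_span_singleton.1 hgJ
  exact mul_eq_zero_of_mem_degLT (by rwa [hd])

include hn in
-- Let the columns of P be the coordinates of m, xm, ..., x^(s-1)m. The action of x is σ-semilinear
-- with matrix C_f, and h m = 0 expresses x^s m by these columns; both facts together say P C_h =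
-- C_f σ(P). Determinants give det(P) h_0 = f_0 σ(det P), and the norm to K does not see σ.
theorem norm_coeff_zero_of_monic {h : S.R} (hh : h ∈ degLT S.aut (s + 1)) (h1 : h.coeff s = 1)
    {m : S.Carrier} (hm : m ≠ 0) (hz : h • m = 0) :
    Algebra.norm S.K (h.coeff 0) = Algebra.norm S.K (S.f.coeff 0) := by
  obtain ⟨N, rfl⟩ := Nat.exists_eq_add_of_le' S.s_pos
  have hd := S.f_natDegree hn
  let P : Matrix (Fin (N + 1)) (Fin (N + 1)) S.L :=
    Matrix.of fun j i => (rep ((var : S.R) ^ (i : ℕ) • m)).coeff j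
  have hA : P * companion N h = companion N S.f * P.map S.aut := by
    ext j i
    have hR : (companion N S.f * P.map S.aut) j i =
        (rep ((var : S.R) ^ ((i : ℕ) + 1) • m)).coeff j := by
      rw [pow_succ', mul_smul, coeff_rep_var_smul S.f_monic hd, Matrix.mul_apply]
      rfl
    rw [hR, Matrix.mul_apply]
    refine Fin.lastCases ?_ (fun i => ?_) i
    · have h2 : (var : S.R) ^ (N + 1) • m =
          ∑ k : Fin (N + 1), (const (-h.coeff k) : S.R) • (var : S.R) ^ (k : ℕ) • m := by
        have h3 := eq_sum_of_mem_degLT hh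
        rw [Finset.sum_range_succ, h1, monomial_eq, map_one, one_mul] at h3
        rw [h3, add_smul, add_eq_zero_iff_neg_eq] at hz
        rw [← hz, Finset.sum_smul, ← Finset.sum_neg_distrib, ← Fin.sum_univ_eq_sum_range
          (fun i => -((SkewRing.monomial S.aut i (h.coeff i)) • m))]
        refine Finset.sum_congr rfl fun k _ => ?_
        rw [monomial_eq, map_neg, neg_smul, mul_smul]
      rw [Fin.val_last, h2, rep_sum S.f_monic, SkewRing.coeff_sum]
      refine Finset.sum_congr rfl fun k _ => ?_
      rw [rep_const_smul S.f_monic, SkewRing.coeff_const_mul, companion_last, mul_comm]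
      rfl
    · simp only [companion_castSucc, mul_ite, mul_one, mul_zero, Finset.sum_ite_eq',
        Finset.mem_univ, if_true]
      rfl
  -- A kernel vector of P is the coefficient vector of a skew polynomial of degree less than s that
  -- kills m.
  have hP : P.det ≠ 0 := by
    rw [Ne, ← Matrix.exists_mulVec_eq_zero_iff]
    rintro ⟨v, hv, hPv⟩
    apply hv
    set p : S.R := ∑ i : Fin (N + 1), SkewRing.monomial S.aut i (v i) with hp
    have hpm : p ∈ degLT S.aut (N + 1) := sum_mem fun i _ => monomial_mem_degLT i.2 _
    have hp0 : p • m = 0 := by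
      rw [← mk_rep S.f_monic (p • m)]
      have : rep (p • m) = 0 := by
        ext j
        by_cases hj : j < N + 1
        · have := congrFun hPv ⟨j, hj⟩
          rw [Pi.zero_apply] at this
          rw [SkewRing.coeff_zero, ← this, hp, Finset.sum_smul, rep_sum S.f_monic,
            SkewRing.coeff_sum, Matrix.mulVec, dotProduct]
          refine Finset.sum_congr rfl fun k _ => ?_
          rw [monomial_eq, mul_smul, rep_const_smul S.f_monic, SkewRing.coeff_const_mul, mul_comm]
          rfl
        · exact rep_mem S.f_monic _ j (by rw [hd]; omega)
      rw [this, map_zero]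
    have hpz := S.eq_zero_of_smul_eq_zero_of_mem hn hpm hm hp0
    ext i
    have := congrArg (fun p => SkewRing.coeff p i) hpz
    simpa [hp, SkewRing.coeff_sum, SkewRing.coeff_monomial, Fin.val_inj] using this
  have hdet := congrArg Matrix.det hA
  have hmap : (P.map S.aut).det = S.aut P.det := ((S.aut : S.L →+* S.L).map_det P).symm
  rw [Matrix.det_mul, Matrix.det_mul, det_companion, det_companion, hmap] at hdet
  have h4 : P.det * h.coeff 0 = S.f.coeff 0 * S.σ P.det := by
    have h5 : ((-1 : S.L) ^ (N + 1)) ≠ 0 := pow_ne_zero _ (neg_ne_zero.2 one_ne_zero)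
    refine mul_left_cancel₀ h5 ?_
    have : S.aut P.det = S.σ P.det := rfl
    rw [this] at hdet
    linear_combination hdet
  have h5 := congrArg (Algebra.norm S.K) h4
  rw [map_mul, map_mul, Algebra.norm_eq_of_algEquiv, mul_comm] at h5
  exact mul_right_cancel₀ (Algebra.norm_ne_zero_iff.2 hP) h5

include hn in
/-- A skew polynomial of degree at most `s` that kills a nonzero vector has degree `s`, and its
extreme coefficients satisfy a norm condition. -/
theorem norm_of_smul_eq_zero {g : S.R} (hg : g ∈ degLT S.aut (s + 1)) {m : S.Carrier}
    (hm : m ≠ 0) (hz : g • m = 0) : (g.coeff s = 0 → g = 0) ∧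
      Algebra.norm S.K (g.coeff 0) = Algebra.norm S.K (S.f.coeff 0) * Algebra.norm S.K (g.coeff s) := by
  have h0 : g.coeff s = 0 → g = 0 := fun h =>
    S.eq_zero_of_smul_eq_zero_of_mem hn (mem_degLT_of_coeff_eq_zero hg h) hm hz
  refine ⟨h0, ?_⟩
  by_cases h : g.coeff s = 0
  · rw [h, h0 h]; simp
  · have h1 := S.norm_coeff_zero_of_monic hn (h := const (g.coeff s)⁻¹ * g)
      (const_mul_mem_degLT _ hg) (by rw [SkewRing.coeff_const_mul, inv_mul_cancel₀ h]) hm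
      (by rw [mul_smul, hz, smul_zero])
    rw [← h1, SkewRing.coeff_const_mul, ← map_mul]
    congr 1
    field_simp

end

end SkewData

/-! ### Isotopy invariants that replace the nuclei -/

section
variable {A : Type u} [AddCommGroup A] {B : Type v} [AddCommGroup B]

/-- The additive maps `T` with `T (a b) = T' (a) b` for some `T'`. -/
def leftMaps (mul : A → A → A) : Set (A →+ A) :=
  {T | ∃ T' : A → A, ∀ a b, T (mul a b) = mul (T' a) b}

/-- The additive maps `T` with `T' (a) b = a T (b)` for some `T'`. -/
def middleMaps (mul : A → A → A) : Set (A →+ A) :=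
  {T | ∃ T' : A → A, ∀ a b, mul (T' a) b = mul a (T b)}

/-- The additive maps `T` with `T (a b) = a T' (b)` for some `T'`. -/
def rightMaps (mul : A → A → A) : Set (A →+ A) :=
  {T | ∃ T' : A → A, ∀ a b, T (mul a b) = mul a (T' b)}

/-- The additive maps `T` with `T (a b) = T' (a) b = a T'' (b)` for some `T'` and `T''`. -/
def centreMaps (mul : A → A → A) : Set (A →+ A) := leftMaps mul ∩ rightMaps mul

/-- Conjugation of additive maps by an additive equivalence. -/
def conjHom (h : A ≃+ B) : (A →+ A) ≃ (B →+ B) where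
  toFun T := h.toAddMonoidHom.comp (T.comp h.symm.toAddMonoidHom)
  invFun T := h.symm.toAddMonoidHom.comp (T.comp h.toAddMonoidHom)
  left_inv T := by ext; simp
  right_inv T := by ext; simp

@[simp] theorem conjHom_apply (h : A ≃+ B) (T : A →+ A) (b : B) :
    conjHom h T b = h (T (h.symm b)) := rfl

@[simp] theorem conjHom_symm_conjHom (h : A ≃+ B) (T : A →+ A) :
    conjHom h.symm (conjHom h T) = T := (conjHom h).left_inv T

section
variable {mulA : A → A → A} {mulB : B → B → B} {h₁ h₂ h₃ : A ≃+ B}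
  (H : ∀ a b, h₁ (mulA a b) = mulB (h₂ a) (h₃ b))
include H

theorem isotopism_symm (a b : B) :
    h₁.symm (mulB a b) = mulA (h₂.symm a) (h₃.symm b) := by
  rw [AddEquiv.symm_apply_eq, H]; simp

theorem conjHom_mem_leftMaps {T : A →+ A} (hT : T ∈ leftMaps mulA) :
    conjHom h₁ T ∈ leftMaps mulB := by
  obtain ⟨T', hT'⟩ := hT
  refine ⟨fun b => h₂ (T' (h₂.symm b)), fun a b => ?_⟩
  rw [conjHom_apply, isotopism_symm H, hT', H]; simp

theorem conjHom_mem_middleMaps {T : A →+ A} (hT : T ∈ middleMaps mulA) :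
    conjHom h₃ T ∈ middleMaps mulB := by
  obtain ⟨T', hT'⟩ := hT
  refine ⟨fun b => h₂ (T' (h₂.symm b)), fun a b => ?_⟩
  have h1 := congrArg h₁ (hT' (h₂.symm a) (h₃.symm b))
  rw [H, H] at h1
  simpa using h1

theorem conjHom_mem_rightMaps {T : A →+ A} (hT : T ∈ rightMaps mulA) :
    conjHom h₁ T ∈ rightMaps mulB := by
  obtain ⟨T', hT'⟩ := hT
  refine ⟨fun b => h₃ (T' (h₃.symm b)), fun a b => ?_⟩
  rw [conjHom_apply, isotopism_symm H, hT', H]; simp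

theorem card_leftMaps_eq : Nat.card (leftMaps mulA) = Nat.card (leftMaps mulB) :=
  Nat.card_congr ((conjHom h₁).subtypeEquiv fun T => ⟨conjHom_mem_leftMaps H, fun hT => by simpa using conjHom_mem_leftMaps (isotopism_symm H) hT⟩)

theorem card_middleMaps_eq : Nat.card (middleMaps mulA) = Nat.card (middleMaps mulB) :=
  Nat.card_congr ((conjHom h₃).subtypeEquiv fun T => ⟨conjHom_mem_middleMaps H, fun hT => by simpa using conjHom_mem_middleMaps (isotopism_symm H) hT⟩)

theorem card_rightMaps_eq : Nat.card (rightMaps mulA) = Nat.card (rightMaps mulB) :=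
  Nat.card_congr ((conjHom h₁).subtypeEquiv fun T => ⟨conjHom_mem_rightMaps H, fun hT => by simpa using conjHom_mem_rightMaps (isotopism_symm H) hT⟩)

theorem card_centreMaps_eq : Nat.card (centreMaps mulA) = Nat.card (centreMaps mulB) :=
  Nat.card_congr ((conjHom h₁).subtypeEquiv fun T =>
    ⟨fun hT => ⟨conjHom_mem_leftMaps H hT.1, conjHom_mem_rightMaps H hT.2⟩, fun hT =>
      ⟨by simpa using conjHom_mem_leftMaps (isotopism_symm H) hT.1,
       by simpa using conjHom_mem_rightMaps (isotopism_symm H) hT.2⟩⟩)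

end

/-- The parameters of a presemifield, defined through additive maps. -/
noncomputable def mapParams (mul : A → A → A) : NuclearParams where
  order := Nat.card A
  left := Nat.card (leftMaps mul)
  middle := Nat.card (middleMaps mul)
  right := Nat.card (rightMaps mul)
  centre := Nat.card (centreMaps mul)

theorem Isotopic.mapParams_eq {mulA : A → A → A} {mulB : B → B → B} (h : Isotopic mulA mulB) :
    mapParams mulA = mapParams mulB := by
  obtain ⟨h₁, h₂, h₃, H⟩ := h
  ext
  · exact Nat.card_congr h₁.toEquiv
  · exact card_leftMaps_eq H
  · exact card_middleMaps_eq H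
  · exact card_rightMaps_eq H
  · exact card_centreMaps_eq H

/-- Evaluating at the identity e shows that left and middle maps are left multiplications by T'(e),
and right maps are right multiplications by T'(e). The defining identity then says that T'(e) lies
in the matching nucleus. -/
theorem IsSemifield.nuclearParams_eq {mul : A → A → A} (hA : IsSemifield mul) :
    nuclearParams mul = mapParams mul := by
  obtain ⟨e, he⟩ := hA.exists_one
  have he1 : ∀ a, mul e a = a := fun a => (he a).1
  have he2 : ∀ a, mul a e = a := fun a => (he a).2
  let l : A → A →+ A := fun a => AddMonoidHom.mk' (mul a) (hA.left_distrib a)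
  let r : A → A →+ A := fun b => AddMonoidHom.mk' (fun a => mul a b) fun a a' => hA.right_distrib a a' b
  have hl : Function.Injective l := fun a a' h => by
    simpa [l, he2] using DFunLike.congr_fun h e
  have hr : Function.Injective r := fun a a' h => by
    simpa [r, he1] using DFunLike.congr_fun h e
  have left_spec : ∀ (T : A →+ A) (T' : A → A), (∀ a b, T (mul a b) = mul (T' a) b) →
      ∀ b, T b = mul (T' e) b ∧ T' b = T b := fun T T' h b =>
    ⟨by simpa [he1] using h e b, by simpa [he2] using (h b e).symm⟩
  have right_spec : ∀ (T : A →+ A) (T' : A → A), (∀ a b, T (mul a b) = mul a (T' b)) →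
      ∀ b, T b = mul b (T' e) ∧ T' b = T b := fun T T' h b =>
    ⟨by simpa [he2] using h b e, by simpa [he1] using (h e b).symm⟩
  ext
  · rfl
  · show Nat.card (leftNucleus mul) = Nat.card (leftMaps mul)
    rw [← Nat.card_image_of_injective hl]
    congr 2
    ext T
    constructor
    · rintro ⟨a, ha, rfl⟩
      exact ⟨mul a, ha⟩
    · rintro ⟨T', h⟩
      have hs := left_spec T T' h
      refine ⟨T' e, fun b c => ?_, AddMonoidHom.ext fun b => (hs b).1.symm⟩
      rw [← (hs _).1, ← (hs _).1, ← (hs b).2, h]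
  · show Nat.card (middleNucleus mul) = Nat.card (middleMaps mul)
    rw [← Nat.card_image_of_injective hl]
    congr 2
    ext T
    constructor
    · rintro ⟨x, hx, rfl⟩
      exact ⟨fun a => mul a x, fun a b => (hx a b).symm⟩
    · rintro ⟨T', h⟩
      have h1 : ∀ b, T b = mul (T' e) b := fun b => by simpa [he1] using (h e b).symm
      have h2 : ∀ a, T' a = mul a (T' e) := fun a => by
        have := h a e
        rwa [he2, h1 e, he2] at this
      refine ⟨T' e, fun a c => ?_, AddMonoidHom.ext fun b => (h1 b).symm⟩
      rw [← h1, ← h2, h]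
  · show Nat.card (rightNucleus mul) = Nat.card (rightMaps mul)
    rw [← Nat.card_image_of_injective hr]
    congr 2
    ext T
    constructor
    · rintro ⟨x, hx, rfl⟩
      exact ⟨fun a => mul a x, fun a b => (hx a b).symm⟩
    · rintro ⟨T', h⟩
      have hs := right_spec T T' h
      refine ⟨T' e, fun a b => ?_, AddMonoidHom.ext fun b => (hs b).1.symm⟩
      rw [← (hs _).1, ← (hs _).1, ← (hs b).2, h]
  · show Nat.card (centre mul) = Nat.card (centreMaps mul)
    rw [← Nat.card_image_of_injective hl]
    congr 2
    ext T
    constructor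
    · rintro ⟨a, ⟨h1, h2, h3, h4⟩, rfl⟩
      refine ⟨⟨mul a, h1⟩, mul a, fun b c => ?_⟩
      show mul a (mul b c) = _
      rw [h1, h4 b, h2]
    · rintro ⟨⟨T', h⟩, T'', h'⟩
      have hs := left_spec T T' h
      have hs' := right_spec T T'' h'
      have e1 : T' e = T e := (hs e).2
      have e2 : T'' e = T e := (hs' e).2
      have l1 : ∀ b, T b = mul (T e) b := fun b => by rw [(hs b).1, e1]
      have r1 : ∀ b, T b = mul b (T e) := fun b => by rw [(hs' b).1, e2]
      have l2 : ∀ a b, T (mul a b) = mul (T a) b := fun a b => by rw [h, (hs a).2]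
      have r2 : ∀ a b, T (mul a b) = mul a (T b) := fun a b => by rw [h', (hs' b).2]
      refine ⟨T e, ⟨fun b c => ?_, fun a c => ?_, fun a b => ?_, fun b => ?_⟩,
        AddMonoidHom.ext fun b => (l1 b).symm⟩
      · rw [← l1, ← l1, l2]
      · rw [← l1, ← r1, ← r2, l2]
      · rw [← r1, ← r1, r2]
      · rw [← l1, r1]

/-- The parameters of a semifield are invariant under isotopy. -/
theorem Isotopic.nuclearParams_eq {mulA : A → A → A} {mulB : B → B → B} (h : Isotopic mulA mulB)
    (hA : IsSemifield mulA) (hB : IsSemifield mulB) : nuclearParams mulA = nuclearParams mulB := by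
  rw [hA.nuclearParams_eq, hB.nuclearParams_eq, h.mapParams_eq]

/-- This discards commutative and degenerate presemifields, because in the new parameters every
nucleus is larger than the centre. -/
theorem left_eq_centre_of_leftMaps_subset {mul : A → A → A} (h : leftMaps mul ⊆ rightMaps mul) :
    (mapParams mul).left = (mapParams mul).centre := by
  show Nat.card (leftMaps mul) = Nat.card (centreMaps mul)
  rw [centreMaps, Set.inter_eq_left.2 h]

theorem leftMaps_subset_of_comm {mul : A → A → A} (h : ∀ a b, mul a b = mul b a) :
    leftMaps mul ⊆ rightMaps mul := by
  rintro T ⟨T', hT⟩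
  exact ⟨T', fun a b => by rw [h a b, hT, h]⟩

theorem pottZhouMul_comm {E : Type u} [Field E] (p k : ℕ) (τ : E ≃+* E) (α : E) (a b : E × E) :
    pottZhouMul p k τ α a b = pottZhouMul p k τ α b a := by
  ext
  · simp only [pottZhouMul]; ring_nf
  · simp only [pottZhouMul]; ring

end

/-! ### Nuclei computed from a spread set of skew polynomials -/

namespace SkewData

open SkewRing

variable {q n s : ℕ} (S : SkewData.{u} q n s)

/-- The action of a skew polynomial on `R / R f`. -/
noncomputable def act (p : S.R) : S.Carrier →+ S.Carrier := AddMonoidHom.mk' (p • ·) (smul_add p)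

@[simp] theorem act_apply (p : S.R) (m : S.Carrier) : S.act p m = p • m := rfl

theorem map_smul_of_commute {T : S.Carrier →+ S.Carrier}
    (hC : ∀ (a : S.L) m, T ((const a : S.R) • m) = (const a : S.R) • T m)
    (hX : ∀ m, T ((var : S.R) • m) = (var : S.R) • T m) (p : S.R) (m : S.Carrier) :
    T (p • m) = p • T m := by
  have hXi : ∀ (i : ℕ) m, T ((var : S.R) ^ i • m) = (var : S.R) ^ i • T m := by
    intro i
    induction i with
    | zero => simp
    | succ i ih => intro m; rw [pow_succ, mul_smul, mul_smul, ih, hX]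
  induction p using SkewRing.induction with
  | h0 => simp
  | hadd p q hp hq => rw [add_smul, add_smul, map_add, hp, hq]
  | hm i a => rw [monomial_eq, mul_smul, mul_smul, hC, hXi]

section
variable {mul : S.Carrier → S.Carrier → S.Carrier} {φ : S.Carrier → S.R}
  (hmul : ∀ a b, mul a b = φ a • b)
include hmul

/-- Every R-endomorphism commutes with the action of the spread set; this gives the lower bound q^s
on the right invariant. -/
theorem end_mem_rightMaps (e : Module.End S.R S.Carrier) :
    (e : S.Carrier →+ S.Carrier) ∈ rightMaps mul :=
  ⟨e, fun a b => by rw [hmul, hmul]; exact map_smul e _ _⟩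

theorem le_card_rightMaps (hn : 2 ≤ n) : q ^ s ≤ Nat.card (rightMaps mul) := by
  have : Finite (S.Carrier →+ S.Carrier) :=
    Finite.of_injective (fun e : S.Carrier →+ S.Carrier => (e : S.Carrier → S.Carrier))
      DFunLike.coe_injective
  rw [← S.card_end hn]
  refine Nat.card_le_card_of_injective
    (fun e : Module.End S.R S.Carrier => (⟨e, S.end_mem_rightMaps hmul e⟩ : rightMaps mul)) fun e e' h => ?_
  exact LinearMap.toAddMonoidHom_injective (Subtype.ext_iff.1 h)

theorem card_rightMaps (hn : 2 ≤ n) (H : ∀ T ∈ rightMaps mul,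
      (∀ (a : S.L) m, T ((const a : S.R) • m) = (const a : S.R) • T m) ∧
        ∀ m, T ((var : S.R) • m) = (var : S.R) • T m) :
    Nat.card (rightMaps mul) = q ^ s := by
  rw [← S.card_end hn]
  refine (Nat.card_congr (Equiv.ofBijective
    (fun e : Module.End S.R S.Carrier => (⟨e, S.end_mem_rightMaps hmul e⟩ : rightMaps mul)) ⟨fun e e' h => ?_, ?_⟩)).symm
  · exact LinearMap.toAddMonoidHom_injective (Subtype.ext_iff.1 h)
  · rintro ⟨T, hT⟩
    obtain ⟨hC, hX⟩ := H T hT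
    exact ⟨{ toFun := T, map_add' := map_add T, map_smul' := S.map_smul_of_commute hC hX }, rfl⟩

theorem mem_rightMaps_iff (H : ∀ T ∈ rightMaps mul,
      (∀ (a : S.L) m, T ((const a : S.R) • m) = (const a : S.R) • T m) ∧
        ∀ m, T ((var : S.R) • m) = (var : S.R) • T m) (T : S.Carrier →+ S.Carrier) :
    T ∈ rightMaps mul ↔ (∀ (a : S.L) m, T ((const a : S.R) • m) = (const a : S.R) • T m) ∧
        ∀ m, T ((var : S.R) • m) = (var : S.R) • T m :=
  ⟨H T, fun h => ⟨T, fun a b => by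
    rw [hmul, hmul, S.map_smul_of_commute h.1 h.2]⟩⟩

end

theorem act_const_injective (hn : 2 ≤ n) :
    Function.Injective fun a : S.L => S.act (const a) := by
  intro a b h
  have h1 : 1 ≤ n * s := Nat.mul_pos S.n_pos S.s_pos
  have := S.eq_of_smul_eq hn (degLT_mono h1 (const_mem_degLT a)) (degLT_mono h1 (const_mem_degLT b))
    fun m => DFunLike.congr_fun h m
  simpa using congrArg (fun p => SkewRing.coeff p 0) this

theorem card_image_act_const (hn : 2 ≤ n) (U : Set S.L) :
    Nat.card ((fun a : S.L => S.act (const a)) '' U) = Nat.card U :=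
  Nat.card_image_of_injective (S.act_const_injective hn) U

theorem act_const_commute_var (hn : 2 ≤ n) {a : S.L} :
    (∀ m, S.act (const a) ((var : S.R) • m) = (var : S.R) • S.act (const a) m) ↔ S.aut a = a := by
  constructor
  · intro h
    refine S.act_const_injective hn (AddMonoidHom.ext fun m => ?_)
    obtain ⟨m, rfl⟩ := S.var_smul_bijective.2 m
    simp only [act_apply]
    rw [← mul_smul, ← var_mul_const, mul_smul]
    exact (h m).symm
  · intro h m
    simp only [act_apply]
    rw [← mul_smul, ← mul_smul, var_mul_const, h]

theorem card_fixed : Nat.card {a : S.L | S.aut a = a} = q := by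
  have : {a : S.L | S.aut a = a} = Set.range (algebraMap S.K S.L) := by
    ext a
    refine ⟨fun h => S.exists_algebraMap_of_fixed h, ?_⟩
    rintro ⟨k, rfl⟩
    exact S.aut_algebraMap k
  rw [this, Nat.card_range_of_injective (algebraMap S.K S.L).injective, S.card_K]

/-- A constant always commutes with L, and it commutes with the action of x exactly when σ fixes it.
-/
theorem card_centreMaps_of_leftMaps_eq (hn : 2 ≤ n) {mul : S.Carrier → S.Carrier → S.Carrier}
    {U : Set S.L} (hl : leftMaps mul = (fun a : S.L => S.act (const a)) '' U)
    (hr : ∀ T, T ∈ rightMaps mul ↔ (∀ (a : S.L) m, T ((const a : S.R) • m) = (const a : S.R) • T m) ∧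
        ∀ m, T ((var : S.R) • m) = (var : S.R) • T m) :
    Nat.card (centreMaps mul) = Nat.card {a : S.L | a ∈ U ∧ S.aut a = a} := by
  rw [← S.card_image_act_const hn, centreMaps, hl]
  congr 2
  ext T
  constructor
  · rintro ⟨⟨a, ha, rfl⟩, hT⟩
    exact ⟨a, ⟨ha, (S.act_const_commute_var hn).1 ((hr _).1 hT).2⟩, rfl⟩
  · rintro ⟨a, ⟨ha, ha'⟩, rfl⟩
    refine ⟨⟨a, ha, rfl⟩, (hr _).2 ⟨fun b m => ?_, (S.act_const_commute_var hn).2 ha'⟩⟩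
    simp only [act_apply]
    rw [← mul_smul, ← mul_smul, ← map_mul, ← map_mul, mul_comm]

section
variable {mul : S.Carrier → S.Carrier → S.Carrier} {φ : S.Carrier → S.R}
  (hmul : ∀ a b, mul a b = φ a • b) {P : Set S.R} (hP : ∀ p ∈ P, ∃ a, φ a = p)
include hmul hP

theorem rightMaps_spec {T : S.Carrier →+ S.Carrier} (h : T ∈ rightMaps mul) :
    ∃ T' : S.Carrier → S.Carrier, ∀ p ∈ P, ∀ b, T (p • b) = p • T' b := by
  obtain ⟨T', h⟩ := h
  refine ⟨T', fun p hp b => ?_⟩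
  obtain ⟨a, rfl⟩ := hP p hp
  rw [← hmul, h, hmul]

/-- If the spread set contains `L x`, the maps in `rightMaps` are `L`-linear. -/
theorem rightMaps_map_const {T : S.Carrier →+ S.Carrier} (h : T ∈ rightMaps mul)
    (hlin : ∀ a, SkewRing.monomial S.aut 1 a ∈ P) (a : S.L) (m : S.Carrier) :
    T ((const a : S.R) • m) = (const a : S.R) • T m := by
  obtain ⟨T', h⟩ := S.rightMaps_spec hmul hP h
  obtain ⟨m, rfl⟩ := S.var_smul_bijective.2 m
  have h1 := h _ (hlin a) m
  have h2 := h _ (hlin 1) m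
  rw [monomial_eq, pow_one, mul_smul, mul_smul] at h1 h2
  rw [map_one, one_smul, one_smul] at h2
  show T ((const a : S.R) • (var : S.R) • m) = (const a : S.R) • T ((var : S.R) • m)
  rw [h1, h2]

end

section
variable {mul : S.Carrier → S.Carrier → S.Carrier} {φ : S.Carrier → S.R}
  (hmul : ∀ a b, mul a b = φ a • b) {P : Set S.R} (hφ : ∀ a, φ a ∈ P) (hP : ∀ p ∈ P, ∃ a, φ a = p)
include hmul hφ hP

theorem mem_leftMaps_iff {T : S.Carrier →+ S.Carrier} :
    T ∈ leftMaps mul ↔ ∀ p ∈ P, ∃ p' ∈ P, ∀ b, T (p • b) = p' • b := by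
  constructor
  · rintro ⟨T', h⟩ p hp
    obtain ⟨a, rfl⟩ := hP p hp
    exact ⟨φ (T' a), hφ _, fun b => by rw [← hmul, h, hmul]⟩
  · intro h
    choose g hg h using fun a => h (φ a) (hφ a)
    choose T' hT' using fun a => hP (g a) (hg a)
    exact ⟨T', fun a b => by rw [hmul, h, hmul, hT']⟩

theorem mem_middleMaps_iff {T : S.Carrier →+ S.Carrier} :
    T ∈ middleMaps mul ↔ ∀ p ∈ P, ∃ p' ∈ P, ∀ b, p' • b = p • T b := by
  constructor
  · rintro ⟨T', h⟩ p hp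
    obtain ⟨a, rfl⟩ := hP p hp
    exact ⟨φ (T' a), hφ _, fun b => by rw [← hmul, h, hmul]⟩
  · intro h
    choose g hg h using fun a => h (φ a) (hφ a)
    choose T' hT' using fun a => hP (g a) (hg a)
    exact ⟨T', fun a b => by rw [hmul, hmul, hT', h]⟩

/-- The parameters of a spread set that contains `1`. -/
theorem mapParams_of_one_mem (hn : 3 ≤ n) (hs : 2 ≤ s) (hdeg : ∀ p ∈ P, p ∈ degLT S.aut (s + 1))
    (h1 : 1 ∈ P) (hlin : ∀ i a, 1 ≤ i → i < s → SkewRing.monomial S.aut i a ∈ P)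
    (htop : ∀ x : S.L, (∀ b, ∃ p ∈ P, p.coeff s = x * b) → x = 0)
    (hUl : ∀ u : S.L, const u ∈ P → ∀ p ∈ P, const u * p ∈ P)
    (hUr : ∀ u : S.L, const u ∈ P → ∀ p ∈ P, p * const u ∈ P)
    (hK : ∀ k : S.K, const (algebraMap S.K S.L k) ∈ P) :
    mapParams mul = ⟨q ^ (n * s), Nat.card {u : S.L | const u ∈ P},
      Nat.card {u : S.L | const u ∈ P}, q ^ s, q⟩ := by
  have hn2 : 2 ≤ n := by omega
  -- With n ≥ 3, products of two elements of P stay in the range where the action determines the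
  -- skew polynomial.
  have hbound : s + s + 1 ≤ n * s := by nlinarith
  have hmem : ∀ p ∈ P, ∀ p' ∈ P, p * p' ∈ degLT S.aut (n * s) := fun p hp p' hp' =>
    degLT_mono hbound (mul_mem_degLT_succ (hdeg p hp) (hdeg p' hp'))
  have hmem1 : ∀ p ∈ P, p ∈ degLT S.aut (n * s) := fun p hp =>
    degLT_mono (by omega) (hdeg p hp)
  obtain ⟨r, rfl⟩ := Nat.exists_eq_add_of_le' hs
  have hconst : ∀ p ∈ P, (∀ i, 2 ≤ i → p.coeff i = 0) → p.coeff 1 = 0 → p = const (p.coeff 0) := by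
    intro p _ h h'
    ext i
    rw [SkewRing.coeff_const]
    split_ifs with hi
    · rw [hi]
    · rcases Nat.lt_or_ge i 2 with h2 | h2
      · rw [show i = 1 by omega, h']
      · exact h i h2
  have hl : leftMaps mul = (fun a : S.L => S.act (const a)) '' {u : S.L | const u ∈ P} := by
    ext T
    rw [S.mem_leftMaps_iff hmul hφ hP]
    constructor
    · intro h
      obtain ⟨p, hp, hTp⟩ := h 1 h1
      simp only [one_smul] at hTp
      have hpp : ∀ x ∈ P, p * x ∈ P := by
        intro x hx
        obtain ⟨x', hx', h'⟩ := h x hx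
        have : p * x = x' := S.eq_of_smul_eq hn2 (hmem p hp x hx) (hmem1 x' hx') fun m => by
          rw [mul_smul, ← hTp, h']
        rwa [this]
      have hc : ∀ b k, (p * SkewRing.monomial S.aut (r + 1) b).coeff (k + (r + 1)) =
          p.coeff k * (S.aut ^ k) b := fun b k => by
        rw [SkewRing.coeff_mul_monomial, if_pos (by omega), Nat.add_sub_cancel]
      -- Here s = r + 2. The product p x^(s-1) must have degree at most s, so p has degree at most
      -- 1.
      have h2 : ∀ i, 2 ≤ i → p.coeff i = 0 := by
        intro i hi
        have h3 := hdeg _ (hpp _ (hlin (r + 1) 1 (by omega) (by omega))) (i + (r + 1)) (by omega)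
        rw [hc] at h3
        simpa using h3
      -- The coefficient of x^s in p σ⁻¹(b) x^(s-1) is p_1 b. If p_1 were nonzero, these would fill
      -- L, against `htop`.
      have h3 : p.coeff 1 = 0 := htop _ fun b =>
        ⟨_, hpp _ (hlin (r + 1) ((S.aut).symm b) (by omega) (by omega)), by
          have := hc (S.aut.symm b) 1
          rw [show 1 + (r + 1) = r + 2 by omega] at this
          rw [this]; simp⟩
      have h4 := hconst p hp h2 h3
      refine ⟨p.coeff 0, ?_, AddMonoidHom.ext fun m => ?_⟩
      · rw [Set.mem_ofPred_eq, ← h4]; exact hp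
      · simp only [act_apply]; rw [← h4, hTp]
    · rintro ⟨u, hu, rfl⟩ p hp
      exact ⟨const u * p, hUl u hu p hp, fun b => by rw [act_apply, mul_smul]⟩
  have hm : middleMaps mul = (fun a : S.L => S.act (const a)) '' {u : S.L | const u ∈ P} := by
    ext T
    rw [S.mem_middleMaps_iff hmul hφ hP]
    constructor
    · intro h
      obtain ⟨p, hp, hTp⟩ := h 1 h1
      simp only [one_smul] at hTp
      have hpp : ∀ x ∈ P, x * p ∈ P := by
        intro x hx
        obtain ⟨x', hx', h'⟩ := h x hx
        have : x * p = x' := S.eq_of_smul_eq hn2 (hmem x hx p hp) (hmem1 x' hx') fun m => by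
          rw [mul_smul, hTp, h']
        rwa [this]
      have hc : ∀ b k, (SkewRing.monomial S.aut (r + 1) b * p).coeff (k + (r + 1)) =
          b * (S.aut ^ (r + 1)) (p.coeff k) := fun b k => by
        rw [SkewRing.coeff_monomial_mul, if_pos (by omega), Nat.add_sub_cancel]
      have h2 : ∀ i, 2 ≤ i → p.coeff i = 0 := by
        intro i hi
        have h3 := hdeg _ (hpp _ (hlin (r + 1) 1 (by omega) (by omega))) (i + (r + 1)) (by omega)
        rw [hc, one_mul] at h3
        exact (map_eq_zero_iff _ (S.aut ^ (r + 1)).injective).1 h3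
      have h3 : p.coeff 1 = 0 := by
        refine (map_eq_zero_iff _ (S.aut ^ (r + 1)).injective).1 (htop _ fun b =>
          ⟨_, hpp _ (hlin (r + 1) b (by omega) (by omega)), ?_⟩)
        have := hc b 1
        rw [show 1 + (r + 1) = r + 2 by omega, mul_comm] at this
        exact this
      have h4 := hconst p hp h2 h3
      refine ⟨p.coeff 0, ?_, AddMonoidHom.ext fun m => ?_⟩
      · rw [Set.mem_ofPred_eq, ← h4]; exact hp
      · simp only [act_apply]; rw [← h4, hTp]
    · rintro ⟨u, hu, rfl⟩ p hp
      exact ⟨p * const u, hUr u hu p hp, fun b => by rw [act_apply, mul_smul]⟩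
  have hr : ∀ T ∈ rightMaps mul,
      (∀ (a : S.L) m, T ((const a : S.R) • m) = (const a : S.R) • T m) ∧
        ∀ m, T ((var : S.R) • m) = (var : S.R) • T m := by
    intro T hT
    refine ⟨S.rightMaps_map_const hmul hP hT fun a => hlin 1 a le_rfl (by omega), fun m => ?_⟩
    obtain ⟨T', hT'⟩ := S.rightMaps_spec hmul hP hT
    have h2 := hT' 1 h1
    simp only [one_smul] at h2
    rw [h2 m]
    exact hT' _ (hlin 1 1 le_rfl (by omega)) m
  ext
  · exact S.card_carrier hn2
  · show Nat.card (leftMaps mul) = _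
    rw [hl, S.card_image_act_const hn2]
  · show Nat.card (middleMaps mul) = _
    rw [hm, S.card_image_act_const hn2]
  · exact S.card_rightMaps hmul hn2 hr
  · show Nat.card (centreMaps mul) = _
    rw [S.card_centreMaps_of_leftMaps_eq hn2 hl (S.mem_rightMaps_iff hmul hr)]
    refine Eq.trans ?_ S.card_fixed
    congr 2
    ext a
    refine ⟨fun h => h.2, fun h => ⟨?_, h⟩⟩
    obtain ⟨k, rfl⟩ := S.exists_algebraMap_of_fixed h
    exact hK k

end

end SkewData

/-! ### The family D: semifield property and parameters -/

namespace DData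

open SkewRing SkewData

section
variable {q t s : ℕ} (D : DData.{u} q (2 * t) s)

theorem finrank_K_L' : Module.finrank D.K D.L' = t := by
  have := D.finrank_L'
  omega

theorem card_L' : Nat.card D.L' = q ^ t := by
  rw [Module.natCard_eq_pow_finrank (K := D.K), D.card_K, finrank_K_L']

theorem finrank_L'_L (D : DData.{u} q (2 * t) s) : Module.finrank D.L' D.L = 2 := by
  have h := Module.finrank_mul_finrank D.K D.L' D.L
  have ht : 0 < 2 * t := D.n_pos
  rw [D.finrank_K_L', D.finrank_L, mul_comm] at h
  exact Nat.eq_of_mul_eq_mul_right (by omega) h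

/-- As [L : L'] = 2, the norm of l from L to L' is l²; transitivity of the norm does the rest. -/
theorem isSquare_norm {l : D.L} (hl : l ∈ D.L') : IsSquare (Algebra.norm D.K l) := by
  have h1 : Algebra.norm D.L' l = (⟨l, hl⟩ : D.L') ^ 2 := by
    have h := Algebra.norm_algebraMap (S := D.L) (⟨l, hl⟩ : D.L')
    rwa [D.finrank_L'_L] at h
  rw [← Algebra.norm_norm (S := D.L'), h1, map_pow]
  exact IsSquare.sq _

theorem γ_notMem : D.γ ∉ D.L' := fun h => D.γ_norm (D.isSquare_norm h)

theorem eq_zero_of_γ_mul_mem {a : D.L} (ha : a ∈ D.L') (h : D.γ * a ∈ D.L') : a = 0 := by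
  by_contra h0
  exact D.γ_notMem ((mul_div_cancel_right₀ D.γ h0) ▸ D.L'.div_mem h ha)

/-- The elements 1 and γ are independent over L', and |L'|² = |L|. -/
theorem exists_second (c : D.L) : ∃ a'' ∈ D.L', c - D.γ * a'' ∈ D.L' := by
  have hinj : Function.Injective fun p : D.L' × D.L' => (p.1 : D.L) + D.γ * p.2 := by
    rintro ⟨a, b⟩ ⟨a', b'⟩ h
    have h' : D.γ * ((b : D.L) - b') = a' - a := by
      simp only at h
      linear_combination h
    have hb : (b : D.L) - b' = 0 := D.eq_zero_of_γ_mul_mem (D.L'.sub_mem b.2 b'.2)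
      (h' ▸ D.L'.sub_mem a'.2 a.2)
    rw [hb, mul_zero, eq_comm, sub_eq_zero] at h'
    exact Prod.ext (Subtype.ext h'.symm) (Subtype.ext (sub_eq_zero.1 hb))
  have hbij := hinj.bijective_of_nat_card_le (by
    rw [Nat.card_prod, D.card_L', ← pow_add, D.card_L, two_mul])
  obtain ⟨⟨a, b⟩, h⟩ := hbij.2 c
  exact ⟨b, b.2, by rw [← h]; simp⟩

theorem second_spec (c : D.L) : D.second c ∈ D.L' ∧ c - D.γ * D.second c ∈ D.L' := by
  have h := D.exists_second c
  rw [second, dif_pos h]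
  exact h.choose_spec

theorem second_eq {c a : D.L} (ha : a ∈ D.L') (h : c - D.γ * a ∈ D.L') : D.second c = a := by
  obtain ⟨h1, h2⟩ := D.second_spec c
  rw [← sub_eq_zero]
  refine D.eq_zero_of_γ_mul_mem (D.L'.sub_mem h1 ha) ?_
  have := D.L'.sub_mem h h2
  convert this using 1
  ring

theorem second_add (c d : D.L) : D.second (c + d) = D.second c + D.second d := by
  obtain ⟨h1, h2⟩ := D.second_spec c
  obtain ⟨h3, h4⟩ := D.second_spec d
  refine D.second_eq (D.L'.add_mem h1 h3) ?_
  convert D.L'.add_mem h2 h4 using 1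
  ring

theorem aut_mem {l : D.L} (hl : l ∈ D.L') : D.aut l ∈ D.L' :=
  IntermediateField.normal_iff_forall_map_le.1 (inferInstance : Normal D.K D.L')
    (D.σ : D.L →ₐ[D.K] D.L) ⟨l, hl, rfl⟩

theorem aut_pow_mem {l : D.L} (hl : l ∈ D.L') (i : ℕ) : (D.aut ^ i) l ∈ D.L' := by
  induction i with
  | zero => exact hl
  | succ i ih => rw [pow_succ']; exact D.aut_mem ih

/-- The skew polynomial by which `a` acts in the product `a ⋆ b`. -/
noncomputable def spread (a : D.Carrier) : D.R :=
  rep a - const (D.γ / D.f.coeff 0 * D.second ((rep a).coeff 0)) * D.f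

theorem mul_eq (a b : D.Carrier) : D.mul a b = D.spread a • b := rfl

theorem spread_add (a b : D.Carrier) : D.spread (a + b) = D.spread a + D.spread b := by
  simp only [spread]
  rw [rep_add D.f_monic, SkewRing.coeff_add, second_add, mul_add, map_add, add_mul]
  abel

theorem mk_spread (a : D.Carrier) : SkewRing.mk D.f (D.spread a) = a := by
  rw [spread, map_sub, mk_mul_self, sub_zero, mk_rep D.f_monic]

/-- The spread set. -/
def spreadSet : Set D.R :=
  {p | p ∈ degLT D.aut (s + 1) ∧ p.coeff 0 ∈ D.L' ∧
    ∃ l ∈ D.L', p.coeff s = D.γ / D.f.coeff 0 * l}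

variable (ht : 2 ≤ t)

include ht in
theorem f_natDegree_eq : D.f.natDegree = s := D.f_natDegree (by omega)

include ht in
theorem f_coeff_s : D.f.coeff s = 1 := by
  have h : D.f.coeff D.f.natDegree = 1 := D.f_monic
  rwa [D.f_natDegree_eq ht] at h

include ht in
theorem f_mem_degLT : D.f ∈ degLT D.aut (s + 1) := by
  have h := mem_degLT_natDegree D.f
  rwa [D.f_natDegree_eq ht] at h

include ht in
-- Subtracting (γ/f_0) a_0'' f leaves a_0' as constant coefficient, and -(γ/f_0) a_0'' at x^s
-- because f is monic of degree s.
theorem spread_mem (a : D.Carrier) : D.spread a ∈ D.spreadSet := by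
  have h1 : rep a ∈ degLT D.aut s := by
    have h := rep_mem D.f_monic a
    rwa [D.f_natDegree_eq ht] at h
  obtain ⟨h2, h3⟩ := D.second_spec ((rep a).coeff 0)
  refine ⟨sub_mem (degLT_mono (Nat.le_succ s) h1) (const_mul_mem_degLT _ (D.f_mem_degLT ht)), ?_,
    -D.second ((rep a).coeff 0), D.L'.neg_mem h2, ?_⟩
  · have h4 := D.f_coeff_zero_ne
    convert h3 using 1
    rw [spread, SkewRing.coeff_sub, SkewRing.coeff_const_mul]
    field_simp
  · rw [spread, SkewRing.coeff_sub, SkewRing.coeff_const_mul, h1 s le_rfl, D.f_coeff_s ht]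
    ring

include ht in
theorem exists_spread_eq {p : D.R} (hp : p ∈ D.spreadSet) : ∃ a, D.spread a = p := by
  obtain ⟨h1, h2, l, hl, h3⟩ := hp
  have h4 := D.f_coeff_zero_ne
  have h5 : p - const (p.coeff s) * D.f ∈ degLT D.aut D.f.natDegree := by
    rw [D.f_natDegree_eq ht]
    refine mem_degLT_of_coeff_eq_zero
      (sub_mem h1 (const_mul_mem_degLT _ (D.f_mem_degLT ht))) ?_
    rw [SkewRing.coeff_sub, SkewRing.coeff_const_mul, D.f_coeff_s ht, mul_one, sub_self]
  refine ⟨SkewRing.mk D.f (p - const (p.coeff s) * D.f), ?_⟩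
  have h6 : D.second (p.coeff 0 - D.γ / D.f.coeff 0 * l * D.f.coeff 0) = -l := by
    refine D.second_eq (D.L'.neg_mem hl) ?_
    convert h2 using 1
    field_simp
    ring
  rw [spread, rep_mk D.f_monic h5, SkewRing.coeff_sub, SkewRing.coeff_const_mul, h3, h6, mul_neg,
    map_neg, neg_mul]
  abel

include ht in
-- If the skew polynomial p of a ≠ 0 kills b ≠ 0, then N(p_0) = N(f_0) N(p_s) = N(γ) N(l) with p_0
-- and l in L' and l ≠ 0. Norms from L' are squares, so N(γ) would be one. The class of 1 is the
-- identity.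
theorem isSemifield_mul : IsSemifield D.mul := by
  have hn : 2 ≤ 2 * t := by omega
  have := IsSimpleModule.nontrivial D.R D.Carrier
  refine ⟨⟨inferInstance, this, fun a b c => ?_, fun a b c => ?_, fun a b h => ?_⟩,
    SkewRing.mk D.f 1, fun a => ⟨?_, ?_⟩⟩
  · simp only [mul_eq, smul_add]
  · simp only [mul_eq, spread_add, add_smul]
  · by_contra! hab
    rw [mul_eq] at h
    obtain ⟨h1, h2, l, hl, h3⟩ := D.spread_mem ht a
    obtain ⟨h4, h5⟩ := D.norm_of_smul_eq_zero hn h1 hab.2 h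
    have h0 : (D.spread a).coeff s ≠ 0 := fun h0 => hab.1 (by
      rw [← D.mk_spread a, h4 h0, map_zero])
    have hl0 : l ≠ 0 := by rintro rfl; rw [mul_zero] at h3; exact h0 h3
    have h6 := D.f_coeff_zero_ne
    rw [h3, ← map_mul, show D.f.coeff 0 * (D.γ / D.f.coeff 0 * l) = D.γ * l by field_simp] at h5
    apply D.γ_norm
    have h7 : Algebra.norm D.K D.γ =
        Algebra.norm D.K ((D.spread a).coeff 0) / Algebra.norm D.K l := by
      rw [h5, map_mul, mul_div_cancel_right₀ _ (Algebra.norm_ne_zero_iff.2 hl0)]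
    rw [h7]
    exact (D.isSquare_norm h2).div (D.isSquare_norm hl)
  · have h1 : rep (SkewRing.mk D.f 1) = 1 := rep_mk D.f_monic (degLT_mono (by
      rw [D.f_natDegree_eq ht]; exact D.s_pos) (const_mem_degLT 1))
    have h2 : D.second 1 = 0 := D.second_eq D.L'.zero_mem (by simp [D.L'.one_mem])
    rw [mul_eq, spread, h1, SkewRing.coeff_one, if_pos rfl, h2, mul_zero, map_zero, zero_mul,
      sub_zero, one_smul]
  · rw [mul_eq, ← mk_eq_smul_one, mk_spread]

include ht in
theorem nuclearParams_mul (hs : 2 ≤ s) :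
    nuclearParams D.mul = ⟨q ^ (2 * t * s), q ^ t, q ^ t, q ^ s, q⟩ := by
  have hU : ∀ u : D.L, const u ∈ D.spreadSet ↔ u ∈ D.L' := by
    intro u
    refine ⟨fun h => by simpa using h.2.1, fun h => ⟨degLT_mono (by omega) (const_mem_degLT u),
      by simpa using h, 0, D.L'.zero_mem, ?_⟩⟩
    rw [SkewRing.coeff_const, if_neg (by omega), mul_zero]
  have hcard : Nat.card {u : D.L | const u ∈ D.spreadSet} = q ^ t := by
    simp only [hU]
    exact D.card_L'
  rw [(D.isSemifield_mul ht).nuclearParams_eq,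
    D.mapParams_of_one_mem D.mul_eq (D.spread_mem ht) (fun p hp => D.exists_spread_eq ht hp)
      (by omega) hs (fun p hp => hp.1), hcard]
  · rw [← map_one const, hU]; exact D.L'.one_mem
  · intro i a h1 h2
    refine ⟨monomial_mem_degLT (by omega) a, ?_, 0, D.L'.zero_mem, ?_⟩
    · rw [SkewRing.coeff_monomial, if_neg (by omega)]; exact D.L'.zero_mem
    · rw [SkewRing.coeff_monomial, if_neg (by omega), mul_zero]
  · intro x hx
    by_contra h0
    -- The available top coefficients form (γ/f_0)L', which has q^t elements; that is too few to
    -- cover xL with x ≠ 0.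
    have hsurj : Function.Surjective fun l : D.L' => x⁻¹ * (D.γ / D.f.coeff 0 * l) := by
      intro b
      obtain ⟨p, ⟨_, _, l, hl, h3⟩, h4⟩ := hx b
      exact ⟨⟨l, hl⟩, by
        show x⁻¹ * (D.γ / D.f.coeff 0 * l) = b
        rw [← h3, h4, inv_mul_cancel_left₀ h0]⟩
    have := Nat.card_le_card_of_surjective _ hsurj
    rw [D.card_L', D.card_L] at this
    have := (Nat.pow_le_pow_iff_right D.one_lt_q).1 this
    omega
  · intro u hu p ⟨h1, h2, l, hl, h3⟩
    rw [hU] at hu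
    refine ⟨const_mul_mem_degLT u h1, ?_, u * l, D.L'.mul_mem hu hl, ?_⟩
    · rw [SkewRing.coeff_const_mul]; exact D.L'.mul_mem hu h2
    · rw [SkewRing.coeff_const_mul, h3]; ring
  · intro u hu p ⟨h1, h2, l, hl, h3⟩
    rw [hU] at hu
    refine ⟨mul_const_mem_degLT u h1, ?_, (D.aut ^ s) u * l,
      D.L'.mul_mem (D.aut_pow_mem hu s) hl, ?_⟩
    · rw [coeff_mul_const]; exact D.L'.mul_mem h2 hu
    · rw [coeff_mul_const, h3]; ring
  · intro k
    rw [hU]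
    exact D.L'.algebraMap_mem k

end

end DData

/-! ### Invariants of the presemifields S for n ≥ 3 and s ≥ 2 -/

namespace SkewRing

variable {L : Type u} [Field L] {σ : L ≃+* L}

/-- Moving the variable past a skew polynomial applies `σ` to the coefficients. -/
theorem exists_var_mul_eq {p : SkewRing σ} {N : ℕ} (hp : p ∈ degLT σ N) :
    ∃ p' ∈ degLT σ N, var * p = p' * var ∧ ∀ i, p'.coeff i = σ (p.coeff i) := by
  obtain ⟨p', hp', h⟩ := exists_eq_mul_var (var_mul_mem_degLT hp) (coeff_var_mul_zero p)
  refine ⟨p', hp', h, fun i => ?_⟩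
  have := congrArg (fun p => coeff p (i + 1)) h
  simpa using this.symm

theorem mem_degLT_of_mul_mem_degLT_right {p g : SkewRing σ} {d e : ℕ} (hg : g ∈ degLT σ (e + 1))
    (hg0 : g.coeff e ≠ 0) (h : p * g ∈ degLT σ (d + e)) : p ∈ degLT σ d := by
  rcases eq_or_ne p 0 with rfl | hp
  · exact zero_mem _
  have hg' : g ≠ 0 := by rintro rfl; exact hg0 rfl
  have := natDegree_lt_of_mem_degLT (mul_ne_zero hp hg') h
  rw [natDegree_mul hp hg', natDegree_eq hg hg0] at this
  exact degLT_mono (by omega) (mem_degLT_natDegree p)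

theorem mem_degLT_of_mul_mem_degLT_left {p g : SkewRing σ} {d e : ℕ} (hg : g ∈ degLT σ (e + 1))
    (hg0 : g.coeff e ≠ 0) (h : g * p ∈ degLT σ (d + e)) : p ∈ degLT σ d := by
  rcases eq_or_ne p 0 with rfl | hp
  · exact zero_mem _
  have hg' : g ≠ 0 := by rintro rfl; exact hg0 rfl
  have := natDegree_lt_of_mem_degLT (mul_ne_zero hg' hp) h
  rw [natDegree_mul hg' hp, natDegree_eq hg hg0] at this
  exact degLT_mono (by omega) (mem_degLT_natDegree p)

@[simp] theorem coeff_var_zero : (var : SkewRing σ).coeff 0 = 0 := by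
  rw [var, SkewRing.coeff_monomial, if_neg one_ne_zero]

theorem eq_monomial_one {p : SkewRing σ} (hp : p ∈ degLT σ 2) (h0 : p.coeff 0 = 0) :
    p = const (p.coeff 1) * var := by
  obtain ⟨p', hp', rfl⟩ := exists_eq_mul_var hp h0
  have h1 := eq_sum_of_mem_degLT hp'
  rw [Finset.sum_range_one, monomial_zero_left] at h1
  rw [coeff_mul_var_succ, ← h1]

end SkewRing

namespace SData

open SkewRing SkewData

variable {q n s : ℕ} (S : SData.{u} q n s)

/-- The skew polynomial by which `a` acts in the product `a ∘ b`. -/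
noncomputable def spread (a : S.Carrier) : S.R :=
  rep a + SkewRing.monomial S.aut s (S.η * S.ρ ((rep a).coeff 0))

theorem mul_eq (a b : S.Carrier) : S.mul a b = S.spread a • b := rfl

/-- The spread set. -/
def spreadSet : Set S.R := {p | p ∈ degLT S.aut (s + 1) ∧ p.coeff s = S.η * S.ρ (p.coeff 0)}

theorem natDegree_f : S.f.natDegree = s := S.f_natDegree S.two_le

theorem rep_mem_degLT (a : S.Carrier) : rep a ∈ degLT S.aut s := by
  have h := rep_mem S.f_monic a
  rwa [S.natDegree_f] at h

theorem spread_mem (a : S.Carrier) : S.spread a ∈ S.spreadSet := by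
  have h := S.rep_mem_degLT a
  refine ⟨add_mem (degLT_mono (Nat.le_succ s) h) (monomial_mem_degLT (Nat.lt_succ_self s) _), ?_⟩
  have hs := S.s_pos
  rw [spread, SkewRing.coeff_add, SkewRing.coeff_add, h s le_rfl, SkewRing.coeff_monomial,
    SkewRing.coeff_monomial, if_pos rfl, if_neg hs.ne', add_zero, zero_add]

theorem exists_spread_eq {p : S.R} (hp : p ∈ S.spreadSet) : ∃ a, S.spread a = p := by
  obtain ⟨h1, h2⟩ := hp
  have hs := S.s_pos
  have h5 : p - SkewRing.monomial S.aut s (p.coeff s) ∈ degLT S.aut S.f.natDegree := by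
    rw [S.natDegree_f]
    refine mem_degLT_of_coeff_eq_zero (sub_mem h1 (monomial_mem_degLT (Nat.lt_succ_self s) _)) ?_
    rw [SkewRing.coeff_sub, SkewRing.coeff_monomial, if_pos rfl, sub_self]
  refine ⟨SkewRing.mk S.f (p - SkewRing.monomial S.aut s (p.coeff s)), ?_⟩
  rw [spread, rep_mk S.f_monic h5, SkewRing.coeff_sub, SkewRing.coeff_monomial, if_neg hs.ne',
    sub_zero, ← h2, sub_add_cancel]

theorem monomial_mem {i : ℕ} (h1 : 1 ≤ i) (h2 : i < s) (a : S.L) :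
    SkewRing.monomial S.aut i a ∈ S.spreadSet := by
  refine ⟨monomial_mem_degLT (by omega) a, ?_⟩
  rw [SkewRing.coeff_monomial, SkewRing.coeff_monomial, if_neg (by omega), if_neg (by omega),
    map_zero, mul_zero]

/-- For η = 0 the spread set consists of all skew polynomials of degree less than s, so every
constant belongs to it. -/
theorem mapParams_mul_of_eta_eq_zero (hn : 3 ≤ n) (hs : 2 ≤ s) (hη : S.η = 0) :
    mapParams S.mul = ⟨q ^ (n * s), q ^ n, q ^ n, q ^ s, q⟩ := by
  have hset : ∀ p : S.R, p ∈ S.spreadSet ↔ p ∈ degLT S.aut (s + 1) ∧ p.coeff s = 0 := by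
    intro p
    rw [spreadSet, Set.mem_ofPred_eq, hη, zero_mul]
  have hU : ∀ u : S.L, const u ∈ S.spreadSet := fun u => by
    rw [hset]
    exact ⟨degLT_mono (by omega) (const_mem_degLT u), by
      rw [SkewRing.coeff_const, if_neg (by omega)]⟩
  have hcard : Nat.card {u : S.L | const u ∈ S.spreadSet} = q ^ n := by
    rw [show {u : S.L | const u ∈ S.spreadSet} = Set.univ from Set.eq_univ_of_forall hU,
      Nat.card_univ, S.card_L]
  rw [S.mapParams_of_one_mem S.mul_eq S.spread_mem (fun p hp => S.exists_spread_eq hp) hn hs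
    (fun p hp => hp.1), hcard]
  · rw [← map_one const]; exact hU 1
  · exact fun i a h1 h2 => S.monomial_mem h1 h2 a
  · intro x hx
    obtain ⟨p, hp, h⟩ := hx 1
    rw [((hset p).1 hp).2, mul_one] at h
    exact h.symm
  · intro u _ p hp
    rw [hset] at hp ⊢
    exact ⟨const_mul_mem_degLT u hp.1, by rw [SkewRing.coeff_const_mul, hp.2, mul_zero]⟩
  · intro u _ p hp
    rw [hset] at hp ⊢
    exact ⟨mul_const_mem_degLT u hp.1, by rw [coeff_mul_const, hp.2, zero_mul]⟩
  · exact fun k => hU _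

/-- An element of the spread set with constant coefficient `1`. -/
noncomputable def unitElement : S.R := 1 + SkewRing.monomial S.aut s S.η

theorem coeff_unitElement_zero : S.unitElement.coeff 0 = 1 := by
  rw [unitElement, SkewRing.coeff_add, SkewRing.coeff_one, if_pos rfl, SkewRing.coeff_monomial,
    if_neg S.s_pos.ne', add_zero]

theorem coeff_unitElement_s : S.unitElement.coeff s = S.η := by
  rw [unitElement, SkewRing.coeff_add, SkewRing.coeff_one, if_neg S.s_pos.ne',
    SkewRing.coeff_monomial, if_pos rfl, zero_add]

theorem unitElement_mem : S.unitElement ∈ S.spreadSet := by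
  refine ⟨add_mem (degLT_mono (by omega) (const_mem_degLT 1))
    (monomial_mem_degLT (Nat.lt_succ_self s) _), ?_⟩
  rw [coeff_unitElement_zero, coeff_unitElement_s, map_one, mul_one]

section
variable (hn : 3 ≤ n) (hs : 2 ≤ s) (hη : S.η ≠ 0)

include hn in
theorem mul_mem_degLT_card {p p' : S.R} (hp : p ∈ degLT S.aut (s + 1))
    (hp' : p' ∈ degLT S.aut (s + 1)) : p * p' ∈ degLT S.aut (n * s) := by
  have hs := S.s_pos
  exact degLT_mono (by nlinarith) (mul_mem_degLT_succ hp hp')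

include hn hs in
theorem mem_degLT_card {p : S.R} (hp : p ∈ degLT S.aut (s + 2)) : p ∈ degLT S.aut (n * s) :=
  degLT_mono (by nlinarith) hp

theorem eq_const_mul_var {c : S.R} (hc : c ∈ S.spreadSet) (h0 : c.coeff 0 = 0)
    (hdeg : c ∈ degLT S.aut s → c ∈ degLT S.aut 2) : c = const (c.coeff 1) * var := by
  have h1 : c ∈ degLT S.aut s := mem_degLT_of_coeff_eq_zero hc.1 (by
    rw [hc.2, h0, map_zero, mul_zero])
  exact eq_monomial_one (hdeg h1) h0

include hn hs hη in
-- The spread set does not contain 1, so T is recovered from its effect on x and on e = 1 + η x^s.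
-- As operators, T x = c and T e = d; with x c = c' x this gives x T = c' and c' e = x d. Since e
-- has constant coefficient 1 and degree s, c' is a constant times x. So T is multiplication by some
-- u, and u e in the spread set means ρ(u) = u.
theorem leftMaps_mul :
    leftMaps S.mul = (fun a : S.L => S.act (const a)) '' {u | S.ρ u = u} := by
  have hn2 : 2 ≤ n := by omega
  ext T
  rw [S.mem_leftMaps_iff S.mul_eq S.spread_mem fun p hp => S.exists_spread_eq hp]
  constructor
  · intro h
    obtain ⟨c, hc, hTc⟩ := h _ (S.monomial_mem le_rfl hs 1)
    obtain ⟨d, hd, hTd⟩ := h _ S.unitElement_mem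
    obtain ⟨c', hc', hcv, hcc⟩ := exists_var_mul_eq hc.1
    have hT : ∀ m, (var : S.R) • T m = c' • m := by
      intro m
      obtain ⟨m, rfl⟩ := S.var_smul_bijective.2 m
      show (var : S.R) • T ((var : S.R) • m) = c' • (var : S.R) • m
      rw [← mul_smul c', ← hcv, mul_smul, ← hTc]; rfl
    have heq : c' * S.unitElement = var * d :=
      S.eq_of_smul_eq hn2 (S.mul_mem_degLT_card hn hc' S.unitElement_mem.1)
        (S.mem_degLT_card hn hs (var_mul_mem_degLT hd.1))
        fun m => by rw [mul_smul, ← hT, hTd, mul_smul]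
    have h0 : c.coeff 0 = 0 := by
      have h1 := congrArg (fun p => SkewRing.coeff p 0) heq
      simp only [coeff_mul_zero, S.coeff_unitElement_zero, coeff_var_zero, zero_mul, mul_one, hcc] at h1
      exact (map_eq_zero_iff _ S.aut.injective).1 h1
    have h2 : c' ∈ degLT S.aut 2 :=
      mem_degLT_of_mul_mem_degLT_right S.unitElement_mem.1 (by rwa [S.coeff_unitElement_s])
        (by rw [heq, add_comm 2 s]; exact var_mul_mem_degLT hd.1)
    have hcu := S.eq_const_mul_var hc h0 fun _ i hi => by
      have := h2 i hi
      rw [hcc] at this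
      exact (map_eq_zero_iff _ S.aut.injective).1 this
    have hTu : T = S.act (const (c.coeff 1)) := by
      ext m
      obtain ⟨m, rfl⟩ := S.var_smul_bijective.2 m
      have := hTc m
      rw [hcu, mul_smul] at this
      exact this
    refine ⟨c.coeff 1, ?_, hTu.symm⟩
    have h3 : const (c.coeff 1) * S.unitElement = d :=
      S.eq_of_smul_eq hn2 (S.mem_degLT_card hn hs (const_mul_mem_degLT _
        (degLT_mono (Nat.le_succ _) S.unitElement_mem.1)))
        (S.mem_degLT_card hn hs (degLT_mono (Nat.le_succ _) hd.1))
        fun m => by rw [mul_smul, ← hTd, hTu]; rfl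
    have h4 := hd.2
    rw [← h3, SkewRing.coeff_const_mul, SkewRing.coeff_const_mul, S.coeff_unitElement_s,
      S.coeff_unitElement_zero, mul_one, mul_comm] at h4
    exact (mul_left_cancel₀ hη h4).symm
  · rintro ⟨u, hu, rfl⟩ p hp
    refine ⟨const u * p, ⟨const_mul_mem_degLT u hp.1, ?_⟩, fun b => by rw [act_apply, mul_smul]⟩
    rw [SkewRing.coeff_const_mul, SkewRing.coeff_const_mul, hp.2, map_mul, show S.ρ u = u from hu]
    ring

include hn hs hη in
-- The argument for left maps on the other side: x T = c and e T = d. Multiplying e by u from the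
-- right twists its top coefficient by σ^s, whence ρ(u) = σ^s(u).
theorem middleMaps_mul :
    middleMaps S.mul = (fun a : S.L => S.act (const a)) '' {u | S.ρ u = (S.aut ^ s) u} := by
  have hn2 : 2 ≤ n := by omega
  ext T
  rw [S.mem_middleMaps_iff S.mul_eq S.spread_mem fun p hp => S.exists_spread_eq hp]
  constructor
  · intro h
    obtain ⟨c, hc, hTc⟩ := h _ (S.monomial_mem le_rfl hs 1)
    replace hTc : ∀ b, c • b = (var : S.R) • T b := hTc
    obtain ⟨d, hd, hTd⟩ := h _ S.unitElement_mem
    obtain ⟨p', hp', hpv, hpp⟩ := exists_var_mul_eq S.unitElement_mem.1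
    have heq : p' * c = var * d :=
      S.eq_of_smul_eq hn2 (S.mul_mem_degLT_card hn hp' hc.1)
        (S.mem_degLT_card hn hs (var_mul_mem_degLT hd.1))
        fun m => by rw [mul_smul, hTc, ← mul_smul, ← hpv, mul_smul, mul_smul, hTd]
    have h0 : c.coeff 0 = 0 := by
      have h1 := congrArg (fun p => SkewRing.coeff p 0) heq
      simpa only [coeff_mul_zero, hpp, S.coeff_unitElement_zero, map_one, one_mul,
        coeff_var_zero, zero_mul] using h1
    have h2 : c ∈ degLT S.aut 2 :=
      mem_degLT_of_mul_mem_degLT_left hp' (by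
        rw [hpp, S.coeff_unitElement_s]
        exact (map_ne_zero_iff _ S.aut.injective).2 hη)
        (by rw [heq, add_comm 2 s]; exact var_mul_mem_degLT hd.1)
    have hcu := S.eq_const_mul_var hc h0 fun _ => h2
    set u := S.aut.symm (c.coeff 1) with hu
    have hTu : T = S.act (const u) := by
      ext m
      apply S.var_smul_injective
      show (var : S.R) • T m = (var : S.R) • (const u : S.R) • m
      rw [← hTc, ← mul_smul, var_mul_const, hu, RingEquiv.apply_symm_apply, ← hcu]
    refine ⟨u, ?_, hTu.symm⟩
    have h3 : S.unitElement * const u = d :=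
      S.eq_of_smul_eq hn2 (S.mem_degLT_card hn hs (mul_const_mem_degLT _
        (degLT_mono (Nat.le_succ _) S.unitElement_mem.1)))
        (S.mem_degLT_card hn hs (degLT_mono (Nat.le_succ _) hd.1))
        fun m => by rw [mul_smul, hTd, hTu]; rfl
    have h4 := hd.2
    rw [← h3, coeff_mul_const, coeff_mul_const, S.coeff_unitElement_s,
      S.coeff_unitElement_zero, one_mul] at h4
    exact (mul_left_cancel₀ hη h4).symm
  · rintro ⟨u, hu, rfl⟩ p hp
    refine ⟨p * const u, ⟨mul_const_mem_degLT u hp.1, ?_⟩, fun b => by rw [act_apply, mul_smul]⟩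
    rw [coeff_mul_const, coeff_mul_const, hp.2, map_mul, pow_zero,
      ← show S.ρ u = (S.aut ^ s) u from hu, RingAut.one_apply]
    ring

include hn hs in
-- The element x gives T(x b) = x T'(b), so only T' = T is needed. For s ≥ 3 this follows from x² in
-- the spread set; for s = 2 the elements a + η ρ(a) x² have to be compared.
theorem rightMaps_mul_linear (T : S.Carrier →+ S.Carrier) (hT : T ∈ rightMaps S.mul) :
    (∀ (a : S.L) m, T ((const a : S.R) • m) = (const a : S.R) • T m) ∧
      ∀ m, T ((var : S.R) • m) = (var : S.R) • T m := by
  have hC := S.rightMaps_map_const S.mul_eq (fun p hp => S.exists_spread_eq hp) hT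
    fun a => S.monomial_mem le_rfl hs a
  refine ⟨hC, ?_⟩
  obtain ⟨T', hT'⟩ := S.rightMaps_spec S.mul_eq (fun p hp => S.exists_spread_eq hp) hT
  have hv : ∀ m, T ((var : S.R) • m) = (var : S.R) • T' m := hT' _ (S.monomial_mem le_rfl hs 1)
  suffices H : ∀ m, T' m = T m by
    intro m; rw [hv, H]
  have hinj := S.var_smul_injective
  rcases hs.lt_or_eq with hs3 | rfl
  · intro m
    obtain ⟨m, rfl⟩ := S.var_smul_bijective.2 m
    show T' ((var : S.R) • m) = T ((var : S.R) • m)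
    have h2 := hT' _ (S.monomial_mem one_le_two hs3 1) m
    rw [← var_pow, pow_two, mul_smul, mul_smul, hv] at h2
    rw [hinj h2, hv]
  -- Put Δ = T - T'. Comparing this relation for a with the one for a = 1 yields a Δ(b) = ρ(a) Δ(b).
  · have hstar : ∀ (a : S.L) b, (const a : S.R) • (T b - T' b) =
        (const (S.η * S.ρ a) : S.R) • (var : S.R) • (T ((var : S.R) • b) - T' ((var : S.R) • b)) := by
      intro a b
      have h2 := hT' (const a + SkewRing.monomial S.aut 2 (S.η * S.ρ a))
        ⟨add_mem (degLT_mono (by omega) (const_mem_degLT a))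
          (monomial_mem_degLT (Nat.lt_succ_self 2) _), by
          simp [SkewRing.coeff_const, SkewRing.coeff_monomial]⟩ b
      rw [monomial_eq, pow_two, add_smul, add_smul, map_add, hC, mul_smul, mul_smul, mul_smul,
        mul_smul, hC, hv] at h2
      rw [smul_sub, smul_sub, smul_sub, hv b, sub_eq_sub_iff_add_eq_add, h2, add_comm]
    have hone : ∀ b, T b - T' b =
        (const S.η : S.R) • (var : S.R) • (T ((var : S.R) • b) - T' ((var : S.R) • b)) := by
      intro b
      simpa using hstar 1 b
    have hzero : ∀ (a a' : S.L) (m : S.Carrier), a ≠ a' →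
        (const a : S.R) • m = (const a' : S.R) • m → m = 0 := by
      intro a a' m h h'
      rw [← sub_eq_zero, ← sub_smul, ← map_sub] at h'
      exact ((isUnit_const (sub_ne_zero.2 h)).smul_eq_zero).1 h'
    suffices H : ∀ b, T b - T' b = 0 from fun m => (sub_eq_zero.1 (H m)).symm
    intro b
    -- For ρ = 1 that relation is empty. But then T' is L-linear too, and replacing b by a b gives a
    -- Δ(b) = σ²(a) Δ(b), where σ² ≠ 1 because n ≥ 3.
    by_cases hρ : ∀ a, S.ρ a = a
    · have hC' : ∀ (a : S.L) m, T' ((const a : S.R) • m) = (const a : S.R) • T' m := by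
        intro a m
        apply hinj
        show (var : S.R) • T' ((const a : S.R) • m) = (var : S.R) • (const a : S.R) • T' m
        rw [← hv, ← mul_smul, var_mul_const, mul_smul, hC, hv, ← mul_smul, ← var_mul_const,
          mul_smul]
      obtain ⟨a, ha⟩ : ∃ a, (S.aut ^ 2) a ≠ (S.aut ^ 0) a := by
        by_contra! h
        have := Nat.le_of_dvd two_pos ((Nat.modEq_zero_iff_dvd).1 (S.aut_pow_eq_iff.1 h))
        omega
      refine hzero _ _ _ ha ?_
      have h3 := hone ((const a : S.R) • b)
      rw [hC, hC', ← mul_smul var, var_mul_const, mul_smul, hC, hC', ← smul_sub, ← smul_sub,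
        ← mul_smul var, var_mul_const, mul_smul, ← mul_smul (const S.η), ← map_mul, mul_comm,
        map_mul, mul_smul, ← hone b] at h3
      exact h3.symm
    · obtain ⟨a, ha⟩ := not_forall.1 hρ
      refine hzero _ _ _ ha ?_
      rw [hstar a b, mul_comm, map_mul, mul_smul, ← hone]

include hn hs hη in
theorem mapParams_mul_of_eta_ne_zero : mapParams S.mul = ⟨q ^ (n * s),
    Nat.card {u : S.L | S.ρ u = u}, Nat.card {u : S.L | S.ρ u = (S.aut ^ s) u}, q ^ s,
    Nat.card {u : S.L | S.ρ u = u ∧ S.aut u = u}⟩ := by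
  have hn2 : 2 ≤ n := by omega
  have hr := S.rightMaps_mul_linear hn hs
  ext
  · exact S.card_carrier hn2
  · show Nat.card (leftMaps S.mul) = _
    rw [S.leftMaps_mul hn hs hη, S.card_image_act_const hn2]
  · show Nat.card (middleMaps S.mul) = _
    rw [S.middleMaps_mul hn hs hη, S.card_image_act_const hn2]
  · exact S.card_rightMaps S.mul_eq hn2 hr
  · show Nat.card (centreMaps S.mul) = _
    rw [S.card_centreMaps_of_leftMaps_eq hn2 (S.leftMaps_mul hn hs hη)
      (S.mem_rightMaps_iff S.mul_eq hr)]
    rfl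

end

end SData

/-! ### Additive maps of finite fields and generalized twisted fields (the case s = 1) -/

section
variable {L : Type u} [Field L]

/-- Dedekind's independence of characters. -/
theorem sum_mul_ringEquiv_eq_zero [Fintype (L ≃+* L)] {c : (L ≃+* L) → L}
    (h : ∀ x, ∑ g, c g * g x = 0) (g : L ≃+* L) : c g = 0 := by
  have hinj : Function.Injective fun g : L ≃+* L => ((g : L →+* L) : L →* L) := fun g g' h =>
    RingEquiv.ext fun x => DFunLike.congr_fun h x
  have hli := (linearIndependent_monoidHom L L).comp _ hinj
  refine Fintype.linearIndependent_iff.1 hli c ?_ g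
  ext x
  simpa using h x

theorem two_term_independence {α β : L ≃+* L} (hαβ : α ≠ β) {x y : L}
    (h : ∀ a, x * α a + y * β a = 0) : x = 0 ∧ y = 0 := by
  obtain ⟨a, ha⟩ : ∃ a, α a ≠ β a := by
    by_contra! h'
    exact hαβ (RingEquiv.ext h')
  have h1 := h 1
  rw [map_one, map_one] at h1
  have h2 : x * (α a - β a) = 0 := by linear_combination h a - β a * h1
  have hx : x = 0 := (mul_eq_zero.1 h2).resolve_right (sub_ne_zero.2 ha)
  refine ⟨hx, ?_⟩
  simpa [hx] using h1

variable [Finite L]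

instance finite_ringAut : Finite (L ≃+* L) :=
  Finite.of_injective (fun e : L ≃+* L => (e : L → L)) DFunLike.coe_injective

/-- Over a finite field, ring automorphisms are automorphisms over the prime field. -/
def algEquivEquivRingEquiv (p : ℕ) [Algebra (ZMod p) L] :
    (L ≃ₐ[ZMod p] L) ≃ (L ≃+* L) where
  toFun g := (g : L ≃+* L)
  invFun g := AlgEquiv.ofRingEquiv (f := g) fun r =>
    RingHom.congr_fun (RingHom.ext_zmod ((g : L →+* L).comp (algebraMap (ZMod p) L))
      (algebraMap (ZMod p) L)) r
  left_inv g := by ext; rfl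
  right_inv g := by ext; rfl

theorem ringAut_mul_comm (g h : L ≃+* L) : g * h = h * g := by
  obtain ⟨p, _⟩ := CharP.exists L
  have : Fact p.Prime := ⟨(CharP.char_is_prime_or_zero L p).resolve_right (CharP.char_ne_zero_of_finite L p)⟩
  let := ZMod.algebra L p
  obtain ⟨g, rfl⟩ := (algEquivEquivRingEquiv p).surjective g
  obtain ⟨h, rfl⟩ := (algEquivEquivRingEquiv p).surjective h
  have : g * h = h * g := IsMulCommutative.is_comm.comm g h
  exact congrArg (algEquivEquivRingEquiv p) this

/-- Additive maps of a finite field are combinations of automorphisms. -/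
theorem exists_eq_sum_mul_ringEquiv [Fintype (L ≃+* L)] (T : L →+ L) :
    ∃ c : (L ≃+* L) → L, ∀ x, T x = ∑ g, c g * g x := by
  classical
  obtain ⟨p, _⟩ := CharP.exists L
  have : Fact p.Prime := ⟨(CharP.char_is_prime_or_zero L p).resolve_right (CharP.char_ne_zero_of_finite L p)⟩
  let := ZMod.algebra L p
  have : Module.Finite (ZMod p) L := Module.Finite.of_finite
  have hinj : Function.Injective fun g : L ≃ₐ[ZMod p] L => (g : L →ₐ[ZMod p] L) := fun g g' h =>
    AlgEquiv.ext fun x => DFunLike.congr_fun h x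
  have hli := (linearIndependent_toLinearMap (ZMod p) L L).comp _ hinj
  -- The independent family of automorphisms has as many members as the L-dimension of the space of
  -- additive maps, so it spans.
  have hcard : Fintype.card (L ≃ₐ[ZMod p] L) = Module.finrank L (L →ₗ[ZMod p] L) := by
    rw [Module.finrank_linearMap_self, ← Nat.card_eq_fintype_card, IsGalois.card_aut_eq_finrank]
  have hspan := hli.span_eq_top_of_card_eq_finrank' hcard
  have hT : (AddMonoidHom.toZModLinearMap p T) ∈ (⊤ : Submodule L (L →ₗ[ZMod p] L)) :=
    Submodule.mem_top
  rw [← hspan, Submodule.mem_span_range_iff_exists_fun] at hT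
  obtain ⟨c, hc⟩ := hT
  refine ⟨fun g => c ((algEquivEquivRingEquiv p).symm g), fun x => ?_⟩
  have h1 := DFunLike.congr_fun hc x
  rw [LinearMap.sum_apply] at h1
  rw [← (algEquivEquivRingEquiv p).sum_comp]
  simp only [Equiv.symm_apply_apply]
  exact h1.symm

end

section
variable {L : Type u} [Field L]

/-- The multiplication of a generalized twisted field. -/
def twistedMul (c : L) (ρ σ : L ≃+* L) (a b : L) : L := a * b + c * ρ a * σ b

/-- Multiplication by `u` as an additive map. -/
def mulHom (u : L) : L →+ L := AddMonoidHom.mulLeft u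

theorem mulHom_apply (u x : L) : mulHom u x = u * x := rfl

theorem mulHom_injective : Function.Injective (mulHom : L → L →+ L) := fun u v h => by
  simpa [mulHom_apply] using DFunLike.congr_fun h 1

variable {c : L} {ρ σ : L ≃+* L}

theorem mulHom_mem_leftMaps {u : L} (hu : ρ u = u) : mulHom u ∈ leftMaps (twistedMul c ρ σ) :=
  ⟨fun a => u * a, fun a b => by simp only [mulHom_apply, twistedMul, map_mul, hu]; ring⟩

theorem mulHom_mem_middleMaps {u : L} (hu : ρ u = σ u) :
    mulHom u ∈ middleMaps (twistedMul c ρ σ) :=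
  ⟨fun a => u * a, fun a b => by simp only [mulHom_apply, twistedMul, map_mul, hu]; ring⟩

theorem mulHom_mem_rightMaps {u : L} (hu : σ u = u) : mulHom u ∈ rightMaps (twistedMul c ρ σ) :=
  ⟨fun a => u * a, fun a b => by simp only [mulHom_apply, twistedMul, map_mul, hu]; ring⟩

theorem eq_mulHom_of_coeff_eq_zero [Fintype (L ≃+* L)] {T : L →+ L} {t : (L ≃+* L) → L}
    (ht : ∀ x, T x = ∑ g, t g * g x) (h : ∀ g, g ≠ 1 → t g = 0) : T = mulHom (t 1) := by
  ext x
  rw [ht, Finset.sum_eq_single 1 (fun g _ hg => by rw [h g hg, zero_mul])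
    (fun h => absurd (Finset.mem_univ _) h)]
  rfl

theorem ne_one_of_mul_self_ne_one (h3 : σ * σ ≠ 1) : σ ≠ 1 := by
  rintro rfl; exact h3 (one_mul 1)

/-- For g ≠ τ the hypothesis applies directly; t_τ is the shifted coefficient at τ², which is
neither 1 nor τ. -/
theorem coeff_eq_zero_of_mul_support {t : (L ≃+* L) → L} {τ : L ≃+* L}
    (h : ∀ g, g ≠ 1 → g ≠ τ → t g = 0 ∧ t (g * τ⁻¹) = 0) {g : L ≃+* L} (hg : g ≠ 1)
    (hg' : g = τ → τ * τ ≠ 1) : t g = 0 := by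
  by_cases hgτ : g = τ
  · have h4 := hg' hgτ
    subst hgτ
    have := (h (g * g) h4 (fun h5 => hg (mul_eq_left.1 h5))).2
    rwa [mul_inv_cancel_right] at this
  · exact (h g hg hgτ).1

variable [Finite L] (hc : c ≠ 0) (h1 : ρ ≠ 1) (h2 : ρ ≠ σ) (h3 : σ * σ ≠ 1)

include hc h2 h3 in
-- Expand T as the sum of t_g g and compare the coefficients of g(b). For g outside {1, σ} the
-- remaining identity in a involves the distinct automorphisms g and gσ⁻¹ρ, so t_g and t_(gσ⁻¹)
-- vanish. As σ² ≠ 1, this also covers t_σ, and only t_1 survives.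
theorem leftMaps_twistedMul :
    leftMaps (twistedMul c ρ σ) = mulHom '' {u | ρ u = u} := by
  classical
  have := Fintype.ofFinite (L ≃+* L)
  have hσ := ne_one_of_mul_self_ne_one h3
  ext T
  constructor
  · rintro ⟨T', hT⟩
    obtain ⟨t, ht⟩ := exists_eq_sum_mul_ringEquiv T
    have key : ∀ a g, t g * g a + t (g * σ⁻¹) * (g * σ⁻¹) (c * ρ a) -
        ((if g = 1 then T' a else 0) + if g = σ then c * ρ (T' a) else 0) = 0 := by
      intro a g
      refine sum_mul_ringEquiv_eq_zero (c := fun g => t g * g a + t (g * σ⁻¹) * (g * σ⁻¹) (c * ρ a) -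
        ((if g = 1 then T' a else 0) + if g = σ then c * ρ (T' a) else 0)) (fun b => ?_) g
      have h := hT a b
      simp only [twistedMul] at h
      rw [map_add, ht, ht] at h
      have h5 : ∑ g, t g * g (c * ρ a * σ b) = ∑ g, t (g * σ⁻¹) * (g * σ⁻¹) (c * ρ a) * g b := by
        refine Eq.trans ?_ (Equiv.sum_comp (Equiv.mulRight σ) _)
        refine Finset.sum_congr rfl fun g _ => ?_
        simp only [Equiv.coe_mulRight]
        rw [mul_inv_cancel_right, map_mul, RingAut.mul_apply, mul_assoc]
      rw [h5] at h
      simp only [sub_mul, add_mul, ite_mul, zero_mul, Finset.sum_sub_distrib, Finset.sum_add_distrib,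
        Finset.sum_ite_eq', Finset.mem_univ, if_true, RingAut.one_apply]
      rw [← h]
      simp only [map_mul, mul_assoc]
      ring
    have hz : ∀ g, g ≠ 1 → g ≠ σ → t g = 0 ∧ t (g * σ⁻¹) = 0 := by
      intro g hg hg'
      have hne : g ≠ g * σ⁻¹ * ρ := by
        intro h
        rw [mul_assoc, eq_comm, mul_eq_left, inv_mul_eq_one] at h
        exact h2 h.symm
      have h := two_term_independence hne (x := t g) (y := t (g * σ⁻¹) * (g * σ⁻¹) c) fun a => by
        have := key a g
        rw [if_neg hg, if_neg hg', map_mul] at this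
        rw [RingAut.mul_apply (g * σ⁻¹) ρ]
        linear_combination this
      refine ⟨h.1, (mul_eq_zero.1 h.2).resolve_right ?_⟩
      exact (map_ne_zero_iff _ (g * σ⁻¹).injective).2 hc
    have hT1 := eq_mulHom_of_coeff_eq_zero ht fun g hg =>
      coeff_eq_zero_of_mul_support hz hg fun _ => h3
    refine ⟨t 1, ?_, hT1.symm⟩
    rw [hT1] at hT
    have h := two_term_independence hσ.symm (x := t 1 * 1 - T' 1) (y := t 1 * c - c * ρ (T' 1))
      fun b => by
        have := hT 1 b
        simp only [mulHom_apply, twistedMul, map_one] at this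
        rw [RingAut.one_apply]
        linear_combination this
    have h4 : T' 1 = t 1 := by linear_combination -h.1
    have h5 := h.2
    rw [h4] at h5
    refine mul_left_cancel₀ hc ?_
    linear_combination -h5
  · rintro ⟨u, hu, rfl⟩
    exact mulHom_mem_leftMaps hu

include hc h1 h3 in
-- The same comparison, except that the automorphisms acting on a are now 1 and ρ; hence the
-- condition ρ ≠ 1.
theorem middleMaps_twistedMul :
    middleMaps (twistedMul c ρ σ) = mulHom '' {u | ρ u = σ u} := by
  classical
  have := Fintype.ofFinite (L ≃+* L)
  have hσ := ne_one_of_mul_self_ne_one h3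
  ext T
  constructor
  · rintro ⟨T', hT⟩
    obtain ⟨t, ht⟩ := exists_eq_sum_mul_ringEquiv T
    have key : ∀ a g, a * t g + c * ρ a * σ (t (g * σ⁻¹)) -
        ((if g = 1 then T' a else 0) + if g = σ then c * ρ (T' a) else 0) = 0 := by
      intro a g
      refine sum_mul_ringEquiv_eq_zero (c := fun g => a * t g + c * ρ a * σ (t (g * σ⁻¹)) -
        ((if g = 1 then T' a else 0) + if g = σ then c * ρ (T' a) else 0)) (fun b => ?_) g
      have h := hT a b
      simp only [twistedMul] at h
      have h5 : σ (T b) = ∑ g, σ (t (g * σ⁻¹)) * g b := by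
        rw [ht, map_sum]
        refine Eq.trans ?_ (Equiv.sum_comp (Equiv.mulRight σ) _)
        refine Finset.sum_congr rfl fun g _ => ?_
        simp only [Equiv.coe_mulRight]
        rw [mul_inv_cancel_right, map_mul, ringAut_mul_comm g σ,
          RingAut.mul_apply]
      rw [h5, ht] at h
      simp only [sub_mul, add_mul, ite_mul, zero_mul, Finset.sum_sub_distrib, Finset.sum_add_distrib,
        Finset.sum_ite_eq', Finset.mem_univ, if_true, RingAut.one_apply]
      rw [h, Finset.mul_sum, Finset.mul_sum]
      simp only [mul_assoc]
      ring
    have hz : ∀ g, g ≠ 1 → g ≠ σ → t g = 0 ∧ t (g * σ⁻¹) = 0 := by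
      intro g hg hg'
      have h := two_term_independence h1.symm (x := t g) (y := c * σ (t (g * σ⁻¹))) fun a => by
        have := key a g
        rw [if_neg hg, if_neg hg'] at this
        rw [RingAut.one_apply]
        linear_combination this
      exact ⟨h.1, (map_eq_zero_iff _ σ.injective).1 ((mul_eq_zero.1 h.2).resolve_left hc)⟩
    have hT1 := eq_mulHom_of_coeff_eq_zero ht fun g hg =>
      coeff_eq_zero_of_mul_support hz hg fun _ => h3
    refine ⟨t 1, ?_, hT1.symm⟩
    rw [hT1] at hT
    have h := two_term_independence hσ.symm (x := T' 1 - t 1) (y := c * ρ (T' 1) - c * σ (t 1))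
      fun b => by
        have := hT 1 b
        simp only [mulHom_apply, twistedMul, map_one, map_mul] at this
        rw [RingAut.one_apply]
        linear_combination this
    have h4 : T' 1 = t 1 := by linear_combination h.1
    have h5 := h.2
    rw [h4] at h5
    refine mul_left_cancel₀ hc ?_
    linear_combination h5
  · rintro ⟨u, hu, rfl⟩
    exact mulHom_mem_middleMaps hu

include hc h1 h2 h3 in
-- The comparison is made in a instead of b, so ρ takes the place of σ. As ρ may be an involution,
-- t_ρ needs its own argument.
theorem rightMaps_twistedMul :
    rightMaps (twistedMul c ρ σ) = mulHom '' {u | σ u = u} := by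
  classical
  have := Fintype.ofFinite (L ≃+* L)
  ext T
  constructor
  · rintro ⟨T', hT⟩
    obtain ⟨t, ht⟩ := exists_eq_sum_mul_ringEquiv T
    have key : ∀ b g, t g * g b + t (g * ρ⁻¹) * (g * ρ⁻¹) (c * σ b) -
        ((if g = 1 then T' b else 0) + if g = ρ then c * σ (T' b) else 0) = 0 := by
      intro b g
      refine sum_mul_ringEquiv_eq_zero (c := fun g => t g * g b + t (g * ρ⁻¹) * (g * ρ⁻¹) (c * σ b) -
        ((if g = 1 then T' b else 0) + if g = ρ then c * σ (T' b) else 0)) (fun a => ?_) g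
      have h := hT a b
      simp only [twistedMul] at h
      rw [map_add, ht, ht] at h
      have h5 : ∑ g, t g * g (c * ρ a * σ b) = ∑ g, t (g * ρ⁻¹) * (g * ρ⁻¹) (c * σ b) * g a := by
        refine Eq.trans ?_ (Equiv.sum_comp (Equiv.mulRight ρ) _)
        refine Finset.sum_congr rfl fun g _ => ?_
        simp only [Equiv.coe_mulRight]
        rw [mul_inv_cancel_right, mul_right_comm, map_mul, RingAut.mul_apply,
          mul_assoc]
      rw [h5] at h
      simp only [sub_mul, add_mul, ite_mul, zero_mul, Finset.sum_sub_distrib, Finset.sum_add_distrib,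
        Finset.sum_ite_eq', Finset.mem_univ, if_true, RingAut.one_apply]
      have h6 : ∑ g, t g * g (a * b) = ∑ g, t g * g b * g a :=
        Finset.sum_congr rfl fun g _ => by rw [map_mul]; ring
      rw [← h6]
      linear_combination h
    have hz : ∀ g, g ≠ 1 → g ≠ ρ → t g = 0 ∧ t (g * ρ⁻¹) = 0 := by
      intro g hg hg'
      have hne : g ≠ g * ρ⁻¹ * σ := by
        intro h
        rw [mul_assoc, eq_comm, mul_eq_left, inv_mul_eq_one] at h
        exact h2 h
      have h := two_term_independence hne (x := t g) (y := t (g * ρ⁻¹) * (g * ρ⁻¹) c) fun a => by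
        have := key a g
        rw [if_neg hg, if_neg hg', map_mul] at this
        rw [RingAut.mul_apply (g * ρ⁻¹) σ]
        linear_combination this
      refine ⟨h.1, (mul_eq_zero.1 h.2).resolve_right ?_⟩
      exact (map_ne_zero_iff _ (g * ρ⁻¹).injective).2 hc
    -- Eliminating T' from the equations at g = 1 and g = ρ leaves a relation between ρ, σ and σρσ.
    -- Here ρ differs from the other two, because ρ ≠ σ and σ² ≠ 1.
    have hρ0 : ρ * ρ = 1 → t ρ = 0 := by
      intro hρρ
      have hρi : ρ⁻¹ = ρ := inv_eq_of_mul_eq_one_left hρρ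
      have hne : ρ ≠ σ * ρ * σ := by
        intro h
        rw [ringAut_mul_comm σ ρ, mul_assoc, eq_comm, mul_eq_left] at h
        exact h3 h
      have hb : ∀ b, t ρ * ρ b + t 1 * c * σ b - c * σ (t 1) * σ b -
          c * σ (t ρ * ρ c) * (σ * ρ * σ) b = 0 := by
        intro b
        have e1 := key b 1
        have e2 := key b ρ
        rw [if_pos rfl, if_neg h1.symm, one_mul, hρi, map_mul, RingAut.one_apply] at e1
        rw [if_neg h1, if_pos rfl, mul_inv_cancel, RingAut.one_apply] at e2
        have e3 : T' b = t 1 * b + t ρ * (ρ c * ρ (σ b)) := by linear_combination -e1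
        rw [e3] at e2
        simp only [map_add, map_mul, RingAut.mul_apply] at e2 ⊢
        linear_combination e2
      have := sum_mul_ringEquiv_eq_zero (c := fun g => (if g = ρ then t ρ else 0) +
        (if g = σ then t 1 * c - c * σ (t 1) else 0) -
        (if g = σ * ρ * σ then c * σ (t ρ * ρ c) else 0)) (fun b => by
          simp only [sub_mul, add_mul, ite_mul, zero_mul, Finset.sum_sub_distrib,
            Finset.sum_add_distrib, Finset.sum_ite_eq', Finset.mem_univ, if_true]
          linear_combination hb b) ρ
      simpa [h2, hne] using this
    have hT1 := eq_mulHom_of_coeff_eq_zero ht fun g hg => by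
      by_cases hgρ : g = ρ ∧ ρ * ρ = 1
      · rw [hgρ.1, hρ0 hgρ.2]
      · exact coeff_eq_zero_of_mul_support hz hg fun h h' => hgρ ⟨h, h'⟩
    refine ⟨t 1, ?_, hT1.symm⟩
    rw [hT1] at hT
    have h := two_term_independence h1.symm (x := t 1 - T' 1) (y := t 1 * c - c * σ (T' 1))
      fun a => by
        have := hT a 1
        simp only [mulHom_apply, twistedMul, map_one] at this
        rw [RingAut.one_apply]
        linear_combination this
    have h4 : T' 1 = t 1 := by linear_combination -h.1
    have h5 := h.2
    rw [h4] at h5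
    refine mul_left_cancel₀ hc ?_
    linear_combination -h5
  · rintro ⟨u, hu, rfl⟩
    exact mulHom_mem_rightMaps hu

include hc h1 h2 h3 in
theorem mapParams_twistedMul : mapParams (twistedMul c ρ σ) = ⟨Nat.card L,
    Nat.card {u | ρ u = u}, Nat.card {u | ρ u = σ u}, Nat.card {u | σ u = u},
    Nat.card {u | ρ u = u ∧ σ u = u}⟩ := by
  ext
  · rfl
  · show Nat.card (leftMaps _) = _
    rw [leftMaps_twistedMul hc h2 h3, Nat.card_image_of_injective mulHom_injective]
  · show Nat.card (middleMaps _) = _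
    rw [middleMaps_twistedMul hc h1 h3, Nat.card_image_of_injective mulHom_injective]
  · show Nat.card (rightMaps _) = _
    rw [rightMaps_twistedMul hc h1 h2 h3, Nat.card_image_of_injective mulHom_injective]
  · show Nat.card (centreMaps _) = _
    rw [centreMaps, leftMaps_twistedMul hc h2 h3, rightMaps_twistedMul hc h1 h2 h3,
      ← Set.image_inter mulHom_injective, Nat.card_image_of_injective mulHom_injective]
    rfl

/-- In the degenerate cases all left maps are right maps. -/
theorem leftMaps_twistedMul_subset (hmul : ∀ a b, twistedMul c ρ σ a b = 0 → a = 0 ∨ b = 0)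
    (h : c = 0 ∨ ρ = 1 ∨ ρ = σ) :
    leftMaps (twistedMul c ρ σ) ⊆ rightMaps (twistedMul c ρ σ) := by
  rcases h with rfl | rfl | rfl
  · exact leftMaps_subset_of_comm fun a b => by simp only [twistedMul]; ring
  -- For ρ = 1 the product is a β(b) with β bijective, that is, an isotope of the field.
  · rintro T ⟨T', hT⟩
    let β : L →+ L := AddMonoidHom.mk' (fun b => b + c * σ b) fun a b => by
      simp only [map_add]; ring
    have hβ : ∀ a b, twistedMul c 1 σ a b = a * β b := fun a b => by
      simp only [twistedMul, RingAut.one_apply, β, AddMonoidHom.mk'_apply]; ring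
    have hinj : Function.Injective β := (injective_iff_map_eq_zero β).2 fun b hb =>
      (hmul 1 b (by rw [hβ, hb, mul_zero])).resolve_left one_ne_zero
    have hsurj : Function.Surjective β := Finite.surjective_of_injective hinj
    choose γ hγ using hsurj
    simp only [hβ] at hT
    have hT2 : ∀ a x, T (a * x) = T' a * x := fun a x => by
      rw [← hγ x, hT]
    refine ⟨fun b => γ (T' (β b)), fun a b => ?_⟩
    rw [hβ, hβ, hγ, mul_comm, hT2, mul_comm]
  · exact leftMaps_subset_of_comm fun a b => by simp only [twistedMul]; ring

end

namespace SData

open SkewRing SkewData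

variable {q n : ℕ} (S : SData.{u} q n 1)

theorem f_eq : S.f = const (S.f.coeff 0) + var := by
  have h1 := mem_degLT_natDegree S.f
  have h2 : S.f.coeff S.f.natDegree = 1 := S.f_monic
  rw [S.natDegree_f] at h1 h2
  have h := eq_sum_of_mem_degLT h1
  rw [Finset.sum_range_succ, Finset.sum_range_one, h2, SkewRing.monomial_zero_left] at h
  exact h

/-- For `s = 1` the presemifield is a generalized twisted field. -/
theorem isotopic_twistedMul :
    Isotopic (twistedMul (-(S.η * S.f.coeff 0)) S.ρ S.aut) S.mul := by
  have hc : ∀ a : S.L, (const a : S.R) ∈ degLT S.aut S.f.natDegree := fun a => by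
    rw [S.natDegree_f]; exact const_mem_degLT a
  let h : S.L →+ S.Carrier :=
    (SkewRing.mk S.f).toAddMonoidHom.comp (const : S.L →+* S.R).toAddMonoidHom
  have happ : ∀ a, h a = SkewRing.mk S.f (const a) := fun a => rfl
  have hinj : Function.Injective h := fun a b hab => by
    simpa using congrArg (fun p => SkewRing.coeff p 0) (mk_injOn (hc a) (hc b) hab)
  have hbij : Function.Bijective h := hinj.bijective_of_nat_card_le (by
    rw [S.card_carrier S.two_le, S.card_L, mul_one])
  let e : S.L ≃+ S.Carrier := AddEquiv.ofBijective h hbij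
  refine ⟨e, e, e, fun a b => ?_⟩
  show SkewRing.mk S.f (const _) = S.mul (SkewRing.mk S.f (const a)) (SkewRing.mk S.f (const b))
  -- Modulo f = x + f_0, the class of x is that of -f_0.
  have hv : ∀ x : S.L, SkewRing.mk S.f (const x * var) = -SkewRing.mk S.f (const (x * S.f.coeff 0)) := by
    intro x
    have h1 : (const x * var : S.R) = const x * S.f - const (x * S.f.coeff 0) := by
      conv_rhs => rw [S.f_eq]
      rw [mul_add, map_mul]
      simp
    rw [h1, map_sub, mk_mul_self, zero_sub]
  rw [mul_eq, spread, rep_mk S.f_monic (hc a), coeff_const_zero, ← mk_mul, add_mul, ← map_mul,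
    monomial_eq, pow_one, mul_assoc, var_mul_const, ← mul_assoc, ← map_mul, map_add (SkewRing.mk S.f),
    hv, twistedMul, map_add, map_add, ← map_neg, ← map_neg]
  congr 3
  ring

end SData

/-! ### Frobenius powers and the exponents in the table -/

section
variable {p : ℕ} [Fact p.Prime] {L : Type u} [Field L] [Finite L] [Algebra (ZMod p) L]

/-- By Artin, the degree of L over the fixed field of τ is the order of τ. -/
theorem card_fixed_pow_orderOf (τ : L ≃ₐ[ZMod p] L) :
    Nat.card {x : L | τ x = x} ^ orderOf τ = Nat.card L := by
  have : Module.Finite (ZMod p) L := Module.Finite.of_finite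
  set F := IntermediateField.fixedField (Subgroup.zpowers τ)
  have hF : {x : L | τ x = x} = (F : Set L) := by
    ext x
    constructor
    · rintro hx ⟨g, hg⟩
      obtain ⟨i, rfl⟩ := hg
      have : τ ∈ MulAction.stabilizer (L ≃ₐ[ZMod p] L) x := hx
      exact (MulAction.stabilizer (L ≃ₐ[ZMod p] L) x).zpow_mem this i
    · intro hx
      exact hx ⟨τ, Subgroup.mem_zpowers τ⟩
  rw [hF, ← Nat.card_zpowers, ← IntermediateField.finrank_fixedField_eq_card]
  exact (Module.natCard_eq_pow_finrank (K := F) (V := L)).symm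

variable (p L) in
/-- The Frobenius automorphism. -/
noncomputable abbrev frob : L ≃ₐ[ZMod p] L := FiniteField.frobeniusAlgEquivOfAlgebraic (ZMod p) L

/-- The z-th Frobenius power has order N / gcd(N, z). Integer exponents are allowed because ρ⁻¹σ^s
leads to a difference. -/
theorem card_fixed_frob_zpow {N : ℕ} (hN : Nat.card L = p ^ N) (z : ℤ) :
    Nat.card {x : L | (frob p L ^ z) x = x} = p ^ Int.gcd N z := by
  have hp : p.Prime := Fact.out
  have : Module.Finite (ZMod p) L := Module.Finite.of_finite
  have hN0 : 0 < N := by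
    rw [Nat.pos_iff_ne_zero]
    rintro rfl
    have := Finite.one_lt_card (α := L)
    rw [hN, pow_zero] at this
    exact lt_irrefl _ this
  have hfin : orderOf (frob p L) = N := by
    rw [FiniteField.orderOf_frobeniusAlgEquivOfAlgebraic]
    rw [Module.natCard_eq_pow_finrank (K := ZMod p), Nat.card_zmod] at hN
    exact Nat.pow_right_injective hp.one_lt hN
  have hord : orderOf (frob p L ^ z) = N / Int.gcd N z := by
    have : orderOf (frob p L ^ z) = orderOf (frob p L ^ z.natAbs) := by
      rcases Int.natAbs_eq z with h | h
      · conv_lhs => rw [h, zpow_natCast]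
      · conv_lhs => rw [h, zpow_neg, zpow_natCast, orderOf_inv]
    rw [this, orderOf_pow, hfin, Int.gcd, Int.natAbs_natCast]
  have hd : Int.gcd N z ∣ N := by exact_mod_cast Int.gcd_dvd_left (a := (N : ℤ)) (b := z)
  have h := card_fixed_pow_orderOf (frob p L ^ z)
  rw [hord, hN] at h
  obtain ⟨r, hr⟩ := hd
  set d := Int.gcd N z
  have hd0 : 0 < d := Nat.pos_of_ne_zero fun h0 => by rw [h0, zero_mul] at hr; omega
  have hr0 : r ≠ 0 := by rintro rfl; omega
  have hq : N / d = r := by rw [hr, Nat.mul_div_cancel_left _ hd0]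
  rw [hq] at h
  refine Nat.pow_left_injective hr0 ?_
  simp only
  rw [h, ← pow_mul, ← hr]

theorem exists_frob_pow_eq (τ : L ≃ₐ[ZMod p] L) : ∃ h : ℕ, frob p L ^ h = τ := by
  have : Module.Finite (ZMod p) L := Module.Finite.of_finite
  obtain ⟨i, hi⟩ := (FiniteField.bijective_frobeniusAlgEquivOfAlgebraic_pow (ZMod p) L).2 τ
  exact ⟨i, hi⟩

theorem frob_pow_apply (i : ℕ) (x : L) : (frob p L ^ i) x = (frob p L)^[i] x := by
  rw [AlgEquiv.coe_pow]

/-- The elements fixed by two powers of the Frobenius automorphism. -/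
theorem card_fixed_frob_pow_inter {N : ℕ} (hN : Nat.card L = p ^ N) (h m : ℕ) :
    Nat.card {x : L | (frob p L ^ h) x = x ∧ (frob p L ^ m) x = x} = p ^ (N.gcd m).gcd h := by
  have hp : p.Prime := Fact.out
  have : Module.Finite (ZMod p) L := Module.Finite.of_finite
  have hfin : orderOf (frob p L) = N := by
    rw [FiniteField.orderOf_frobeniusAlgEquivOfAlgebraic]
    rw [Module.natCard_eq_pow_finrank (K := ZMod p), Nat.card_zmod] at hN
    exact Nat.pow_right_injective hp.one_lt hN
  have h1 : {x : L | (frob p L ^ h) x = x ∧ (frob p L ^ m) x = x} =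
      {x : L | (frob p L ^ (((N.gcd m).gcd h : ℕ) : ℤ)) x = x} := by
    ext x
    simp only [Set.mem_ofPred_eq, zpow_natCast, frob_pow_apply]
    constructor
    · rintro ⟨hh, hm⟩
      have hNx : Function.IsPeriodicPt (frob p L) N x := by
        show (frob p L)^[N] x = x
        rw [← frob_pow_apply, ← hfin, pow_orderOf_eq_one]
        rfl
      exact Function.IsPeriodicPt.gcd (hNx.gcd hm) hh
    · intro hx
      have hx' : Function.IsPeriodicPt (frob p L) ((N.gcd m).gcd h) x := hx
      exact ⟨hx'.trans_dvd (Nat.gcd_dvd_right _ _),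
        hx'.trans_dvd ((Nat.gcd_dvd_left _ _).trans (Nat.gcd_dvd_right _ _))⟩
  rw [h1, card_fixed_frob_zpow hN, Int.gcd_natCast_natCast,
    Nat.gcd_eq_right ((Nat.gcd_dvd_left _ _).trans (Nat.gcd_dvd_left _ _))]

end

namespace SkewData

variable {q n s : ℕ} (S : SkewData.{u} q n s)

/-- The parameters of the twisted constructions, in terms of Frobenius powers, are tabulated. -/
theorem tabulatedParams (ρ : S.L ≃+* S.L) : TabulatedParams ⟨q ^ (n * s),
    Nat.card {u : S.L | ρ u = u}, Nat.card {u : S.L | ρ u = (S.aut ^ s) u}, q ^ s,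
    Nat.card {u : S.L | ρ u = u ∧ S.aut u = u}⟩ := by
  obtain ⟨p, e, hp, he, hq⟩ : ∃ p e : ℕ, p.Prime ∧ 0 < e ∧ p ^ e = q := by
    have := Fintype.ofFinite S.K
    have h := FiniteField.isPrimePow_card S.K
    rwa [← Nat.card_eq_fintype_card, S.card_K, isPrimePow_nat_iff] at h
  have : Fact p.Prime := ⟨hp⟩
  have hcard : Nat.card S.L = p ^ (n * e) := by rw [S.card_L, ← hq, ← pow_mul, mul_comm]
  have : CharP S.L p := by
    have := Fintype.ofFinite S.L
    exact charP_of_card_eq_prime_pow (Nat.card_eq_fintype_card.symm.trans hcard)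
  let := ZMod.algebra S.L p
  have : Module.Finite (ZMod p) S.L := Module.Finite.of_finite
  obtain ⟨h, hh⟩ := exists_frob_pow_eq ((algEquivEquivRingEquiv p).symm ρ)
  obtain ⟨m, hm⟩ := exists_frob_pow_eq ((algEquivEquivRingEquiv p).symm S.aut)
  have hρ : ∀ x, ρ x = (frob p S.L ^ h) x := fun x => by rw [hh]; rfl
  have haut : ∀ x, S.aut x = (frob p S.L ^ m) x := fun x => by rw [hm]; rfl
  have hautpow : ∀ (i : ℕ) x, (S.aut ^ i) x = (frob p S.L ^ (m * i)) x := by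
    intro i
    induction i with
    | zero => intro x; rfl
    | succ i ih => intro x; rw [pow_succ, RingAut.mul_apply, ih, haut, mul_add, mul_one, pow_add]; rfl
  have hfin : orderOf (frob p S.L) = n * e := by
    rw [FiniteField.orderOf_frobeniusAlgEquivOfAlgebraic]
    rw [Module.natCard_eq_pow_finrank (K := ZMod p), Nat.card_zmod] at hcard
    exact Nat.pow_right_injective hp.one_lt hcard
  have hn := S.n_pos
  -- The order of σ, as m-th Frobenius power, is ne / gcd(ne, m), and it equals n. So m = ej with j
  -- prime to n.
  have hgcd : (n * e).gcd m = e := by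
    have h1 : orderOf (frob p S.L ^ m) = n := by
      refine Eq.trans ?_ S.orderOf_σ
      rw [orderOf_eq_orderOf_iff]
      intro i
      rw [AlgEquiv.ext_iff, AlgEquiv.ext_iff]
      refine forall_congr' fun x => ?_
      rw [← pow_mul, ← hautpow, aut_pow_apply]
      rfl
    rw [orderOf_pow, hfin] at h1
    have h2 := Nat.div_mul_cancel (Nat.gcd_dvd_left (n * e) m)
    rw [h1] at h2
    exact Nat.eq_of_mul_eq_mul_left hn h2
  obtain ⟨j, hj⟩ : e ∣ m := hgcd ▸ Nat.gcd_dvd_right _ _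
  have hco : j.Coprime n := by
    rw [hj, mul_comm n, Nat.gcd_mul_left] at hgcd
    rw [Nat.coprime_comm]
    exact Nat.eq_of_mul_eq_mul_left he (by rw [mul_one]; exact hgcd)
  have e1 : Nat.card {u : S.L | ρ u = u} = p ^ (n * e).gcd h := by
    rw [← Int.gcd_natCast_natCast, ← card_fixed_frob_zpow hcard]
    simp only [hρ, zpow_natCast]
  -- The condition says that ρ⁻¹σ^s fixes u, and this is the Frobenius power with exponent jes - h.
  have e2 : Nat.card {u : S.L | ρ u = (S.aut ^ s) u} =
      p ^ Int.gcd (n * e) (j * (e * s) - h) := by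
    have := card_fixed_frob_zpow hcard (j * (e * s) - h)
    rw [Nat.cast_mul] at this
    rw [← this]
    congr 2
    ext u
    simp only [Set.mem_ofPred_eq, hρ, hautpow]
    rw [sub_eq_neg_add, zpow_add, zpow_neg, zpow_natCast,
      show ((j : ℤ) * (e * s)) = ((m * s : ℕ) : ℤ) by rw [hj]; push_cast; ring, zpow_natCast]
    show _ ↔ (frob p S.L ^ h).symm _ = u
    rw [AlgEquiv.symm_apply_eq, eq_comm]
    rfl
  have e3 : Nat.card {u : S.L | ρ u = u ∧ S.aut u = u} = p ^ e.gcd h := by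
    have := card_fixed_frob_pow_inter hcard h m
    rw [hgcd] at this
    simpa only [hρ, haut] using this
  rw [e1, e2, e3, ← hq, ← pow_mul, ← pow_mul]
  have := TabulatedParams.twisted p e n s h j hp hco
  rwa [show n * s * e = e * (n * s) by ring] at this

end SkewData

/-! ### Arithmetic exclusion of the tabulated parameters -/

theorem perm_triple_cases {a b c x y : ℕ} (h : [a, b, c].Perm [x, x, y]) :
    (a = x ∧ b = x ∧ c = y) ∨ (a = x ∧ b = y ∧ c = x) ∨ (a = y ∧ b = x ∧ c = x) := by
  have hy : y ∈ [a, b, c] := h.mem_iff.2 (by simp)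
  have hrot : [x, x, y].Perm [y, x, x] := List.perm_append_comm (l₁ := [x, x]) (l₂ := [y])
  have key : ∀ u v w : ℕ, [u, v, w].Perm [x, x, y] → u = y → v = x ∧ w = x := by
    rintro u v w h rfl
    have h1 := (List.perm_cons u).1 (h.trans hrot)
    have h2 := (List.perm_replicate (n := 2) (a := x)).1 h1
    simpa using h2
  simp only [List.mem_cons, List.not_mem_nil, or_false] at hy
  rcases hy with h1 | h1 | h1
  · obtain ⟨h2, h3⟩ := key a b c h h1.symm
    exact Or.inr (Or.inr ⟨h1.symm, h2, h3⟩)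
  · obtain ⟨h2, h3⟩ := key b a c ((List.Perm.swap a b [c]).trans h) h1.symm
    exact Or.inr (Or.inl ⟨h2, h1.symm, h3⟩)
  · have h4 : [c, a, b].Perm [a, b, c] := List.perm_append_comm (l₁ := [c]) (l₂ := [a, b])
    obtain ⟨h2, h3⟩ := key c a b (h4.trans h) h1.symm
    exact Or.inl ⟨h2, h3, h1.symm⟩

section
variable {t s : ℕ}

/-- A parity argument. Write 2s = tu. If u is odd, s | ty forces 2s | ty, against the second gcd. If
u is even, then s = tw, with w odd since 2t ∤ s. Now y even again gives 2s | ty, while y odd makes x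
even, so that 2t divides the first gcd. -/
theorem false_of_gcd_eq (hs : 0 < s) (ht : 0 < t) (hns : ¬ 2 * t ∣ s) {x y : ℤ} (hxy : Odd (x + y))
    (hx : Int.gcd (2 * s) (t * x) = t) (hy : Int.gcd (2 * s) (t * y) = s) : False := by
  have hs' : (0 : ℤ) < s := by exact_mod_cast hs
  have ht' : (t : ℤ) ≠ 0 := by exact_mod_cast ht.ne'
  have cx : ∀ d : ℤ, d ∣ 2 * s → d ∣ t * x → d ∣ t := fun d h1 h2 => by
    rw [← hx]; exact Int.dvd_coe_gcd h1 h2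
  have cy : ∀ d : ℤ, d ∣ 2 * s → d ∣ t * y → d ∣ s := fun d h1 h2 => by
    rw [← hy]; exact Int.dvd_coe_gcd h1 h2
  have hty : ¬ (2 * s : ℤ) ∣ t * y := fun h => by
    have := Int.le_of_dvd hs' (cy _ dvd_rfl h)
    omega
  have htx : ¬ (2 * t : ℤ) ∣ s := fun h => hns (by exact_mod_cast h)
  obtain ⟨u, hu⟩ : (t : ℤ) ∣ 2 * s := by
    conv_lhs => rw [← hx]
    exact Int.gcd_dvd_left ..
  have hsy : (s : ℤ) ∣ t * y := by
    conv_lhs => rw [← hy]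
    exact Int.gcd_dvd_right ..
  rcases Int.even_or_odd u with ⟨w, hw⟩ | hodd
  · have hsw : (s : ℤ) = t * w := by rw [hw] at hu; linarith
    have hwy : w ∣ y := by
      rw [hsw] at hsy
      exact (mul_dvd_mul_iff_left ht').1 hsy
    rcases Int.even_or_odd w with ⟨v, hv⟩ | hwodd
    · exact htx ⟨v, by rw [hsw, hv]; ring⟩
    · rcases Int.even_or_odd y with hyev | hyodd
      · have hco : IsCoprime (2 : ℤ) w := by
          obtain ⟨k, hk⟩ := hwodd
          exact ⟨-k, 1, by rw [hk]; ring⟩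
        have := hco.mul_dvd hyev.two_dvd hwy
        rw [hsw, mul_left_comm] at hty
        exact hty (mul_dvd_mul_left _ this)
      · have hxev : Even x := by
          by_contra h
          rw [Int.not_even_iff_odd] at h
          exact (Int.not_even_iff_odd.2 hxy) (h.add_odd hyodd)
        have h1 := cx (2 * t) ⟨w, by rw [hsw]; ring⟩ (by
          rw [mul_comm 2]; exact mul_dvd_mul_left _ hxev.two_dvd)
        have := Int.le_of_dvd (by exact_mod_cast ht) h1
        have : (0 : ℤ) < t := by exact_mod_cast ht
        omega
  · have h1 : u ∣ 2 * y := by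
      have : (2 * s : ℤ) ∣ 2 * (t * y) := mul_dvd_mul_left _ hsy
      rw [hu, mul_left_comm] at this
      exact (mul_dvd_mul_iff_left ht').1 this
    have hco : IsCoprime u (2 : ℤ) := by
      obtain ⟨k, hk⟩ := hodd
      exact ⟨1, -k, by rw [hk]; ring⟩
    have h2 := hco.dvd_of_dvd_mul_left h1
    rw [hu] at hty
    exact hty (mul_dvd_mul_left _ h2)

variable {e : ℕ} (he : 0 < e) (ht : 2 ≤ t) (hs : 2 ≤ s) (hns : ¬ 2 * t ∣ s)
include he ht hs hns

/-- The nucleus of order p^(Es') must match q^s or q^t. For q^s one gets n' = 2t, and h and jEs' - h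
are odd multiples of te; their sum jse is then a multiple of 2te, so 2t | s because j is prime to
n'. For q^t one gets n' = 2s, j odd and E = e, and `false_of_gcd_eq` applies. -/
theorem false_of_twisted_exponents {E n' s' h j : ℕ} (hj : j.Coprime n')
    (hord : n' * s' * E = e * (2 * t * s)) (hcen : E.gcd h = e)
    (hperm : ((n' * E).gcd h = t * e ∧ Int.gcd (n' * E) (j * (E * s') - h) = t * e ∧ E * s' = s * e) ∨
      ((n' * E).gcd h = t * e ∧ Int.gcd (n' * E) (j * (E * s') - h) = s * e ∧ E * s' = t * e) ∨
      ((n' * E).gcd h = s * e ∧ Int.gcd (n' * E) (j * (E * s') - h) = t * e ∧ E * s' = t * e)) :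
    False := by
  have heZ : (e : ℤ) ≠ 0 := by exact_mod_cast he.ne'
  obtain ⟨E₁, hE₁⟩ : e ∣ E := hcen ▸ Nat.gcd_dvd_left _ _
  rw [← Int.gcd_natCast_natCast, Nat.cast_mul] at hperm
  rcases hperm with ⟨hA, hB, hR⟩ | hperm
  · have hn' : n' = 2 * t := by
      have : n' * (s * e) = 2 * t * (s * e) :=
        calc n' * (s * e) = n' * (E * s') := by rw [hR]
          _ = n' * s' * E := by ring
          _ = e * (2 * t * s) := hord
          _ = 2 * t * (s * e) := by ring
      exact Nat.eq_of_mul_eq_mul_right (by positivity) this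
    subst hn'
    have hB' : ((t * e : ℕ) : ℤ) ∣ j * (E * s') - h := hB ▸ Int.gcd_dvd_right ..
    have hA' : ((t * e : ℕ) : ℤ) ∣ h := hA ▸ Int.gcd_dvd_right ..
    -- As e | E, the number 2te divides n'E; a gcd equal to te thus rules out that 2te divides z.
    have hno : ∀ z : ℤ, Int.gcd ((2 * t : ℕ) * E) z = t * e → ¬ ((2 * (t * e) : ℕ) : ℤ) ∣ z := by
      intro z hz h'
      have h1 : ((2 * (t * e) : ℕ) : ℤ) ∣ (2 * t : ℕ) * E :=
        ⟨E₁, by rw [hE₁]; push_cast; ring⟩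
      have h2 := Int.dvd_coe_gcd h1 h'
      rw [hz] at h2
      have h3 := Nat.le_of_dvd (by positivity) (Int.natCast_dvd_natCast.1 h2)
      have : 0 < t * e := by positivity
      omega
    obtain ⟨x, hx⟩ := hA'
    obtain ⟨y, hy⟩ := hB'
    have hxo : Odd x := by
      rw [← Int.not_even_iff_odd]
      rintro ⟨k, hk⟩
      exact hno _ hA ⟨k, by rw [hx, hk]; push_cast; ring⟩
    have hyo : Odd y := by
      rw [← Int.not_even_iff_odd]
      rintro ⟨k, hk⟩
      exact hno _ hB ⟨k, by rw [hy, hk]; push_cast; ring⟩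
    obtain ⟨k, hk⟩ := hxo.add_odd hyo
    have hR' : (E * s' : ℤ) = s * e := by exact_mod_cast hR
    have h1 : (j * s : ℤ) = 2 * t * k := by
      rw [hR'] at hy
      push_cast at hx hy
      refine mul_right_cancel₀ heZ ?_
      have : (j * (s * e) : ℤ) = t * e * (x + y) := by rw [mul_add, ← hy, ← hx]; ring
      rw [hk] at this
      linarith
    have h2 : (2 * t : ℤ) ∣ j * s := ⟨k, h1⟩
    have h3 : 2 * t ∣ j * s := by exact_mod_cast h2
    exact hns (hj.symm.dvd_of_dvd_mul_left h3)
  · have hR : E * s' = t * e := by rcases hperm with h | h <;> exact h.2.2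
    have hn' : n' = 2 * s := by
      have : n' * (t * e) = 2 * s * (t * e) :=
        calc n' * (t * e) = n' * (E * s') := by rw [hR]
          _ = n' * s' * E := by ring
          _ = e * (2 * t * s) := hord
          _ = 2 * s * (t * e) := by ring
      exact Nat.eq_of_mul_eq_mul_right (by positivity) this
    subst hn'
    have hR' : (E * s' : ℤ) = t * e := by exact_mod_cast hR
    rw [hR'] at hperm
    have hth : ((t * e : ℕ) : ℤ) ∣ h := by
      rcases hperm with ⟨hA, -, -⟩ | ⟨-, hB, -⟩
      · exact hA ▸ Int.gcd_dvd_right ..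
      · have h1 : ((t * e : ℕ) : ℤ) ∣ j * (t * e) - h := hB ▸ Int.gcd_dvd_right ..
        have h2 : ((t * e : ℕ) : ℤ) ∣ j * (t * e) := ⟨j, by push_cast; ring⟩
        exact (dvd_sub_right h2).1 h1
    -- E divides Es' = te, which divides h; so E is its own gcd with h, namely e.
    have hEe : E = e := by
      have h1 : t * e ∣ h := by exact_mod_cast hth
      have h2 : E ∣ h := (hR ▸ dvd_mul_right E s').trans h1
      rw [← hcen]
      exact (Nat.gcd_eq_left h2).symm
    rw [hEe] at hperm
    obtain ⟨x, hx⟩ := hth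
    have hodd : Odd (j : ℤ) := by
      have : j.Coprime 2 := hj.coprime_mul_right_right
      rw [Nat.coprime_two_right] at this
      exact_mod_cast this
    have hred : ∀ (z : ℤ) (d : ℕ), Int.gcd ((2 * s : ℕ) * e) (e * (t * z)) = d * e →
        Int.gcd (2 * s) (t * z) = d := by
      intro z d h
      rw [mul_comm _ (e : ℤ), Int.gcd_mul_left, Int.natAbs_natCast, mul_comm d] at h
      have := Nat.eq_of_mul_eq_mul_left he h
      exact_mod_cast this
    have hxe : (h : ℤ) = e * (t * x) := by rw [hx]; push_cast; ring
    have hye : (j * (t * e) - h : ℤ) = e * (t * (j - x)) := by rw [hx]; push_cast; ring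
    rw [hye, hxe] at hperm
    rcases hperm with ⟨hA, hB, -⟩ | ⟨hA, hB, -⟩
    · exact false_of_gcd_eq (by omega) (by omega) hns (by simpa using hodd) (hred _ _ hA)
        (hred _ _ hB)
    · exact false_of_gcd_eq (by omega) (by omega) hns (x := j - x) (y := x) (by simpa using hodd)
        (hred _ _ hB) (hred _ _ hA)

end

section
variable {q t s : ℕ}

theorem left_ne_centre {P : NuclearParams} (hq : 1 < q) (ht : 2 ≤ t) (hs : 2 ≤ s)
    (h : P.SameUpToPerm ⟨q ^ (2 * t * s), q ^ t, q ^ t, q ^ s, q⟩) : P.left ≠ P.centre := by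
  have hlt : ∀ k, 2 ≤ k → q ^ k ≠ q := fun k hk h => by
    have := Nat.pow_right_injective hq (h.trans (pow_one q).symm)
    omega
  rw [show P.centre = q from h.2.2]
  have hmem : P.left ∈ [q ^ t, q ^ t, q ^ s] := h.2.1.mem_iff.1 (by simp)
  simp only [List.mem_cons, List.not_mem_nil, or_false] at hmem
  rcases hmem with h | h | h <;> rw [h]
  · exact hlt t ht
  · exact hlt t ht
  · exact hlt s hs

theorem order_ne_sq {P : NuclearParams} (hq : 1 < q) (ht : 2 ≤ t) (hs : 2 ≤ s)
    (h : P.SameUpToPerm ⟨q ^ (2 * t * s), q ^ t, q ^ t, q ^ s, q⟩) {k : ℕ}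
    (hk : k ∈ [P.left, P.middle, P.right]) : k ^ 2 < P.order := by
  have hmem : k ∈ [q ^ t, q ^ t, q ^ s] := h.2.1.mem_iff.1 hk
  rw [show P.order = _ from h.1]
  simp only [List.mem_cons, List.not_mem_nil, or_false] at hmem
  have h1 : (q ^ t) ^ 2 < q ^ (2 * t * s) := by
    rw [← pow_mul]; exact Nat.pow_lt_pow_right hq (by nlinarith)
  have h2 : (q ^ s) ^ 2 < q ^ (2 * t * s) := by
    rw [← pow_mul]; exact Nat.pow_lt_pow_right hq (by nlinarith)
  rcases hmem with h | h | h <;> rw [h] <;> assumption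

/-- All orders are powers of one prime, so exponents can be compared. That s is even enters only in
Kölsch's row. -/
theorem not_sameUpToPerm_of_tabulated (hq : IsPrimePow q) (ht : 2 ≤ t) (hs : 2 ≤ s)
    (hse : Even s) (hns : ¬ 2 * t ∣ s) {Q : NuclearParams} (hQ : TabulatedParams Q) :
    ¬ Q.SameUpToPerm ⟨q ^ (2 * t * s), q ^ t, q ^ t, q ^ s, q⟩ := by
  intro h
  have hl := left_ne_centre hq.one_lt ht hs h
  obtain ⟨p, e, hp, he, rfl⟩ := (isPrimePow_nat_iff q).1 hq
  obtain ⟨hord, hperm, hcen⟩ := h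
  have hexp : 0 < e * (2 * t * s) := by positivity
  have hprime : ∀ {p' k : ℕ}, p'.Prime → p' ^ k = (p ^ e) ^ (2 * t * s) → p' = p := by
    intro p' k hp' h
    rw [← pow_mul] at h
    have h1 : p ∣ p' ^ k := h ▸ dvd_pow_self p hexp.ne'
    exact ((Nat.prime_dvd_prime_iff_eq hp hp').1 (hp.dvd_of_dvd_pow h1)).symm
  have hpow : ∀ {a b : ℕ}, p ^ a = (p ^ e) ^ b ↔ a = b * e := fun {a b} => by
    rw [← pow_mul, mul_comm e]
    exact (Nat.pow_right_injective hp.two_le).eq_iff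
  obtain ⟨s₂, hs₂⟩ := hse
  cases hQ with
  | pottZhou => exact hl rfl
  | twisted p' E n' s' h j hp' hj =>
    obtain rfl := hprime hp' hord
    replace hord := hpow.1 hord
    have hcen' := hpow.1 (hcen.trans (pow_one _).symm)
    refine false_of_twisted_exponents he ht hs hns hj (by rw [hord, mul_comm])
      (by rw [hcen', one_mul]) ?_
    have hc := perm_triple_cases hperm
    simpa only [hpow] using hc
  | cyclic p' E n' s' hp' =>
    obtain rfl := hprime hp' hord
    replace hord := hpow.1 hord
    have hcen' := hpow.1 (hcen.trans (pow_one _).symm)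
    have hc := perm_triple_cases hperm
    simp only [hpow] at hc
    rw [one_mul] at hcen'
    subst hcen'
    -- Every matching forces n' = t and s' = s, so the order would be q^(ts) instead of q^(2ts).
    have h1 : E * n' = t * E ∧ E * s' = s * E := by omega
    have h2 : n' = t := Nat.eq_of_mul_eq_mul_left he (by rw [h1.1, mul_comm])
    have h3 : s' = s := Nat.eq_of_mul_eq_mul_left he (by rw [h1.2, mul_comm])
    subst h2 h3
    have h4 : 0 < n' * s' * E := by positivity
    have h5 : 2 * n' * s' * E = 2 * (n' * s' * E) := by ring
    omega
  | gologluKolsch p' m c z hp' =>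
    obtain rfl := hprime hp' hord
    have hc := perm_triple_cases hperm
    simp only [hpow] at hc
    have h0 : 0 < t * e := by positivity
    have h0 : 0 < s * e := by positivity
    -- Only c = te and 2c = se survives: the other matchings equate a positive number with its
    -- double.
    have h1 : s * e = 2 * t * e := by rw [mul_assoc]; omega
    exact hns (Nat.eq_of_mul_eq_mul_right he h1 ▸ dvd_rfl)
  | kolsch p' m a b z hp' =>
    obtain rfl := hprime hp' hord
    replace hord := hpow.1 hord
    have hc := perm_triple_cases hperm
    simp only [hpow] at hc
    have h1 : a.gcd (b.gcd m) = t * e ∧ (2 * a).gcd m = s * e := by omega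
    have h2 : t * e ∣ a := h1.1 ▸ Nat.gcd_dvd_left _ _
    -- Since s = 2s₂, the number 2te divides m = tse. It also divides 2a, and hence the gcd se.
    have h3 : m = 2 * (t * e) * s₂ := by
      have : 2 * m = 2 * (2 * (t * e) * s₂) := by rw [hord, hs₂]; ring
      omega
    have h4 : 2 * (t * e) ∣ s * e := h1.2 ▸ Nat.dvd_gcd (mul_dvd_mul_left 2 h2) (h3 ▸ dvd_mul_right _ _)
    rw [← mul_assoc] at h4
    exact hns (Nat.dvd_of_mul_dvd_mul_right he h4)

end

/-! ### New parameters and non-isotopy -/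

section
variable {A : Type u} {B : Type v} [AddCommGroup A] [AddCommGroup B]
  {mulA : A → A → A} {mulB : B → B → B}

theorem Isotopic.trans {C : Type*} [AddCommGroup C] {mulC : C → C → C}
    (h : Isotopic mulA mulB) (h' : Isotopic mulB mulC) : Isotopic mulA mulC := by
  obtain ⟨h₁, h₂, h₃, H⟩ := h
  obtain ⟨g₁, g₂, g₃, G⟩ := h'
  exact ⟨h₁.trans g₁, h₂.trans g₂, h₃.trans g₃, fun a b => by simp [H, G]⟩

theorem Isotopic.eq_zero_or_eq_zero (h : Isotopic mulA mulB) (hB : IsSemifield mulB) (a b : A)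
    (hab : mulA a b = 0) : a = 0 ∨ b = 0 := by
  obtain ⟨h₁, h₂, h₃, H⟩ := h
  have h := H a b
  rw [hab, map_zero] at h
  simpa using hB.eq_zero_or_eq_zero _ _ h.symm

theorem Isotopic.left_eq_centre (h : Isotopic mulA mulB) (hB : IsSemifield mulB)
    (hA : leftMaps mulA ⊆ rightMaps mulA) :
    (nuclearParams mulB).left = (nuclearParams mulB).centre := by
  rw [hB.nuclearParams_eq, ← h.mapParams_eq]
  exact left_eq_centre_of_leftMaps_subset hA

end

namespace NuclearParams

theorem SameUpToPerm.symm {P Q : NuclearParams} (h : P.SameUpToPerm Q) : Q.SameUpToPerm P :=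
  ⟨h.1.symm, h.2.1.symm, h.2.2.symm⟩

theorem SameUpToPerm.trans {P Q T : NuclearParams} (h : P.SameUpToPerm Q) (h' : Q.SameUpToPerm T) :
    P.SameUpToPerm T :=
  ⟨h.1.trans h'.1, h.2.1.trans h'.2.1, h.2.2.trans h'.2.2⟩

theorem SameUpToPerm.refl (P : NuclearParams) : P.SameUpToPerm P := ⟨rfl, .refl _, rfl⟩

end NuclearParams

theorem SkewData.isPrimePow {q n s : ℕ} (S : SkewData.{u} q n s) : IsPrimePow q := by
  have := Fintype.ofFinite S.K
  have h := FiniteField.isPrimePow_card S.K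
  rwa [← Nat.card_eq_fintype_card, S.card_K] at h

theorem SkewData.tabulatedParams_cyclic {q n s : ℕ} (S : SkewData.{u} q n s) :
    TabulatedParams ⟨q ^ (n * s), q ^ n, q ^ n, q ^ s, q⟩ := by
  obtain ⟨p, e, hp, -, rfl⟩ := (isPrimePow_nat_iff q).1 S.isPrimePow
  have := TabulatedParams.cyclic p e n s hp
  rwa [mul_comm (n * s), pow_mul, pow_mul p e n, pow_mul p e s] at this

/-- The parameters of a semifield isotopic to some `S_{n,s,1}(η, ρ, F)` are tabulated, unless it
has rank two or its left nucleus and its centre have the same order. -/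
theorem SData.nuclearParams_of_isotopic {B : Type v} [AddCommGroup B] {mul : B → B → B}
    (hB : IsSemifield mul) {q n s : ℕ} (S : SData.{u} q n s) (h : Isotopic S.mul mul) :
    TabulatedParams (nuclearParams mul) ∨
      (nuclearParams mul).order ≤ (nuclearParams mul).right ^ 2 ∨
      (nuclearParams mul).left = (nuclearParams mul).centre := by
  have hP : nuclearParams mul = mapParams S.mul := by rw [hB.nuclearParams_eq, h.mapParams_eq]
  rcases S.two_le.eq_or_lt with hn | hn
  -- For n = 2 the right invariant is at least q^s, the square root of the order.
  · refine Or.inr (Or.inl ?_)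
    rw [hP]
    calc Nat.card S.Carrier = (q ^ s) ^ 2 := by
          rw [S.card_carrier S.two_le, ← pow_mul, mul_comm s, hn]
      _ ≤ _ := Nat.pow_le_pow_left (S.le_card_rightMaps S.mul_eq S.two_le) 2
  rcases (Nat.succ_le_of_lt S.s_pos).eq_or_lt with hs | hs
  · obtain rfl : 1 = s := hs
    by_cases hdeg : -(S.η * S.f.coeff 0) = 0 ∨ S.ρ = 1 ∨ S.ρ = S.aut
    · have h' := S.isotopic_twistedMul.trans h
      exact Or.inr (Or.inr (h'.left_eq_centre hB
        (leftMaps_twistedMul_subset (h'.eq_zero_or_eq_zero hB) hdeg)))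
    · push Not at hdeg
      have h3 : S.aut * S.aut ≠ 1 := fun h => by
        have h1 : ∀ a, (S.aut ^ 2) a = (S.aut ^ 0) a := fun a => by rw [pow_two, h, pow_zero]
        rw [S.aut_pow_eq_iff] at h1
        have := Nat.le_of_dvd two_pos ((Nat.modEq_zero_iff_dvd).1 h1)
        omega
      have h4 := S.tabulatedParams S.ρ
      rw [hP, ← S.isotopic_twistedMul.mapParams_eq,
        mapParams_twistedMul hdeg.1 hdeg.2.1 hdeg.2.2 h3, S.card_L, S.card_fixed]
      simp only [mul_one, pow_one] at h4
      exact Or.inl h4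
  · left
    rw [hP]
    by_cases hη : S.η = 0
    · rw [S.mapParams_mul_of_eta_eq_zero hn hs hη]
      exact S.tabulatedParams_cyclic
    · rw [S.mapParams_mul_of_eta_ne_zero hn hs hη]
      exact S.tabulatedParams S.ρ

section
variable {q t s : ℕ} (hq : IsPrimePow q) (ht : 2 ≤ t) (hs : 2 ≤ s) (hse : Even s)
  (hns : ¬ 2 * t ∣ s)
include hq ht hs hse hns

/-- The square of each nucleus order is smaller than q^(2ts), which excludes rank two; left nucleus
and centre differ, which excludes commutative and degenerate presemifields; everything else is in
the table. -/
theorem isNewParams : IsNewParams.{v} ⟨q ^ (2 * t * s), q ^ t, q ^ t, q ^ s, q⟩ := by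
  intro B _ mul hB hknown hperm
  have hlc := left_ne_centre hq.one_lt ht hs hperm
  have hsq := fun k => order_ne_sq (k := k) hq.one_lt ht hs hperm
  cases hknown with
  | rankTwo h =>
    rcases h with h | h | h
    · exact (hsq _ (by simp)).ne' (h.trans rfl : _ = (nuclearParams mul).left ^ 2)
    · exact (hsq _ (by simp)).ne' (h.trans rfl : _ = (nuclearParams mul).middle ^ 2)
    · exact (hsq _ (by simp)).ne' (h.trans rfl : _ = (nuclearParams mul).right ^ 2)
  | pottZhou p m k hp hodd hm E hE τ α hα h =>
    exact hlc (h.left_eq_centre hB (leftMaps_subset_of_comm (pottZhouMul_comm p k τ α)))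
  | skew q' n' s' S h =>
    rcases S.nuclearParams_of_isotopic hB h with h | h | h
    · exact not_sameUpToPerm_of_tabulated hq ht hs hse hns h hperm
    · exact (hsq _ (by simp)).not_ge h
    · exact hlc h
  | tabulated Q hQ h =>
    exact not_sameUpToPerm_of_tabulated hq ht hs hse hns hQ (h.symm.trans hperm)

end

theorem DData.not_isotopic_of_isNewParams {q t s : ℕ} (D : DData.{u} q (2 * t) s) (ht : 2 ≤ t)
    (hnew : IsNewParams.{v} (nuclearParams D.mul)) {B : Type v} [AddCommGroup B]
    {mul : B → B → B} (hB : IsSemifield mul) (hknown : IsKnown mul) : ¬ Isotopic D.mul mul :=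
  fun h => hnew B mul hB hknown
    (h.nuclearParams_eq (D.isSemifield_mul ht) hB ▸ NuclearParams.SameUpToPerm.refl _)

/-! ### Existence of members of the family D -/

namespace SkewRing

section
variable {L : Type u} [Field L] {σ : L ≃+* L}

/-- Induction on the degree: if p = ab with non-units a and b, then b has smaller degree, and its
right factors are right factors of p. -/
theorem exists_monic_irreducible_right_factor {p : SkewRing σ} (hp : p ≠ 0) (hu : ¬ IsUnit p) :
    ∃ f : SkewRing σ, f.Monic ∧ Irreducible f ∧ ∃ g, p = g * f := by
  induction hd : p.natDegree using Nat.strong_induction_on generalizing p with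
  | _ d ih =>
    by_cases hirr : Irreducible p
    · have hc := coeff_natDegree_ne_zero hp
      obtain ⟨w, hw⟩ := isUnit_const (σ := σ) (inv_ne_zero hc)
      refine ⟨_, monic_const_inv_mul hp, ?_, const (p.coeff p.natDegree), ?_⟩
      · rw [← hw, irreducible_units_mul]
        exact hirr
      · rw [← mul_assoc, ← map_mul, mul_inv_cancel₀ hc, map_one, one_mul]
    · rw [irreducible_iff] at hirr
      push Not at hirr
      obtain ⟨a, b, hab, ha, hb⟩ := hirr hu
      have ha0 : a ≠ 0 := fun h => hp (by rw [hab, h, zero_mul])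
      have hb0 : b ≠ 0 := fun h => hp (by rw [hab, h, mul_zero])
      have hda : a.natDegree ≠ 0 := fun h => ha (isUnit_iff.2 ⟨ha0, h⟩)
      have hdp := natDegree_mul ha0 hb0
      rw [← hab, hd] at hdp
      obtain ⟨f, hf, hf', g, hg⟩ := ih b.natDegree (by omega) hb0 hb rfl
      exact ⟨f, hf, hf', a * g, by rw [hab, hg, mul_assoc]⟩

end

end SkewRing

section
variable {K L : Type*} [Field K] [Field L] [Finite L] [Algebra K L]

/-- The Galois group is cyclic of order 2t; the t-th power of a generator has order 2, and its fixed
field has degree t. -/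
theorem exists_intermediateField_of_finrank_eq {t : ℕ} (ht : 0 < t)
    (h : Module.finrank K L = 2 * t) :
    ∃ L' : IntermediateField K L, Module.finrank K L' = t := by
  have : FiniteDimensional K L := Module.Finite.of_finite
  obtain ⟨τ, hτ⟩ := IsCyclic.exists_ofOrder_eq_natCard (α := L ≃ₐ[K] L)
  rw [IsGalois.card_aut_eq_finrank, h] at hτ
  have h1 := IntermediateField.finrank_fixedField_eq_card (Subgroup.zpowers (τ ^ t))
  rw [Nat.card_zpowers, orderOf_pow, hτ, Nat.gcd_mul_left_left,
    Nat.mul_div_cancel _ ht] at h1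
  refine ⟨IntermediateField.fixedField (Subgroup.zpowers (τ ^ t)), ?_⟩
  have h2 := Module.finrank_mul_finrank K (IntermediateField.fixedField (Subgroup.zpowers (τ ^ t))) L
  rw [h1, h] at h2
  omega

/-- Start from any γ with nonsquare norm. If γ/c lies in L', replace γ by γw² with w² outside L';
the square class of the norm does not change. -/
theorem exists_norm_not_isSquare [Finite K] (hK : ringChar K ≠ 2) (L' : IntermediateField K L) (hL' : L' ≠ ⊤)
    {c : L} (hc : c ≠ 0) : ∃ γ : L, γ / c ∉ L' ∧ ¬ IsSquare (Algebra.norm K γ) := by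
  obtain ⟨a, ha⟩ := FiniteField.exists_nonsquare hK
  obtain ⟨γ, rfl⟩ := FiniteField.norm_surjective K L a
  by_cases hγ : γ / c ∈ L'
  · have h2 : (2 : L) ≠ 0 := by
      have h := Ring.two_ne_zero hK
      rw [← map_ofNat (algebraMap K L) 2]
      exact (_root_.map_ne_zero _).2 h
    have hγ0 : γ ≠ 0 := fun h => ha (by rw [h, Algebra.norm_zero]; exact IsSquare.zero)
    -- In odd characteristic w = ((w+1)² - w² - 1)/2, so a subfield containing all squares is the
    -- whole field.
    obtain ⟨w, hw⟩ : ∃ w : L, w ^ 2 ∉ L' := by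
      by_contra! H
      refine hL' (eq_top_iff.2 fun w _ => ?_)
      have h3 : w = ((w + 1) ^ 2 - w ^ 2 - 1) / 2 := by field_simp; ring
      rw [h3]
      exact L'.div_mem (L'.sub_mem (L'.sub_mem (H _) (H _)) L'.one_mem) (ofNat_mem L' 2)
    have hw0 : w ≠ 0 := fun h => hw (by rw [h, zero_pow two_ne_zero]; exact L'.zero_mem)
    refine ⟨γ * w ^ 2, fun h => hw ?_, fun h => ha ?_⟩
    · have h3 : w ^ 2 = γ * w ^ 2 / c / (γ / c) := by field_simp
      rw [h3]
      exact L'.div_mem h hγ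
    · have hN : Algebra.norm K w ≠ 0 := Algebra.norm_ne_zero_iff.2 hw0
      have h3 : Algebra.norm K γ = Algebra.norm K (γ * w ^ 2) / (Algebra.norm K w * Algebra.norm K w) := by
        rw [map_mul, map_pow, pow_two, mul_div_cancel_right₀ _ (mul_ne_zero hN hN)]
      rw [h3]
      exact h.div ⟨_, rfl⟩
  · exact ⟨γ, hγ, ha⟩

end

/-- The minimal polynomial of a primitive element of the extension of degree s. -/
theorem exists_monic_irreducible_natDegree (K : Type*) [Field K] [Finite K] {s : ℕ} (hs : 0 < s) :
    ∃ F : K[X], F.Monic ∧ Irreducible F ∧ F.natDegree = s := by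
  obtain ⟨p, hp⟩ := CharP.exists K
  have : Fact p.Prime := ⟨CharP.char_is_prime K p⟩
  have : NeZero s := ⟨hs.ne'⟩
  obtain ⟨α, hα⟩ := Field.exists_primitive_element K (FiniteField.Extension K p s)
  have hint : IsIntegral K α := IsIntegral.of_finite K α
  refine ⟨minpoly K α, minpoly.monic hint, minpoly.irreducible hint, ?_⟩
  rw [← IntermediateField.adjoin.finrank hint, hα, IntermediateField.finrank_top',
    FiniteField.finrank_extension]

theorem SkewData.nonempty {q n s : ℕ} (hq : IsPrimePow q) (hn : 0 < n) (hs : 2 ≤ s) :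
    Nonempty (SkewData.{0} q n s) := by
  obtain ⟨p, e, hp, he, rfl⟩ := (isPrimePow_nat_iff q).1 hq
  have : Fact p.Prime := ⟨hp⟩
  have : NeZero n := ⟨hn.ne'⟩
  obtain ⟨F, hmon, hirr, hdeg⟩ := exists_monic_irreducible_natDegree (GaloisField p e) (two_pos.trans_le hs)
  let K := GaloisField p e
  let L := FiniteField.Extension K p n
  let σ : L ≃ₐ[K] L := FiniteField.Extension.frob K p n
  set P : SkewRing (σ : L ≃+* L) :=
    F.sum fun i a => SkewRing.monomial (σ : L ≃+* L) (n * i) (algebraMap K L a) with hP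
  have hPc : P.coeff (n * s) = 1 := by
    rw [hP, Polynomial.sum, SkewRing.coeff_sum, Finset.sum_eq_single s]
    · rw [SkewRing.coeff_monomial, if_pos rfl, ← hdeg, hmon.coeff_natDegree, map_one]
    · intro i _ hi
      rw [SkewRing.coeff_monomial, if_neg fun h => hi (Nat.eq_of_mul_eq_mul_left hn h)]
    · intro h
      rw [Polynomial.notMem_support_iff, ← hdeg, hmon.coeff_natDegree] at h
      exact absurd h one_ne_zero
  have hP0 : P ≠ 0 := fun h => by
    rw [h] at hPc
    exact zero_ne_one hPc
  have hPu : ¬ IsUnit P := fun h => by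
    have h1 := SkewRing.mem_degLT_natDegree P (n * s) (by
      rw [(SkewRing.isUnit_iff.1 h).2]
      exact Nat.mul_pos hn (two_pos.trans_le hs))
    rw [hPc] at h1
    exact one_ne_zero h1
  obtain ⟨f, hf, hf', hg⟩ := SkewRing.exists_monic_irreducible_right_factor hP0 hPu
  exact ⟨{
    K := K
    L := L
    card_K := GaloisField.card p e he.ne'
    finrank_L := FiniteField.finrank_extension K p n
    σ := σ
    σ_generates := fun τ => by
      obtain ⟨i, -, hi⟩ := FiniteField.Extension.exists_frob_pow_eq K p n τ
      exact ⟨i, by simpa using hi⟩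
    F := F
    F_monic := hmon
    F_irreducible := hirr
    F_ne_X := by
      rintro rfl
      rw [natDegree_X] at hdeg
      omega
    F_natDegree := hdeg
    f := f
    f_monic := hf
    f_irreducible := hf'
    f_factor := hg }⟩

theorem DData.nonempty {q t s : ℕ} (hq : IsPrimePow q) (hodd : Odd q) (ht : 2 ≤ t) (hs : 2 ≤ s) :
    Nonempty (DData.{0} q (2 * t) s) := by
  obtain ⟨S⟩ := SkewData.nonempty (n := 2 * t) hq (by omega) hs
  obtain ⟨L', hL'⟩ := exists_intermediateField_of_finrank_eq (by omega) S.finrank_L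
  have hK : ringChar S.K ≠ 2 := by
    have := Fintype.ofFinite S.K
    intro h
    have h1 := FiniteField.even_card_of_char_two h
    rw [← Nat.card_eq_fintype_card, S.card_K, ← Nat.even_iff] at h1
    exact (Nat.not_even_iff_odd.2 hodd) h1
  have htop : L' ≠ ⊤ := by
    rintro rfl
    rw [IntermediateField.finrank_top', S.finrank_L] at hL'
    omega
  obtain ⟨γ, h1, h2⟩ := exists_norm_not_isSquare hK L' htop S.f_coeff_zero_ne
  exact ⟨{ S with
    L' := L'
    finrank_L' := by rw [hL']
    γ := γ
    γ_div_notMem := h1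
    γ_norm := h2 }⟩

/-! ### The smallest case and the final assembly -/

theorem eight_le_two_mul_mul {t s : ℕ} (ht : 2 ≤ t) (hs : 2 ≤ s) :
    8 ≤ 2 * t * s ∧ (2 * t * s = 8 ↔ t = 2 ∧ s = 2) := by
  refine ⟨by nlinarith, fun h => ⟨by nlinarith, by nlinarith⟩, ?_⟩
  rintro ⟨rfl, rfl⟩
  rfl

theorem mainTheorem12 :
    -- the multiplications define semifields with the stated parameters
    (∀ (q t s : ℕ) (D : DData.{u} q (2 * t) s), Odd q → 2 ≤ t → 2 ≤ s →
      IsSemifield D.mul ∧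
      nuclearParams D.mul = ⟨q ^ (2 * t * s), q ^ t, q ^ t, q ^ s, q⟩) ∧
    -- if moreover `s` is even and `n = 2 * t` does not divide `s`, then they are new
    (∀ (q t s : ℕ) (D : DData.{u} q (2 * t) s), Odd q → 2 ≤ t → 2 ≤ s → Even s → ¬ 2 * t ∣ s →
      IsNewParams.{v} (nuclearParams D.mul) ∧
      ∀ (B : Type v) [AddCommGroup B] (mul : B → B → B), IsSemifield mul → IsKnown mul →
        ¬ Isotopic D.mul mul) ∧
    -- the families are not empty
    (∀ q t s : ℕ, IsPrimePow q → Odd q → 2 ≤ t → 2 ≤ s → Nonempty (DData.{0} q (2 * t) s)) ∧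
    -- for every odd prime power `q`, infinitely many new parameters occur
    (∀ q : ℕ, IsPrimePow q → Odd q →
      {P : NuclearParams | IsNewParams.{v} P ∧
        ∃ (t s : ℕ) (D : DData.{0} q (2 * t) s), 2 ≤ t ∧ 2 ≤ s ∧ Even s ∧ ¬ 2 * t ∣ s ∧
          nuclearParams D.mul = P}.Infinite) ∧
    -- the smallest case is `n = 4`, `s = 2`
    (∀ q : ℕ, IsPrimePow q → Odd q →
      (∃ D : DData.{0} q 4 2, nuclearParams D.mul = ⟨q ^ 8, q ^ 2, q ^ 2, q ^ 2, q⟩ ∧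
        IsNewParams.{v} (nuclearParams D.mul)) ∧
      ∀ (t s : ℕ) (D : DData.{u} q (2 * t) s), 2 ≤ t → 2 ≤ s → Even s → ¬ 2 * t ∣ s →
        q ^ 8 ≤ Nat.card D.Carrier ∧ (Nat.card D.Carrier = q ^ 8 ↔ t = 2 ∧ s = 2)) := by
  refine ⟨fun q t s D _ ht hs => ⟨D.isSemifield_mul ht, D.nuclearParams_mul ht hs⟩,
    fun q t s D _ ht hs hse hns => ?_, fun q t s => DData.nonempty,
    fun q hq hodd => ?_, fun q hq hodd => ⟨?_, fun t s D ht hs _ _ => ?_⟩⟩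
  · have hnew := isNewParams.{v} D.isPrimePow ht hs hse hns
    rw [← D.nuclearParams_mul ht hs] at hnew
    exact ⟨hnew, fun B _ mul hB hknown => D.not_isotopic_of_isNewParams ht hnew hB hknown⟩
  -- Take n = 4 and s = 4k + 2, which is even and not divisible by 4; the right nucleus q^s
  -- separates the tuples.
  · refine Set.infinite_of_injective_forall_mem
      (f := fun k : ℕ => (⟨q ^ (2 * 2 * (4 * k + 2)), q ^ 2, q ^ 2, q ^ (4 * k + 2), q⟩ : NuclearParams))
      (fun k l h => ?_) fun k => ?_
    · have h1 := Nat.pow_right_injective hq.one_lt (congrArg NuclearParams.right h)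
      omega
    · have hs : 2 ≤ 4 * k + 2 := by omega
      have hse : Even (4 * k + 2) := ⟨2 * k + 1, by ring⟩
      have hns : ¬ 2 * 2 ∣ 4 * k + 2 := by omega
      obtain ⟨D⟩ := DData.nonempty hq hodd le_rfl hs
      exact ⟨isNewParams hq le_rfl hs hse hns, 2, _, D, le_rfl, hs, hse, hns,
        D.nuclearParams_mul le_rfl hs⟩
  · obtain ⟨D⟩ := DData.nonempty hq hodd le_rfl le_rfl
    have h := D.nuclearParams_mul le_rfl le_rfl
    refine ⟨D, h, ?_⟩
    have hnew := isNewParams.{v} hq le_rfl le_rfl even_two (by norm_num : ¬ 2 * 2 ∣ 2)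
    rwa [← h] at hnew
  · have hcard : Nat.card D.Carrier = q ^ (2 * t * s) := D.card_carrier (by omega)
    obtain ⟨h1, h2⟩ := eight_le_two_mul_mul ht hs
    rw [hcard, ← h2]
    exact ⟨Nat.pow_le_pow_right hq.pos h1, (Nat.pow_right_injective hq.one_lt).eq_iff⟩
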